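/- Let $K$ be a commutative ring with unit. A $K$-linear 2-category is a (strict) 2-category $\mathcal C$ whose sets of 2-morphisms are $K$-modules such that vertical and horizontal composition of 2-morphisms are $K$-bilinear. Write $\circ$ for the composition of 1-morphisms and for the horizontal composition of 2-morphisms. A $K$-linear Gray semigroup $(\mathcal C,\otimes)$ is a $K$-linear 2-category with a pseudofunctor $\otimes:\mathcal C\times\mathcal C\to\mathcal C$, $K$-bilinear on 2-morphisms, with structural 2-isomorphisms $\widehat\otimes((f',g'),(f,g)):(f'\otimes g')\circ(f\otimes g)\Rightarrow(f'\circ f)\otimes(g'\circ g)$ and $\otimes_0(X,Y): \mathrm{id}_X\otimes \mathrm{id}_Y\Rightarrow \mathrm{id}_{X\otimes Y}$, such that * $\otimes$ is cubical: all $\otimes_0(X,Y)$, $\widehat\otimes((f',\mathrm{id}),(f,g))$ and $\widehat\otimes((f,g'),(\mathrm{id},g))$ are identities; * the associator and the pentagonator are identities, i.e. $\otimes\circ(\otimes\times \mathrm{id})=\otimes\circ(\mathrm{id}\times\otimes)$ as pseudofunctors $\mathcal C^3\to\mathcal C$. Let $\otimes(n):\mathcal C^n\to\mathcal C$ ($n\ge1$)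 be the iterated tensor product pseudofunctor, with $\otimes(1)$ the identity. **The extended double complex.** For $m,n\ge 0$ let $X^{m,n}$ be the $K$-module of families of 2-morphisms $$\phi(f_0,\dots,f_m):\ \otimes(n+1)(f_0)\circ\cdots\circ\otimes(n+1)(f_m)\Longrightarrow\otimes(n+1)(f_0\circ\cdots\circ f_m),$$ indexed by the strings of $m+1$ composable 1-morphisms $f_i=(f_i^0,\dots,f_i^n)$ of $\mathcal C^{n+1}$, natural with respect to 2-morphisms in each $f_i$. For a 2-morphism $\tau$, $\lceil\tau\rceil$ denotes its vertical composite with the canonical 2-isomorphisms, built from $\widehat\otimes$, that give it the source and target required by the left-hand side. Define $\delta_h:X^{m,n}\to X^{m+1,n}$ by $$(\delta_h\phi)(f_0,\dots,f_{m+1})=\lceil 1_{\otimes(n+1)(f_0)}\circ\phi(f_1,\dots,f_{m+1})\rceil+\sum_{i=1}^{m+1}(-1)^i\lceil\phi(f_0,\dots,f_{i-1}\circ f_i,\dots,f_{m+1})\rceil+(-1)^{m+2}\lceil\phi(f_0,\dots,f_m)\circ1_{\otimes(n+1)(f_{m+1})}\rceil$$ and $\delta_v:X^{m,n}\to X^{m,n+1}$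 by $$(\delta_v\phi)\big((f_j^0,\dots,f_j^{n+1})_{0\le j\le m}\big)=\lceil 1_{f_0^0\circ\cdots\circ f_m^0}\otimes\phi\big((f_j^1,\dots,f_j^{n+1})_j\big)\rceil+\sum_{i=1}^{n+1}(-1)^i\lceil\phi\big((f_j^0,\dots,f_j^{i-1}\otimes f_j^i,\dots,f_j^{n+1})_j\big)\rceil+(-1)^{n+2}\lceil\phi\big((f_j^0,\dots,f_j^n)_j\big)\otimes1_{f_0^{n+1}\circ\cdots\circ f_m^{n+1}}\rceil .$$ **The general pentagonator complex.** For $n\ge0$ let $\widetilde X^n_{pent}$ be the $K$-module of all families of 2-morphisms $\mathfrak n_{X_0,\dots,X_n}:\mathrm{id}_{X_0\otimes\cdots\otimes X_n}\Rightarrow \mathrm{id}_{X_0\otimes\cdots\otimes X_n}$, indexed by the objects of $\mathcal C^{n+1}$ (no further condition), and define $\delta_{pent}:\widetilde X^n_{pent}\to\widetilde X^{n+1}_{pent}$ by $$(\delta_{pent}\mathfrak n)_{X_0,\dots,X_{n+1}}=1_{\mathrm{id}_{X_0}}\otimes\mathfrak n_{X_1,\dots,X_{n+1}}+\sum_{i=1}^{n+1}(-1)^i\mathfrak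 n_{X_0,\dots,X_{i-1}\otimes X_i,\dots,X_{n+1}}+(-1)^{n+2}\mathfrak n_{X_0,\dots,X_n}\otimes1_{\mathrm{id}_{X_{n+1}}}.$$ Define $K$-linear maps $\varphi:\widetilde X^n_{pent}\to X^{0,n}$ by $$(\varphi(\mathfrak n))(f_0,\dots,f_n)=\mathfrak n_{X_0',\dots,X_n'}\circ1_{f_0\otimes\cdots\otimes f_n}-1_{f_0\otimes\cdots\otimes f_n}\circ\mathfrak n_{X_0,\dots,X_n}$$ for 1-morphisms $(f_0,\dots,f_n):(X_0,\dots,X_n)\to(X'_0,\dots,X'_n)$ of $\mathcal C^{n+1}$. **Proposition.** (1) $(\widetilde X^\bullet_{pent},\delta_{pent})$ and the first column $(X^{0,\bullet},\delta_v)$ are cochain complexes and $\varphi$ is a cochain map: $\delta_v\varphi=\varphi\,\delta_{pent}$. (2) Replace the first column by the cone of $\varphi$: put $X^{0,n}_{mod}=X^{0,n}\oplus\widetilde X^{n+1}_{pent}$ and $X^{m,n}_{mod}=X^{m,n}$ for $m\ge1$ ($n\ge0$). Let $\delta'_v(\phi,\mathfrak n)=(\delta_v\phi+\varphi(\mathfrak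 n),-\delta_{pent}\mathfrak n)$ for $m=0$ and $\delta'_v=\delta_v$ for $m\ge1$; let $\delta'_h(\phi,\mathfrak n)=\delta_h\phi$ (the projection to $X^{0,n}$ followed by $\delta_h$) for $m=0$ and $\delta'_h=\delta_h$ for $m\ge1$. Then $(X^{\bullet,\bullet}_{mod},\delta'_h,\delta'_v)$ is a double complex: for all $m,n\ge0$, $\delta'_h\delta'_h=0$, $\delta'_v\delta'_v=0$ and $\delta'_h\delta'_v=\delta'_v\delta'_h$. -/

import Mathlib

open CategoryTheory Bicategory

universe w v u w' v' u' w'' v'' u''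

namespace GrayComplex

section Products

variable {A : Type u} [Bicategory.{w, v} A] {B : Type u} [Bicategory.{w, v} B]
  {C : Type u} [Bicategory.{w, v} C] {D : Type u} [Bicategory.{w, v} D]

/-- The product `F × G` of two pseudofunctors. -/
def prodPF (F : A ⥤ᵖ C) (G : B ⥤ᵖ D) : (A × B) ⥤ᵖ (C × D) where
  obj X := (F.obj X.1, G.obj X.2)
  map f := (F.map f.1, G.map f.2)
  map₂ τ := (F.map₂ τ.1, G.map₂ τ.2)
  map₂_id _ := Prod.ext (F.map₂_id _) (G.map₂_id _)
  map₂_comp _ _ := Prod.ext (F.map₂_comp _ _) (G.map₂_comp _ _)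
  mapId X := Iso.prod (F.mapId X.1) (G.mapId X.2)
  mapComp f g := Iso.prod (F.mapComp f.1 g.1) (G.mapComp f.2 g.2)
  map₂_whisker_left f _ _ τ :=
    Prod.ext (F.map₂_whisker_left f.1 τ.1) (G.map₂_whisker_left f.2 τ.2)
  map₂_whisker_right τ h :=
    Prod.ext (F.map₂_whisker_right τ.1 h.1) (G.map₂_whisker_right τ.2 h.2)
  map₂_associator f g h :=
    Prod.ext (F.map₂_associator f.1 g.1 h.1) (G.map₂_associator f.2 g.2 h.2)
  map₂_left_unitor f := Prod.ext (F.map₂_left_unitor f.1) (G.map₂_left_unitor f.2)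
  map₂_right_unitor f := Prod.ext (F.map₂_right_unitor f.1) (G.map₂_right_unitor f.2)

variable (A B C)

/-- The rebracketing 2-functor `A × (B × C) ⟶ (A × B) × C`. -/
def assocPF : (A × (B × C)) ⥤ᵖ ((A × B) × C) where
  obj X := ((X.1, X.2.1), X.2.2)
  map f := ((f.1, f.2.1), f.2.2)
  map₂ τ := ((τ.1, τ.2.1), τ.2.2)
  mapId X := Iso.prod (Iso.prod (Iso.refl (𝟙 X.1)) (Iso.refl (𝟙 X.2.1))) (Iso.refl (𝟙 X.2.2))
  mapComp f g := Iso.prod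
    (Iso.prod (Iso.refl (f.1 ≫ g.1)) (Iso.refl (f.2.1 ≫ g.2.1))) (Iso.refl (f.2.2 ≫ g.2.2))
  map₂_whisker_left f _ _ τ := Prod.ext (Prod.ext
    ((Pseudofunctor.id A).map₂_whisker_left f.1 τ.1)
    ((Pseudofunctor.id B).map₂_whisker_left f.2.1 τ.2.1))
    ((Pseudofunctor.id C).map₂_whisker_left f.2.2 τ.2.2)
  map₂_whisker_right τ h := Prod.ext (Prod.ext
    ((Pseudofunctor.id A).map₂_whisker_right τ.1 h.1)
    ((Pseudofunctor.id B).map₂_whisker_right τ.2.1 h.2.1))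
    ((Pseudofunctor.id C).map₂_whisker_right τ.2.2 h.2.2)
  map₂_associator f g h := Prod.ext (Prod.ext
    ((Pseudofunctor.id A).map₂_associator f.1 g.1 h.1)
    ((Pseudofunctor.id B).map₂_associator f.2.1 g.2.1 h.2.1))
    ((Pseudofunctor.id C).map₂_associator f.2.2 g.2.2 h.2.2)
  map₂_left_unitor f := Prod.ext (Prod.ext
    ((Pseudofunctor.id A).map₂_left_unitor f.1)
    ((Pseudofunctor.id B).map₂_left_unitor f.2.1))
    ((Pseudofunctor.id C).map₂_left_unitor f.2.2)
  map₂_right_unitor f := Prod.ext (Prod.ext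
    ((Pseudofunctor.id A).map₂_right_unitor f.1)
    ((Pseudofunctor.id B).map₂_right_unitor f.2.1))
    ((Pseudofunctor.id C).map₂_right_unitor f.2.2)

variable {A B C}

theorem pseudofunctor_ext {A : Type u} [Bicategory.{w, v} A] {B : Type u} [Bicategory.{w, v} B]
    {F G : A ⥤ᵖ B} (h : F.toPrelaxFunctor = G.toPrelaxFunctor)
    (hid : ∀ a, HEq (F.mapId a).hom (G.mapId a).hom)
    (hcomp : ∀ {a b c : A} (f : a ⟶ b) (g : b ⟶ c),
      HEq (F.mapComp f g).hom (G.mapComp f g).hom) : F = G := by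
  obtain ⟨P, i, k⟩ := F
  obtain ⟨Q, j, l⟩ := G
  dsimp only at h
  subst h
  have h1 : i = j := by
    funext a
    exact Iso.ext (eq_of_heq (hid a))
  have h2 : @k = @l := by
    funext a b c f g
    exact Iso.ext (eq_of_heq (hcomp f g))
  subst h1 h2
  rfl

theorem comp_assocPF {E : Type u} [Bicategory.{w, v} E] (F : A ⥤ᵖ B) (G : B ⥤ᵖ C) (H : C ⥤ᵖ E) :
    (F.comp G).comp H = F.comp (G.comp H) := by
  refine pseudofunctor_ext rfl (fun a => heq_of_eq ?_) (fun f g => heq_of_eq ?_)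
  · exact (by simp : H.map₂ (G.map₂ (F.mapId a).hom ≫ (G.mapId (F.obj a)).hom) ≫
      (H.mapId (G.obj (F.obj a))).hom = H.map₂ (G.map₂ (F.mapId a).hom) ≫
        H.map₂ (G.mapId (F.obj a)).hom ≫ (H.mapId (G.obj (F.obj a))).hom)
  · exact (by simp : H.map₂ (G.map₂ (F.mapComp f g).hom ≫ (G.mapComp (F.map f) (F.map g)).hom) ≫
      (H.mapComp (G.map (F.map f)) (G.map (F.map g))).hom = H.map₂ (G.map₂ (F.mapComp f g).hom) ≫
        H.map₂ (G.mapComp (F.map f) (F.map g)).hom ≫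
          (H.mapComp (G.map (F.map f)) (G.map (F.map g))).hom)

theorem id_compPF (F : A ⥤ᵖ B) : (Pseudofunctor.id A).comp F = F := by
  refine pseudofunctor_ext rfl (fun a => heq_of_eq ?_) (fun f g => heq_of_eq ?_)
  · exact (by simp : F.map₂ (𝟙 _) ≫ (F.mapId a).hom = (F.mapId a).hom)
  · exact (by simp : F.map₂ (𝟙 _) ≫ (F.mapComp f g).hom = (F.mapComp f g).hom)

theorem comp_idPF (F : A ⥤ᵖ B) : F.comp (Pseudofunctor.id B) = F := by
  refine pseudofunctor_ext rfl (fun a => heq_of_eq ?_) (fun f g => heq_of_eq ?_)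
  · exact Category.comp_id _
  · exact Category.comp_id _

theorem prodPF_comp {A' B' : Type u} [Bicategory.{w, v} A'] [Bicategory.{w, v} B']
    (F : A ⥤ᵖ B) (G : C ⥤ᵖ D) (F' : B ⥤ᵖ A') (G' : D ⥤ᵖ B') :
    (prodPF F G).comp (prodPF F' G') = prodPF (F.comp F') (G.comp G') := by
  refine pseudofunctor_ext rfl (fun a => heq_of_eq ?_) (fun f g => heq_of_eq ?_)
  · rfl
  · rfl

theorem prodPF_id : prodPF (Pseudofunctor.id A) (Pseudofunctor.id B) = Pseudofunctor.id (A × B) := by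
  refine pseudofunctor_ext rfl (fun a => heq_of_eq ?_) (fun f g => heq_of_eq ?_)
  · rfl
  · rfl

theorem assocPF_naturality {A' B' C' : Type u} [Bicategory.{w, v} A'] [Bicategory.{w, v} B']
    [Bicategory.{w, v} C'] (F : A ⥤ᵖ A') (G : B ⥤ᵖ B') (H : C ⥤ᵖ C') :
    (prodPF F (prodPF G H)).comp (assocPF A' B' C') =
      (assocPF A B C).comp (prodPF (prodPF F G) H) := by
  refine pseudofunctor_ext rfl (fun a => heq_of_eq ?_) (fun f g => heq_of_eq ?_)
  · refine Prod.ext (Prod.ext ?_ ?_) ?_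
    · exact (by simp : (F.mapId a.1).hom ≫ 𝟙 _ = F.map₂ (𝟙 _) ≫ (F.mapId a.1).hom)
    · exact (by simp : (G.mapId a.2.1).hom ≫ 𝟙 _ = G.map₂ (𝟙 _) ≫ (G.mapId a.2.1).hom)
    · exact (by simp : (H.mapId a.2.2).hom ≫ 𝟙 _ = H.map₂ (𝟙 _) ≫ (H.mapId a.2.2).hom)
  · refine Prod.ext (Prod.ext ?_ ?_) ?_
    · exact (by simp : (F.mapComp f.1 g.1).hom ≫ 𝟙 _ = F.map₂ (𝟙 _) ≫ (F.mapComp f.1 g.1).hom)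
    · exact (by simp :
        (G.mapComp f.2.1 g.2.1).hom ≫ 𝟙 _ = G.map₂ (𝟙 _) ≫ (G.mapComp f.2.1 g.2.1).hom)
    · exact (by simp :
        (H.mapComp f.2.2 g.2.2).hom ≫ 𝟙 _ = H.map₂ (𝟙 _) ≫ (H.mapComp f.2.2 g.2.2).hom)

end Products

section Powers

variable (B : Type u)

/-- The power `B ^ (n + 1)`. -/
def Pow : ℕ → Type u
  | 0 => B
  | n + 1 => B × Pow n

instance powBicategory [Bicategory.{w, v} B] : ∀ n, Bicategory.{w, v} (Pow B n)
  | 0 => (inferInstance : Bicategory.{w, v} B)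
  | n + 1 => @Bicategory.uniformProd B _ (Pow B n) (powBicategory n)

instance powStrict [Bicategory.{w, v} B] [Bicategory.Strict B] :
    ∀ n, Bicategory.Strict (Pow B n)
  | 0 => (inferInstance : Bicategory.Strict B)
  | n + 1 =>
    haveI := powStrict n
    (inferInstance : @Bicategory.Strict (B × Pow B n) (Bicategory.prod B (Pow B n)))

variable {B}  [Bicategory.{w, v} B]

/-- The iterated tensor product `⊗(n + 1) : B ^ (n + 1) ⟶ B`,
`(X_0, …, X_n) ↦ X_0 ⊗ (X_1 ⊗ (⋯ ⊗ X_n))`. -/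
def tensorPow (T : (B × B) ⥤ᵖ B) : ∀ n, Pow B n ⥤ᵖ B
  | 0 => Pseudofunctor.id B
  | n + 1 => (prodPF (Pseudofunctor.id B) (tensorPow T n)).comp T

/-- Given `T` (to be thought of as `⊗`), the pseudofunctor
`(X_0, …, X_{n+1}) ↦ (X_0, …, X_i ⊗ X_{i+1}, …, X_{n+1})`. -/
def contract (T : (B × B) ⥤ᵖ B) : ∀ n, Fin (n + 1) → (Pow B (n + 1) ⥤ᵖ Pow B n)
  | 0, _ => T
  | n + 1, ⟨0, _⟩ => (assocPF B B (Pow B n)).comp (prodPF T (Pseudofunctor.id (Pow B n)))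
  | n + 1, ⟨i + 1, h⟩ =>
    prodPF (Pseudofunctor.id B) (contract T n ⟨i, Nat.lt_of_succ_lt_succ h⟩)

/-- `(X_0, …, X_{n+1}) ↦ ((X_0, …, X_n), X_{n+1})` -/
def splitLast : ∀ n, Pow B (n + 1) ⥤ᵖ (Pow B n × B)
  | 0 => Pseudofunctor.id (B × B)
  | n + 1 => (prodPF (Pseudofunctor.id B) (splitLast n)).comp (assocPF B (Pow B n) B)

theorem contract_comp (T : (B × B) ⥤ᵖ B)
    (hT : (assocPF B B B).comp ((prodPF T (Pseudofunctor.id B)).comp T) =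
      (prodPF (Pseudofunctor.id B) T).comp T) :
    ∀ n i, (contract T n i).comp (tensorPow T n) = tensorPow T (n + 1)
  | 0, i => by
    change T.comp (Pseudofunctor.id B) =
      (prodPF (Pseudofunctor.id B) (Pseudofunctor.id B)).comp T
    rw [comp_idPF, prodPF_id, id_compPF]
  | n + 1, ⟨0, _⟩ => by
    change ((assocPF B B (Pow B n)).comp (prodPF T (Pseudofunctor.id (Pow B n)))).comp
        ((prodPF (Pseudofunctor.id B) (tensorPow T n)).comp T) =
      (prodPF (Pseudofunctor.id B) ((prodPF (Pseudofunctor.id B) (tensorPow T n)).comp T)).comp T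
    have h1 : prodPF (Pseudofunctor.id B) ((prodPF (Pseudofunctor.id B) (tensorPow T n)).comp T) =
        (prodPF (Pseudofunctor.id B) (prodPF (Pseudofunctor.id B) (tensorPow T n))).comp
          (prodPF (Pseudofunctor.id B) T) := by
      rw [prodPF_comp, comp_idPF]
    have h2 : (prodPF T (Pseudofunctor.id (Pow B n))).comp
          (prodPF (Pseudofunctor.id B) (tensorPow T n)) =
        (prodPF (prodPF (Pseudofunctor.id B) (Pseudofunctor.id B)) (tensorPow T n)).comp
          (prodPF T (Pseudofunctor.id B)) := by
      rw [prodPF_comp, prodPF_comp, prodPF_id, comp_idPF, comp_idPF, id_compPF, id_compPF]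
    rw [h1, comp_assocPF, comp_assocPF, ← hT, ← comp_assocPF _ (assocPF B B B),
      assocPF_naturality, comp_assocPF, ← comp_assocPF _ _ T, h2, comp_assocPF]
  | n + 1, ⟨i + 1, h⟩ => by
    change (prodPF (Pseudofunctor.id B) (contract T n ⟨i, Nat.lt_of_succ_lt_succ h⟩)).comp
        ((prodPF (Pseudofunctor.id B) (tensorPow T n)).comp T) =
      (prodPF (Pseudofunctor.id B) (tensorPow T (n + 1))).comp T
    rw [← contract_comp T hT n ⟨i, Nat.lt_of_succ_lt_succ h⟩, ← comp_assocPF, prodPF_comp,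
      comp_idPF]

theorem splitLast_comp (T : (B × B) ⥤ᵖ B)
    (hT : (assocPF B B B).comp ((prodPF T (Pseudofunctor.id B)).comp T) =
      (prodPF (Pseudofunctor.id B) T).comp T) :
    ∀ n, (splitLast n).comp ((prodPF (tensorPow T n) (Pseudofunctor.id B)).comp T) =
      tensorPow T (n + 1)
  | 0 => by
    change (Pseudofunctor.id (B × B)).comp
        ((prodPF (Pseudofunctor.id B) (Pseudofunctor.id B)).comp T) =
      (prodPF (Pseudofunctor.id B) (Pseudofunctor.id B)).comp T
    rw [id_compPF]
  | n + 1 => by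
    change ((prodPF (Pseudofunctor.id B) (splitLast n)).comp (assocPF B (Pow B n) B)).comp
        ((prodPF ((prodPF (Pseudofunctor.id B) (tensorPow T n)).comp T)
          (Pseudofunctor.id B)).comp T) =
      (prodPF (Pseudofunctor.id B) (tensorPow T (n + 1))).comp T
    have h1 : prodPF ((prodPF (Pseudofunctor.id B) (tensorPow T n)).comp T) (Pseudofunctor.id B) =
        (prodPF (prodPF (Pseudofunctor.id B) (tensorPow T n)) (Pseudofunctor.id B)).comp
          (prodPF T (Pseudofunctor.id B)) := by
      rw [prodPF_comp, comp_idPF]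
    rw [h1, comp_assocPF, comp_assocPF _ _ T, ← comp_assocPF (assocPF B (Pow B n) B),
      ← assocPF_naturality, comp_assocPF _ (assocPF B B B), hT, ← comp_assocPF _ _ T, prodPF_comp,
      ← comp_assocPF, prodPF_comp, ← splitLast_comp T hT n]
    simp only [comp_idPF]

end Powers
section Whisker

theorem paste {C : Type*} [Category C] {a a' b b' c c' : C} {x : a ⟶ a'} {y : b ⟶ b'}
    {z : c ⟶ c'} {f : a ⟶ b} {f' : a' ⟶ b'} {g : b ⟶ c} {g' : b' ⟶ c'} (h : f ≫ y = x ≫ f')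
    (h' : g ≫ z = y ≫ g') : (f ≫ g) ≫ z = x ≫ f' ≫ g' := by
  rw [Category.assoc, h', ← Category.assoc, h, Category.assoc]

variable {C : Type u} [Bicategory.{w, v} C]

theorem whisker_eqToHom {X Y Z : C} {a b a' b' : X ⟶ Y} {x : a ⟶ b} {y : a' ⟶ b'} (ha : a = a')
    (hb : b = b') (h : x ≫ eqToHom hb = eqToHom ha ≫ y) {f g : Y ⟶ Z} (τ : f ⟶ g)
    (h1 : b ≫ g = b' ≫ g) (h2 : a ≫ f = a' ≫ f) :
    (x ▷ f ≫ b ◁ τ) ≫ eqToHom h1 = eqToHom h2 ≫ y ▷ f ≫ b' ◁ τ := by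
  subst ha hb
  simp only [eqToHom_refl, Category.comp_id, Category.id_comp] at h ⊢
  rw [h]

theorem whisker_assoc_eqToHom [Bicategory.Strict C] {W X Y Z : C} {g g' : W ⟶ X} {s t : X ⟶ Y}
    {f f' : Y ⟶ Z} (σ : g ⟶ g') (ρ : s ⟶ t) (τ : f ⟶ f') (h1 : (g' ≫ t) ≫ f' = g' ≫ t ≫ f')
    (h2 : (g ≫ s) ≫ f = g ≫ s ≫ f) :
    ((σ ▷ s ≫ g' ◁ ρ) ▷ f ≫ (g' ≫ t) ◁ τ) ≫ eqToHom h1 =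
      eqToHom h2 ≫ σ ▷ (s ≫ f) ≫ g' ◁ (ρ ▷ f ≫ t ◁ τ) := by
  have e1 : eqToHom h1 = (α_ g' t f').hom := by
    rw [Bicategory.Strict.associator_eqToIso]; rfl
  have e2 : eqToHom h2 = (α_ g s f).hom := by
    rw [Bicategory.Strict.associator_eqToIso]; rfl
  rw [e1, e2]
  simp

end Whisker

section Strings
/-- `Str C m X Y` consists of the strings `(f_0, …, f_m)` of `m + 1` composable 1-morphisms with
`f_0 ∘ ⋯ ∘ f_m : X ⟶ Y`; the head `f_0` of the string is the 1-morphism applied last. -/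
inductive Str (C : Type u) [Bicategory.{w, v} C] : ℕ → C → C → Type (max u v)
  | single {X Y : C} (f : X ⟶ Y) : Str C 0 X Y
  | cons {m : ℕ} {X Y Z : C} (f : Y ⟶ Z) (s : Str C m X Y) : Str C (m + 1) X Z

namespace Str

variable {C : Type u} [Bicategory.{w, v} C] {D : Type u'} [Bicategory.{w', v'} D]
  {E : Type u''} [Bicategory.{w'', v''} E]

/-- The composite `f_0 ∘ ⋯ ∘ f_m`. -/
def comp : ∀ {m : ℕ} {X Y : C}, Str C m X Y → (X ⟶ Y)
  | _, _, _, single f => f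
  | _, _, _, cons f s => s.comp ≫ f

/-- The string `(F f_0, …, F f_m)`. -/
def map (F : C ⥤ᵖ D) : ∀ {m : ℕ} {X Y : C}, Str C m X Y → Str D m (F.obj X) (F.obj Y)
  | _, _, _, single f => single (F.map f)
  | _, _, _, cons f s => cons (F.map f) (s.map F)

/-- `(f_0, …, f_{m+1}) ↦ (f_0, …, f_i ∘ f_{i+1}, …, f_{m+1})`. -/
def contract : ∀ {m : ℕ} {X Y : C}, Fin (m + 1) → Str C (m + 1) X Y → Str C m X Y
  | 0, _, _, _, cons f (single g) => single (g ≫ f)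
  | _ + 1, _, _, ⟨0, _⟩, cons f (cons g s) => cons (g ≫ f) s
  | _ + 1, _, _, ⟨i + 1, h⟩, cons f s => cons f (s.contract ⟨i, Nat.lt_of_succ_lt_succ h⟩)

/-- `(f_0, …, f_m), g ↦ (f_0, …, f_m, g)`. -/
def snoc {W : C}  : ∀ {m : ℕ} {X Y : C}, Str C m X Y → (W ⟶ X) → Str C (m + 1) W Y
  | _, _, _, single f, g => cons f (single g)
  | _, _, _, cons f s, g => cons f (s.snoc g)

/-- `(f_0, …, f_{m+1}) ↦ ((f_0, …, f_m), f_{m+1})`. -/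
def unsnoc : ∀ {m : ℕ} {X Y : C}, Str C (m + 1) X Y → Σ Z : C, Str C m Z Y × (X ⟶ Z)
  | 0, _, _, cons f (single g) => ⟨_, single f, g⟩
  | _ + 1, _, _, cons f s => ⟨s.unsnoc.1, cons f s.unsnoc.2.1, s.unsnoc.2.2⟩

theorem snoc_unsnoc : ∀ {m : ℕ} {X Y : C} (s : Str C (m + 1) X Y),
    s = s.unsnoc.2.1.snoc s.unsnoc.2.2
  | 0, _, _, cons _ (single _) => rfl
  | _ + 1, _, _, cons f s => congrArg (cons f) (snoc_unsnoc s)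

theorem unsnoc_snoc {W : C} : ∀ {m : ℕ} {X Y : C} (s : Str C m X Y) (g : W ⟶ X),
    (s.snoc g).unsnoc = ⟨X, s, g⟩
  | _, _, _, single _, _ => rfl
  | m + 1, _, _, cons f s, g => by
    change (⟨(s.snoc g).unsnoc.1, cons f (s.snoc g).unsnoc.2.1, (s.snoc g).unsnoc.2.2⟩ :
      Σ Z : C, Str C (m + 1) Z _ × (W ⟶ Z)) = _
    rw [unsnoc_snoc s g]

theorem map_snoc (F : C ⥤ᵖ D) {W : C} : ∀ {m : ℕ} {X Y : C} (s : Str C m X Y) (g : W ⟶ X),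
    (s.snoc g).map F = (s.map F).snoc (F.map g)
  | _, _, _, single _, _ => rfl
  | _, _, _, cons f s, g => congrArg (cons (F.map f)) (map_snoc F s g)

theorem comp_snoc [Bicategory.Strict C] {W : C} : ∀ {m : ℕ} {X Y : C} (s : Str C m X Y)
    (g : W ⟶ X), (s.snoc g).comp = g ≫ s.comp
  | _, _, _, single _, _ => rfl
  | _, _, _, cons f s, g => by
    change (s.snoc g).comp ≫ f = g ≫ s.comp ≫ f
    rw [comp_snoc s g, Bicategory.Strict.assoc]

theorem comp_contract [Bicategory.Strict C] : ∀ {m : ℕ} {X Y : C} (i : Fin (m + 1))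
    (s : Str C (m + 1) X Y), (s.contract i).comp = s.comp
  | 0, _, _, _, cons _ (single _) => rfl
  | _ + 1, _, _, ⟨0, _⟩, cons f (cons g s) => (Bicategory.Strict.assoc s.comp g f).symm
  | _ + 1, _, _, ⟨i + 1, h⟩, cons f s => congrArg (· ≫ f) (comp_contract ⟨i, _⟩ s)

theorem map_map (F : C ⥤ᵖ D) (G : D ⥤ᵖ E) : ∀ {m : ℕ} {X Y : C} (s : Str C m X Y),
    s.map (F.comp G) = (s.map F).map G
  | _, _, _, single _ => rfl
  | _, _, _, cons f s => congrArg (cons (G.map (F.map f))) (map_map F G s)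

/-- A 2-morphism between parallel strings: a string of 2-morphisms `τ_i : f_i ⟶ g_i`. -/
inductive Hom : ∀ {m : ℕ} {X Y : C}, Str C m X Y → Str C m X Y → Type (max u v w)
  | single {X Y : C} {f g : X ⟶ Y} (τ : f ⟶ g) : Hom (single f) (single g)
  | cons {m : ℕ} {X Y Z : C} {f g : Y ⟶ Z} {s t : Str C m X Y} (τ : f ⟶ g) (σ : Hom s t) :
      Hom (cons f s) (cons g t)

namespace Hom
/-- The horizontal composite `τ_0 ∘ ⋯ ∘ τ_m`. -/
def comp : ∀ {m : ℕ} {X Y : C} {s t : Str C m X Y}, Hom s t → (s.comp ⟶ t.comp)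
  | _, _, _, _, _, single τ => τ
  | _, _, _, _, _, cons (f := f) (t := t) τ σ => σ.comp ▷ f ≫ t.comp ◁ τ

/-- The string `(F τ_0, …, F τ_m)`. -/
def map (F : C ⥤ᵖ D) : ∀ {m : ℕ} {X Y : C} {s t : Str C m X Y},
    Hom s t → Hom (s.map F) (t.map F)
  | _, _, _, _, _, single τ => single (F.map₂ τ)
  | _, _, _, _, _, cons τ σ => cons (F.map₂ τ) (σ.map F)

def snoc {W : C} : ∀ {m : ℕ} {X Y : C} {s t : Str C m X Y} {g g' : W ⟶ X},
    Hom s t → (g ⟶ g') → Hom (s.snoc g) (t.snoc g')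
  | _, _, _, _, _, _, _, single σ, τ => cons σ (single τ)
  | _, _, _, _, _, _, _, cons ρ σ, τ => cons ρ (σ.snoc τ)

def contract : ∀ {m : ℕ} {X Y : C} {s t : Str C (m + 1) X Y} (i : Fin (m + 1)),
    Hom s t → Hom (s.contract i) (t.contract i)
  | 0, _, _, _, _, _, cons (f := f) τ (single (g := g) σ) => single (σ ▷ f ≫ g ◁ τ)
  | _ + 1, _, _, _, _, ⟨0, _⟩, cons (f := f) τ (cons (g := g) σ ρ) => cons (σ ▷ f ≫ g ◁ τ) ρ
  | _ + 1, _, _, _, _, ⟨i + 1, h⟩, cons τ σ =>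
      cons τ (σ.contract ⟨i, Nat.lt_of_succ_lt_succ h⟩)

theorem snoc_induction {P : ∀ {m : ℕ} {X Y : C} {s t : Str C (m + 1) X Y}, Hom s t → Prop}
    (hP : ∀ {m : ℕ} {W X Y : C} {s t : Str C m X Y} {g g' : W ⟶ X} (σ : Hom s t) (τ : g ⟶ g'),
      P (σ.snoc τ)) : ∀ {m : ℕ} {X Y : C} {s t : Str C (m + 1) X Y} (σ : Hom s t), P σ
  | 0, _, _, _, _, cons σ (single τ) => hP (single σ) τ
  | _ + 1, _, _, _, _, cons ρ σ =>
    snoc_induction (P := fun {_ X Y _ _} σ => ∀ {Z : C} {f g : Y ⟶ Z} (ρ : f ⟶ g), P (cons ρ σ))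
      (fun σ τ _ _ _ ρ => hP (cons ρ σ) τ) σ ρ

theorem comp_contract [Bicategory.Strict C] : ∀ {m : ℕ} {X Y : C} {s t : Str C (m + 1) X Y}
    (i : Fin (m + 1)) (σ : Hom s t),
    (σ.contract i).comp ≫ eqToHom (Str.comp_contract i t) =
      eqToHom (Str.comp_contract i s) ≫ σ.comp
  | 0, _, _, _, _, _, cons τ (single σ) => by
    exact (Category.comp_id _).trans (Category.id_comp _).symm
  | _ + 1, _, _, _, _, ⟨0, _⟩, cons τ (cons σ ρ) => by
    have h := whisker_assoc_eqToHom ρ.comp σ τ (Bicategory.Strict.assoc _ _ _)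
      (Bicategory.Strict.assoc _ _ _)
    have h3 := congrArg (fun x => eqToHom (Bicategory.Strict.assoc _ _ _).symm ≫ x ≫
      eqToHom (Bicategory.Strict.assoc _ _ _).symm) h
    simp only [Category.assoc, eqToHom_trans, eqToHom_trans_assoc, eqToHom_refl, Category.comp_id,
      Category.id_comp] at h3
    change (ρ.comp ▷ _ ≫ _ ◁ (σ ▷ _ ≫ _ ◁ τ)) ≫ eqToHom _ =
      eqToHom _ ≫ (ρ.comp ▷ _ ≫ _ ◁ σ) ▷ _ ≫ _ ◁ τ
    rw [h3]
    exact Category.assoc _ _ _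
  | _ + 1, _, _, _, _, ⟨i + 1, h⟩, cons τ σ => by
    exact whisker_eqToHom _ _ (comp_contract ⟨i, Nat.lt_of_succ_lt_succ h⟩ σ) τ _ _

theorem comp_snoc [Bicategory.Strict C] {W : C} : ∀ {m : ℕ} {X Y : C} {s t : Str C m X Y}
    {g g' : W ⟶ X} (σ : Hom s t) (τ : g ⟶ g'),
    (σ.snoc τ).comp ≫ eqToHom (Str.comp_snoc t g') =
      eqToHom (Str.comp_snoc s g) ≫ τ ▷ s.comp ≫ g' ◁ σ.comp
  | _, _, _, _, _, _, _, single σ, τ => by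
    exact (Category.comp_id _).trans (Category.id_comp _).symm
  | _, _, _, _, _, _, _, cons ρ σ, τ => by
    have h := congrArg (· ≫ eqToHom (Bicategory.Strict.assoc _ _ _))
      (whisker_eqToHom _ _ (comp_snoc σ τ) ρ
        (congrArg (· ≫ _) (Str.comp_snoc _ _)) (congrArg (· ≫ _) (Str.comp_snoc _ _)))
    simp only [Category.assoc, eqToHom_trans] at h
    have h2 := whisker_assoc_eqToHom τ σ.comp ρ (Bicategory.Strict.assoc _ _ _)
      (Bicategory.Strict.assoc _ _ _)
    simp only [Category.assoc] at h2
    rw [h2] at h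
    simp only [eqToHom_trans_assoc] at h
    change ((σ.snoc τ).comp ▷ _ ≫ _ ◁ ρ) ≫ eqToHom _ =
      eqToHom _ ≫ τ ▷ _ ≫ _ ◁ (σ.comp ▷ _ ≫ _ ◁ ρ)
    rw [Category.assoc]
    exact h

theorem map_map (F : C ⥤ᵖ D) (G : D ⥤ᵖ E) : ∀ {m : ℕ} {X Y : C} {s t : Str C m X Y} (σ : Hom s t),
    (σ.map (F.comp G)).comp ≫ eqToHom (congrArg Str.comp (Str.map_map F G t)) =
      eqToHom (congrArg Str.comp (Str.map_map F G s)) ≫ ((σ.map F).map G).comp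
  | _, _, _, _, _, single σ => by
    exact (Category.comp_id _).trans (Category.id_comp _).symm
  | _, _, _, _, _, cons ρ σ => by
    exact whisker_eqToHom _ _ (map_map F G σ) (G.map₂ (F.map₂ ρ)) _ _

theorem map_snoc [Bicategory.Strict C] (F : C ⥤ᵖ D) {W : C} : ∀ {m : ℕ} {X Y : C} {s t : Str C m X Y}
    {g g' : W ⟶ X} (σ : Hom s t) (τ : g ⟶ g'),
    ((σ.snoc τ).map F).comp ≫ eqToHom (congrArg Str.comp (Str.map_snoc F t g')) =
      eqToHom (congrArg Str.comp (Str.map_snoc F s g)) ≫ ((σ.map F).snoc (F.map₂ τ)).comp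
  | _, _, _, _, _, _, _, single σ, τ => by
    exact (Category.comp_id _).trans (Category.id_comp _).symm
  | _, _, _, _, _, _, _, cons ρ σ, τ => by
    exact whisker_eqToHom _ _ (map_snoc F σ τ) (F.map₂ ρ) _ _

end Hom

/-- The canonical 2-isomorphism `F f_0 ∘ ⋯ ∘ F f_m ⟶ F (f_0 ∘ ⋯ ∘ f_m)`. -/
def hat (F : C ⥤ᵖ D) : ∀ {m : ℕ} {X Y : C} (s : Str C m X Y), (s.map F).comp ⟶ F.map s.comp
  | _, _, _, single f => 𝟙 (F.map f)
  | _, _, _, cons f s => s.hat F ▷ F.map f ≫ (F.mapComp s.comp f).inv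

/-- The canonical 2-isomorphism
`F f_0 ∘ ⋯ ∘ F f_{m+1} ⟶ F f_0 ∘ ⋯ ∘ F (f_i ∘ f_{i+1}) ∘ ⋯ ∘ F f_{m+1}`. -/
def hatAt (F : C ⥤ᵖ D) : ∀ {m : ℕ} {X Y : C} (i : Fin (m + 1)) (s : Str C (m + 1) X Y),
    (s.map F).comp ⟶ ((s.contract i).map F).comp
  | 0, _, _, _, cons f (single g) => (F.mapComp g f).inv
  | _ + 1, _, _, ⟨0, _⟩, cons f (cons g s) =>
      (α_ (s.map F).comp (F.map g) (F.map f)).hom ≫ (s.map F).comp ◁ (F.mapComp g f).inv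
  | _ + 1, _, _, ⟨i + 1, h⟩, cons f s => hatAt F ⟨i, Nat.lt_of_succ_lt_succ h⟩ s ▷ F.map f

theorem hat_naturality (F : C ⥤ᵖ D) : ∀ {m : ℕ} {X Y : C} {s t : Str C m X Y} (σ : Hom s t),
    s.hat F ≫ F.map₂ σ.comp = (σ.map F).comp ≫ t.hat F
  | _, _, _, _, _, .single σ => by
    exact (Category.id_comp _).trans (Category.comp_id _).symm
  | _, _, _, _, _, .cons ρ σ => by
    have ih := hat_naturality F σ
    rename_i f g s t
    change (s.hat F ▷ F.map f ≫ (F.mapComp s.comp f).inv) ≫ F.map₂ (σ.comp ▷ f ≫ t.comp ◁ ρ) =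
      ((σ.map F).comp ▷ F.map f ≫ (t.map F).comp ◁ F.map₂ ρ) ≫ t.hat F ▷ F.map g ≫
        (F.mapComp t.comp g).inv
    simp only [PrelaxFunctor.map₂_comp, Pseudofunctor.map₂_whisker_left,
      Pseudofunctor.map₂_whisker_right, Category.assoc, Iso.inv_hom_id_assoc]
    rw [← comp_whiskerRight_assoc, ih, comp_whiskerRight_assoc, whisker_exchange_assoc]

theorem hatAt_naturality (F : C ⥤ᵖ D) : ∀ {m : ℕ} {X Y : C} (i : Fin (m + 1)) {s t : Str C (m + 1) X Y} (σ : Hom s t),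
    s.hatAt F i ≫ ((σ.contract i).map F).comp = (σ.map F).comp ≫ t.hatAt F i
  | 0, _, _, _, _, _, .cons τ (.single σ) => by
    rename_i f g f' g'
    change (F.mapComp f' f).inv ≫ F.map₂ (σ ▷ f ≫ g' ◁ τ) =
      (F.map₂ σ ▷ F.map f ≫ F.map g' ◁ F.map₂ τ) ≫ (F.mapComp g' g).inv
    simp
  | _ + 1, _, _, ⟨0, _⟩, _, _, .cons τ (.cons σ ρ) => by
    rename_i f g Y f' s g' t
    change ((α_ (s.map F).comp (F.map f') (F.map f)).hom ≫
        (s.map F).comp ◁ (F.mapComp f' f).inv) ≫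
          ((ρ.map F).comp ▷ F.map (f' ≫ f) ≫ (t.map F).comp ◁ F.map₂ (σ ▷ f ≫ g' ◁ τ)) =
      (((ρ.map F).comp ▷ F.map f' ≫ (t.map F).comp ◁ F.map₂ σ) ▷ F.map f ≫
        ((t.map F).comp ≫ F.map g') ◁ F.map₂ τ) ≫
        (α_ (t.map F).comp (F.map g') (F.map g)).hom ≫ (t.map F).comp ◁ (F.mapComp g' g).inv
    rw [Category.assoc, whisker_exchange_assoc]
    simp
  | _ + 1, _, _, ⟨i + 1, h⟩, _, _, .cons τ σ => by
    have ih := hatAt_naturality F ⟨i, Nat.lt_of_succ_lt_succ h⟩ σ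
    rename_i f g s t
    change s.hatAt F ⟨i, Nat.lt_of_succ_lt_succ h⟩ ▷ F.map f ≫
        (((σ.contract ⟨i, Nat.lt_of_succ_lt_succ h⟩).map F).comp ▷ F.map f ≫ _ ◁ F.map₂ τ) =
      ((σ.map F).comp ▷ F.map f ≫ (t.map F).comp ◁ F.map₂ τ) ≫
        t.hatAt F ⟨i, Nat.lt_of_succ_lt_succ h⟩ ▷ F.map g
    rw [← comp_whiskerRight_assoc, ih, comp_whiskerRight_assoc, Category.assoc, whisker_exchange]
end Str
end Strings
/-- On top of the `K`-modules of 2-morphisms and the bilinearity of vertical composition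
(`Preadditive`, `Linear`), horizontal composition of 2-morphisms is `K`-bilinear. -/
class IsLinearTwoCategory (K : Type*) [CommRing K] (C : Type u) [Bicategory.{w, v} C]
    [∀ X Y : C, Preadditive (X ⟶ Y)] [∀ X Y : C, Linear K (X ⟶ Y)] : Prop where
  whiskerLeft_add : ∀ {X Y Z : C} (f : X ⟶ Y) {g h : Y ⟶ Z} (σ τ : g ⟶ h),
    f ◁ (σ + τ) = f ◁ σ + f ◁ τ
  whiskerLeft_smul : ∀ {X Y Z : C} (f : X ⟶ Y) {g h : Y ⟶ Z} (k : K) (τ : g ⟶ h),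
    f ◁ (k • τ) = k • f ◁ τ
  add_whiskerRight : ∀ {X Y Z : C} {f g : X ⟶ Y} (σ τ : f ⟶ g) (h : Y ⟶ Z),
    (σ + τ) ▷ h = σ ▷ h + τ ▷ h
  smul_whiskerRight : ∀ {X Y Z : C} {f g : X ⟶ Y} (k : K) (τ : f ⟶ g) (h : Y ⟶ Z),
    (k • τ) ▷ h = k • τ ▷ h

section Cochains

variable (K : Type*) [CommRing K]
  {C : Type u} [Bicategory.{w, v} C] {D : Type u'} [Bicategory.{w', v'} D]
  {E : Type u''} [Bicategory.{w'', v''} E]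

/-- Families of 2-morphisms `φ (f_0, …, f_m) : F f_0 ∘ ⋯ ∘ F f_m ⟶ F (f_0 ∘ ⋯ ∘ f_m)`. -/
abbrev Fam (m : ℕ) (F : C ⥤ᵖ D) : Type (max u v w') :=
  ∀ (X Y : C) (s : Str C m X Y), (s.map F).comp ⟶ F.map s.comp

/-- Naturality of a family in its arguments `f_0, …, f_m`. -/
def IsNatural {m : ℕ} {F : C ⥤ᵖ D} (φ : Fam m F) : Prop :=
  ∀ (X Y : C) (s t : Str C m X Y) (σ : Str.Hom s t),
    φ X Y s ≫ F.map₂ σ.comp = (σ.map F).comp ≫ φ X Y t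

variable [∀ X Y : D, Preadditive (X ⟶ Y)] [∀ X Y : D, Linear K (X ⟶ Y)]

/-- The `K`-module of the natural families
`φ (f_0, …, f_m) : F f_0 ∘ ⋯ ∘ F f_m ⟶ F (f_0 ∘ ⋯ ∘ f_m)`. -/
def Cochain (m : ℕ) (F : C ⥤ᵖ D) : Submodule K (Fam m F) where
  carrier := {φ | IsNatural φ}
  add_mem' := by
    intro φ ψ hφ hψ X Y s t σ
    exact (Preadditive.add_comp _ _ _ _ _ _).trans
      ((congrArg₂ (· + ·) (hφ X Y s t σ) (hψ X Y s t σ)).trans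
        (Preadditive.comp_add _ _ _ _ _ _).symm)
  zero_mem' := by
    intro X Y s t σ
    exact Limits.zero_comp.trans Limits.comp_zero.symm
  smul_mem' := by
    intro k φ hφ X Y s t σ
    exact (Linear.smul_comp _ _ _ _ _ _).trans
      ((congrArg (k • ·) (hφ X Y s t σ)).trans (Linear.comp_smul _ _ _ _ _ _).symm)

variable [IsLinearTwoCategory K D]

/-- `(f_0, …, f_{m+1}) ↦ ⌈1_{F f_0} ∘ φ (f_1, …, f_{m+1})⌉`, on families. -/
def firstFam (m : ℕ) (F : C ⥤ᵖ D) : Fam m F →ₗ[K] Fam (m + 1) F where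
  toFun φ
    | _, _, .cons f s => φ _ _ s ▷ F.map f ≫ (F.mapComp s.comp f).inv
  map_add' φ ψ := by
    funext X Y s
    cases s with
    | cons f s =>
      exact (congrArg (· ≫ _) (IsLinearTwoCategory.add_whiskerRight K _ _ _)).trans
        (Preadditive.add_comp _ _ _ _ _ _)
  map_smul' k φ := by
    funext X Y s
    cases s with
    | cons f s =>
      exact (congrArg (· ≫ _) (IsLinearTwoCategory.smul_whiskerRight _ _ _)).trans
        (Linear.smul_comp _ _ _ _ _ _)

/-- `(f_0, …, f_{m+1}) ↦ ⌈1_{F f_0} ∘ φ (f_1, …, f_{m+1})⌉`. -/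
def firstFace (m : ℕ) (F : C ⥤ᵖ D) : Cochain K m F →ₗ[K] Cochain K (m + 1) F :=
  (firstFam K m F).restrict (by
    intro φ hφ X Y s t σ
    cases σ with
    | @cons _ _ _ _ f g s t τ σ =>
      change (φ _ _ s ▷ F.map f ≫ (F.mapComp s.comp f).inv) ≫ F.map₂ (σ.comp ▷ f ≫ t.comp ◁ τ) =
        ((σ.map F).comp ▷ F.map f ≫ (t.map F).comp ◁ F.map₂ τ) ≫ φ _ _ t ▷ F.map g ≫
          (F.mapComp t.comp g).inv
      simp only [PrelaxFunctor.map₂_comp, Pseudofunctor.map₂_whisker_left,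
        Pseudofunctor.map₂_whisker_right, Category.assoc, Iso.inv_hom_id_assoc]
      rw [← comp_whiskerRight_assoc, hφ, comp_whiskerRight_assoc, whisker_exchange_assoc])

/-- `(f_0, …, f_{m+1}) ↦ ⌈φ (f_0, …, f_i ∘ f_{i+1}, …, f_{m+1})⌉`. -/
def innerFace [Bicategory.Strict C] (m : ℕ) (F : C ⥤ᵖ D) (i : Fin (m + 1)) :
    Cochain K m F →ₗ[K] Cochain K (m + 1) F :=
  LinearMap.restrict
    { toFun := fun φ _ _ s =>
        s.hatAt F i ≫ φ _ _ (s.contract i) ≫ eqToHom (congrArg F.map (s.comp_contract i))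
      map_add' := by
        intro φ ψ
        funext X Y s
        exact (congrArg (_ ≫ ·) (Preadditive.add_comp _ _ _ _ _ _)).trans
          (Preadditive.comp_add _ _ _ _ _ _)
      map_smul' := by
        intro k φ
        funext X Y s
        exact (congrArg (_ ≫ ·) (Linear.smul_comp _ _ _ _ _ _)).trans
          (Linear.comp_smul _ _ _ _ _ _) }
    (by
      intro φ hφ X Y s t σ
      change (s.hatAt F i ≫ φ _ _ (s.contract i) ≫ eqToHom _) ≫ F.map₂ σ.comp =
        (σ.map F).comp ≫ t.hatAt F i ≫ φ _ _ (t.contract i) ≫ eqToHom _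
      have h := congrArg (fun x => F.map₂ x) (σ.comp_contract i)
      simp only [PrelaxFunctor.map₂_comp, PrelaxFunctor.map₂_eqToHom] at h
      rw [← reassoc_of% (Str.hatAt_naturality F i σ), ← reassoc_of% (hφ _ _ _ _ (σ.contract i)), h]
      simp)

/-- Auxiliary to `lastFam`: the string `s` is `p.2.1` followed by `p.2.2`. -/
def lastAux [Bicategory.Strict C] [Bicategory.Strict D] {m : ℕ} {F : C ⥤ᵖ D} (φ : Fam m F)
    {X Y : C} (s : Str C (m + 1) X Y) (p : Σ Z : C, Str C m Z Y × (X ⟶ Z))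
    (h : s = p.2.1.snoc p.2.2) : (s.map F).comp ⟶ F.map s.comp :=
  eqToHom (by rw [h, Str.map_snoc, Str.comp_snoc]) ≫ F.map p.2.2 ◁ φ _ _ p.2.1 ≫
    (F.mapComp p.2.2 p.2.1.comp).inv ≫ eqToHom (by rw [h, Str.comp_snoc])

/-- `(f_0, …, f_{m+1}) ↦ ⌈φ (f_0, …, f_m) ∘ 1_{F f_{m+1}}⌉`, on families. -/
def lastFam [Bicategory.Strict C] [Bicategory.Strict D] {m : ℕ} {F : C ⥤ᵖ D} (φ : Fam m F) :
    Fam (m + 1) F :=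
  fun _ _ s => lastAux φ s s.unsnoc s.snoc_unsnoc

theorem lastFam_snoc [Bicategory.Strict C] [Bicategory.Strict D] {m : ℕ} {F : C ⥤ᵖ D}
    (φ : Fam m F) {W X Y : C} (s : Str C m X Y) (g : W ⟶ X) :
    lastFam φ _ _ (s.snoc g) = eqToHom (by rw [Str.map_snoc, Str.comp_snoc]) ≫
      F.map g ◁ φ _ _ s ≫ (F.mapComp g s.comp).inv ≫ eqToHom (by rw [Str.comp_snoc]) := by
  have : ∀ (p : Σ Z : C, Str C m Z Y × (W ⟶ Z)) (h : s.snoc g = p.2.1.snoc p.2.2),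
      p = ⟨X, s, g⟩ → lastAux φ (s.snoc g) p h = lastAux φ (s.snoc g) ⟨X, s, g⟩ rfl := by
    rintro p h rfl
    rfl
  exact this _ _ (s.unsnoc_snoc g)

/-- `(f_0, …, f_{m+1}) ↦ ⌈φ (f_0, …, f_m) ∘ 1_{F f_{m+1}}⌉`. -/
def lastFace [Bicategory.Strict C] [Bicategory.Strict D] (m : ℕ) (F : C ⥤ᵖ D) :
    Cochain K m F →ₗ[K] Cochain K (m + 1) F :=
  LinearMap.restrict
    { toFun := lastFam
      map_add' := by
        intro φ ψ
        funext X Y s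
        change lastAux (φ + ψ) s s.unsnoc s.snoc_unsnoc =
          lastAux φ s s.unsnoc s.snoc_unsnoc + lastAux ψ s s.unsnoc s.snoc_unsnoc
        simp only [lastAux, Pi.add_apply, IsLinearTwoCategory.whiskerLeft_add (C := D) K,
          Preadditive.add_comp, Preadditive.comp_add]
      map_smul' := by
        intro k φ
        funext X Y s
        change lastAux (k • φ) s s.unsnoc s.snoc_unsnoc =
          k • lastAux φ s s.unsnoc s.snoc_unsnoc
        simp only [lastAux, Pi.smul_apply, IsLinearTwoCategory.whiskerLeft_smul,
          Linear.smul_comp, Linear.comp_smul] }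
    (by
      intro φ hφ X Y s t σ
      change lastFam φ _ _ s ≫ F.map₂ σ.comp = (σ.map F).comp ≫ lastFam φ _ _ t
      induction σ using Str.Hom.snoc_induction with
      | @hP m W X Y s t g g' σ τ =>
        rename_i φ hφ
        have h1 := congrArg (fun x => F.map₂ x ≫ eqToHom (congrArg F.map (t.comp_snoc g').symm))
          (σ.comp_snoc τ)
        have h2 := (σ.map F).comp_snoc (F.map₂ τ)
        have h3 := σ.map_snoc F τ
        have h4 := hφ _ _ _ _ σ
        simp only [PrelaxFunctor.map₂_comp, PrelaxFunctor.map₂_eqToHom, Category.assoc,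
          eqToHom_trans, eqToHom_refl, Category.comp_id] at h1
        have h5 : ((σ.snoc τ).map F).comp = eqToHom (by rw [Str.map_snoc, Str.comp_snoc]) ≫
            (F.map₂ τ ▷ (s.map F).comp ≫ F.map g' ◁ (σ.map F).comp) ≫
              eqToHom (by rw [Str.map_snoc, Str.comp_snoc]) := by
          have h6 := congrArg (· ≫ eqToHom (congrArg Str.comp (t.map_snoc F g').symm)) h3
          have h7 := congrArg (· ≫ eqToHom ((t.map F).comp_snoc (F.map g')).symm) h2
          simp only [Category.assoc, eqToHom_trans, eqToHom_refl, Category.comp_id] at h6 h7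
          rw [h6, h7]
          simp only [Category.assoc, eqToHom_trans, eqToHom_trans_assoc]
        rw [lastFam_snoc, lastFam_snoc, h1, h5]
        simp only [Category.assoc, eqToHom_trans_assoc, eqToHom_refl, Category.id_comp,
          Pseudofunctor.map₂_whisker_left, Pseudofunctor.map₂_whisker_right,
          Iso.inv_hom_id_assoc]
        rw [whisker_exchange_assoc, ← whiskerLeft_comp_assoc, h4, whiskerLeft_comp_assoc])

end Cochains

section Cochains2

variable (K : Type*) [CommRing K]
  {C : Type u} [Bicategory.{w, v} C] {D : Type u'} [Bicategory.{w', v'} D]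
  {E : Type u''} [Bicategory.{w'', v''} E]
  [∀ X Y : D, Preadditive (X ⟶ Y)] [∀ X Y : D, Linear K (X ⟶ Y)] [IsLinearTwoCategory K D]

/-- The coboundary of the complex of purely pseudofunctorial deformations of `F`. -/
def deltaH [Bicategory.Strict C] [Bicategory.Strict D] (m : ℕ) (F : C ⥤ᵖ D) :
    Cochain K m F →ₗ[K] Cochain K (m + 1) F :=
  firstFace K m F + ∑ i : Fin (m + 1), (-1 : K) ^ (i.val + 1) • innerFace K m F i +
    (-1 : K) ^ (m + 2) • lastFace K m F

/-- Evaluation of a cochain on `(P f_0, …, P f_m)`, padded by the structure of `P`: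
`F (P f_0) ∘ ⋯ ∘ F (P f_m) ⟶ F (P f_0 ∘ ⋯ ∘ P f_m) ⟶ F (P (f_0 ∘ ⋯ ∘ f_m))`. -/
def pullback (m : ℕ) (P : E ⥤ᵖ C) (F : C ⥤ᵖ D) :
    Cochain K m F →ₗ[K] Cochain K m (P.comp F) :=
  LinearMap.restrict
    { toFun := fun φ _ _ s =>
        eqToHom (congrArg Str.comp (s.map_map P F)) ≫ φ _ _ (s.map P) ≫ F.map₂ (s.hat P)
      map_add' := by
        intro φ ψ
        funext X Y s
        exact (congrArg (_ ≫ ·) (Preadditive.add_comp _ _ _ _ _ _)).trans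
          (Preadditive.comp_add _ _ _ _ _ _)
      map_smul' := by
        intro k φ
        funext X Y s
        exact (congrArg (_ ≫ ·) (Linear.smul_comp _ _ _ _ _ _)).trans
          (Linear.comp_smul _ _ _ _ _ _) }
    (by
      intro φ hφ X Y s t σ
      have h := congrArg (fun x => F.map₂ x) (Str.hat_naturality P σ)
      simp only [PrelaxFunctor.map₂_comp] at h
      exact paste (σ.map_map P F).symm (paste (hφ _ _ _ _ (σ.map P)) h))

/-- Transport of cochains along an equality of pseudofunctors. -/
def castCochain (m : ℕ) : ∀ {F G : C ⥤ᵖ D}, F = G → (Cochain K m F →ₗ[K] Cochain K m G)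
  | _, _, rfl => LinearMap.id

end Cochains2

namespace Str

section Pairs

variable {A B C D : Type u} [Bicategory.{w, v} A] [Bicategory.{w, v} B] [Bicategory.{w, v} C]
  [Bicategory.{w, v} D]

/-- The first components of a string of pairs. -/
def fst : ∀ {m : ℕ} {X Y : A × B}, Str (A × B) m X Y → Str A m X.1 Y.1
  | _, _, _, single f => single f.1
  | _, _, _, cons f s => cons f.1 s.fst

/-- The second components of a string of pairs. -/
def snd : ∀ {m : ℕ} {X Y : A × B}, Str (A × B) m X Y → Str B m X.2 Y.2
  | _, _, _, single f => single f.2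
  | _, _, _, cons f s => cons f.2 s.snd

theorem comp_fst : ∀ {m : ℕ} {X Y : A × B} (s : Str (A × B) m X Y), s.fst.comp = s.comp.1
  | _, _, _, single _ => rfl
  | _, _, _, cons f s => congrArg (· ≫ f.1) (comp_fst s)

theorem comp_snd : ∀ {m : ℕ} {X Y : A × B} (s : Str (A × B) m X Y), s.snd.comp = s.comp.2
  | _, _, _, single _ => rfl
  | _, _, _, cons f s => congrArg (· ≫ f.2) (comp_snd s)

theorem map_prod_fst (F : A ⥤ᵖ C) (G : B ⥤ᵖ D) : ∀ {m : ℕ} {X Y : A × B} (s : Str (A × B) m X Y),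
    (s.map (prodPF F G)).comp.1 = (s.fst.map F).comp
  | _, _, _, single _ => rfl
  | _, _, _, cons f s => congrArg (· ≫ F.map f.1) (map_prod_fst F G s)

theorem map_prod_snd (F : A ⥤ᵖ C) (G : B ⥤ᵖ D) : ∀ {m : ℕ} {X Y : A × B} (s : Str (A × B) m X Y),
    (s.map (prodPF F G)).comp.2 = (s.snd.map G).comp
  | _, _, _, single _ => rfl
  | _, _, _, cons f s => congrArg (· ≫ G.map f.2) (map_prod_snd F G s)

theorem map_id : ∀ {m : ℕ} {X Y : A} (s : Str A m X Y), s.map (Pseudofunctor.id A) = s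
  | _, _, _, single _ => rfl
  | _, _, _, cons f s => congrArg (cons f) (map_id s)

namespace Hom

def fst : ∀ {m : ℕ} {X Y : A × B} {s t : Str (A × B) m X Y}, Hom s t → Hom s.fst t.fst
  | _, _, _, _, _, single τ => single τ.1
  | _, _, _, _, _, cons τ σ => cons τ.1 σ.fst

def snd : ∀ {m : ℕ} {X Y : A × B} {s t : Str (A × B) m X Y}, Hom s t → Hom s.snd t.snd
  | _, _, _, _, _, single τ => single τ.2
  | _, _, _, _, _, cons τ σ => cons τ.2 σ.snd

theorem comp_fst : ∀ {m : ℕ} {X Y : A × B} {s t : Str (A × B) m X Y} (σ : Hom s t),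
    σ.fst.comp ≫ eqToHom (Str.comp_fst t) = eqToHom (Str.comp_fst s) ≫ σ.comp.1
  | _, _, _, _, _, single σ => (Category.comp_id _).trans (Category.id_comp _).symm
  | _, _, _, _, _, cons ρ σ => whisker_eqToHom _ _ (comp_fst σ) ρ.1 _ _

theorem comp_snd : ∀ {m : ℕ} {X Y : A × B} {s t : Str (A × B) m X Y} (σ : Hom s t),
    σ.snd.comp ≫ eqToHom (Str.comp_snd t) = eqToHom (Str.comp_snd s) ≫ σ.comp.2
  | _, _, _, _, _, single σ => (Category.comp_id _).trans (Category.id_comp _).symm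
  | _, _, _, _, _, cons ρ σ => whisker_eqToHom _ _ (comp_snd σ) ρ.2 _ _

theorem map_prod_fst (F : A ⥤ᵖ C) (G : B ⥤ᵖ D) :
    ∀ {m : ℕ} {X Y : A × B} {s t : Str (A × B) m X Y} (σ : Hom s t),
    (σ.map (prodPF F G)).comp.1 ≫ eqToHom (Str.map_prod_fst F G t) =
      eqToHom (Str.map_prod_fst F G s) ≫ (σ.fst.map F).comp
  | _, _, _, _, _, single σ => (Category.comp_id _).trans (Category.id_comp _).symm
  | _, _, _, _, _, cons ρ σ => whisker_eqToHom _ _ (map_prod_fst F G σ) (F.map₂ ρ.1) _ _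

theorem map_prod_snd (F : A ⥤ᵖ C) (G : B ⥤ᵖ D) :
    ∀ {m : ℕ} {X Y : A × B} {s t : Str (A × B) m X Y} (σ : Hom s t),
    (σ.map (prodPF F G)).comp.2 ≫ eqToHom (Str.map_prod_snd F G t) =
      eqToHom (Str.map_prod_snd F G s) ≫ (σ.snd.map G).comp
  | _, _, _, _, _, single σ => (Category.comp_id _).trans (Category.id_comp _).symm
  | _, _, _, _, _, cons ρ σ => whisker_eqToHom _ _ (map_prod_snd F G σ) (G.map₂ ρ.2) _ _

theorem map_id : ∀ {m : ℕ} {X Y : A} {s t : Str A m X Y} (σ : Hom s t),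
    (σ.map (Pseudofunctor.id A)).comp ≫ eqToHom (congrArg Str.comp (Str.map_id t)) =
      eqToHom (congrArg Str.comp (Str.map_id s)) ≫ σ.comp
  | _, _, _, _, _, single σ => (Category.comp_id _).trans (Category.id_comp _).symm
  | _, _, _, _, _, cons ρ σ => whisker_eqToHom _ _ (map_id σ) ρ _ _

end Hom

end Pairs

end Str

section Tensor

variable {A B C D : Type u} [Bicategory.{w, v} A] [Bicategory.{w, v} B] [Bicategory.{w, v} C]
  [Bicategory.{w, v} D]

/-- The identity 2-morphisms of `f_0 ∘ ⋯ ∘ f_m`, as a family for the identity pseudofunctor. -/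
def idFam (m : ℕ) : Fam m (Pseudofunctor.id A) :=
  fun _ _ s => eqToHom (congrArg Str.comp s.map_id)

theorem isNatural_idFam (m : ℕ) : IsNatural (idFam (A := A) m) :=
  fun _ _ _ _ σ => σ.map_id.symm

/-- The family of the pairs `(φ (f_0, …, f_m), ψ (g_0, …, g_m))`. -/
def prodFam {m : ℕ} {F : A ⥤ᵖ C} {G : B ⥤ᵖ D} (φ : Fam m F) (ψ : Fam m G) :
    Fam m (prodPF F G) :=
  fun _ _ s =>
    (eqToHom (s.map_prod_fst F G) ≫ φ _ _ s.fst ≫ eqToHom (congrArg F.map s.comp_fst),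
      eqToHom (s.map_prod_snd F G) ≫ ψ _ _ s.snd ≫ eqToHom (congrArg G.map s.comp_snd))

theorem isNatural_prodFam {m : ℕ} {F : A ⥤ᵖ C} {G : B ⥤ᵖ D} {φ : Fam m F} {ψ : Fam m G}
    (hφ : IsNatural φ) (hψ : IsNatural ψ) : IsNatural (prodFam φ ψ) := by
  intro X Y s t σ
  refine Prod.ext ?_ ?_
  · have h := congrArg (fun x => F.map₂ x) σ.comp_fst
    simp only [PrelaxFunctor.map₂_comp, PrelaxFunctor.map₂_eqToHom] at h
    exact paste (σ.map_prod_fst F G).symm (paste (hφ _ _ _ _ σ.fst) h.symm)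
  · have h := congrArg (fun x => G.map₂ x) σ.comp_snd
    simp only [PrelaxFunctor.map₂_comp, PrelaxFunctor.map₂_eqToHom] at h
    exact paste (σ.map_prod_snd F G).symm (paste (hψ _ _ _ _ σ.snd) h.symm)

/-- The family `⌈T (φ (f_0, …, f_m))⌉`:
`T F f_0 ∘ ⋯ ∘ T F f_m ⟶ T (F f_0 ∘ ⋯ ∘ F f_m) ⟶ T (F (f_0 ∘ ⋯ ∘ f_m))`. -/
def postFam {m : ℕ} {F : A ⥤ᵖ B} (T : B ⥤ᵖ C) (φ : Fam m F) : Fam m (F.comp T) :=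
  fun _ _ s => eqToHom (congrArg Str.comp (s.map_map F T)) ≫ (s.map F).hat T ≫ T.map₂ (φ _ _ s)

theorem isNatural_postFam {m : ℕ} {F : A ⥤ᵖ B} (T : B ⥤ᵖ C) {φ : Fam m F} (hφ : IsNatural φ) :
    IsNatural (postFam T φ) := by
  intro X Y s t σ
  have h := congrArg (fun x => T.map₂ x) (hφ _ _ _ _ σ)
  simp only [PrelaxFunctor.map₂_comp] at h
  exact paste (σ.map_map F T).symm (paste (Str.hat_naturality T (σ.map F)) h)

end Tensor

section Gray

variable (K : Type*) [CommRing K] (B : Type u) [Bicategory.{w, v} B] [Bicategory.Strict B]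
  [∀ X Y : B, Preadditive (X ⟶ Y)] [∀ X Y : B, Linear K (X ⟶ Y)] [IsLinearTwoCategory K B]

/-- A `K`-linear Gray semigroup: a cubical pseudofunctor `⊗`, `K`-bilinear on 2-morphisms, which
is associative, that is, whose associator and pentagonator are identities. The equality `assoc` of
pseudofunctors says that the two bracketings agree on objects, 1-morphisms and 2-morphisms and
that they have the same structural 2-isomorphisms. -/
structure GraySemigroup where
  /-- The tensor product. -/
  tensor : (B × B) ⥤ᵖ B
  add_map₂ : ∀ {X X' Y Y' : B} {f f' : X ⟶ X'} {g g' : Y ⟶ Y'} (σ τ : f ⟶ f') (ρ : g ⟶ g'),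
    tensor.map₂ (((σ + τ, ρ) : ((f, g) : (X, Y) ⟶ (X', Y')) ⟶ (f', g'))) =
      tensor.map₂ (((σ, ρ) : ((f, g) : (X, Y) ⟶ (X', Y')) ⟶ (f', g'))) +
        tensor.map₂ (((τ, ρ) : ((f, g) : (X, Y) ⟶ (X', Y')) ⟶ (f', g')))
  smul_map₂ : ∀ {X X' Y Y' : B} {f f' : X ⟶ X'} {g g' : Y ⟶ Y'} (k : K) (σ : f ⟶ f')
    (ρ : g ⟶ g'),
    tensor.map₂ (((k • σ, ρ) : ((f, g) : (X, Y) ⟶ (X', Y')) ⟶ (f', g'))) =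
      k • tensor.map₂ (((σ, ρ) : ((f, g) : (X, Y) ⟶ (X', Y')) ⟶ (f', g')))
  map₂_add : ∀ {X X' Y Y' : B} {f f' : X ⟶ X'} {g g' : Y ⟶ Y'} (ρ : f ⟶ f') (σ τ : g ⟶ g'),
    tensor.map₂ (((ρ, σ + τ) : ((f, g) : (X, Y) ⟶ (X', Y')) ⟶ (f', g'))) =
      tensor.map₂ (((ρ, σ) : ((f, g) : (X, Y) ⟶ (X', Y')) ⟶ (f', g'))) +
        tensor.map₂ (((ρ, τ) : ((f, g) : (X, Y) ⟶ (X', Y')) ⟶ (f', g')))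
  map₂_smul : ∀ {X X' Y Y' : B} {f f' : X ⟶ X'} {g g' : Y ⟶ Y'} (k : K) (ρ : f ⟶ f')
    (σ : g ⟶ g'),
    tensor.map₂ (((ρ, k • σ) : ((f, g) : (X, Y) ⟶ (X', Y')) ⟶ (f', g'))) =
      k • tensor.map₂ (((ρ, σ) : ((f, g) : (X, Y) ⟶ (X', Y')) ⟶ (f', g')))
  mapId_eq : ∀ X Y : B, ∃ h, tensor.mapId (X, Y) = eqToIso h
  cubical_left : ∀ {X X' X'' Y Y' : B} (f : X ⟶ X') (f' : X' ⟶ X'') (g : Y ⟶ Y'), ∃ h,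
    tensor.mapComp ((f, g) : (X, Y) ⟶ (X', Y')) ((f', 𝟙 Y') : (X', Y') ⟶ (X'', Y')) = eqToIso h
  cubical_right : ∀ {X X' Y Y' Y'' : B} (f : X ⟶ X') (g : Y ⟶ Y') (g' : Y' ⟶ Y''), ∃ h,
    tensor.mapComp ((𝟙 X, g) : (X, Y) ⟶ (X, Y')) ((f, g') : (X, Y') ⟶ (X', Y'')) = eqToIso h
  assoc : (assocPF B B B).comp ((prodPF tensor (Pseudofunctor.id B)).comp tensor) =
    (prodPF (Pseudofunctor.id B) tensor).comp tensor

end Gray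

section DeltaV

variable {K : Type*} [CommRing K] {B : Type u} [Bicategory.{w, v} B] [Bicategory.Strict B]
  [∀ X Y : B, Preadditive (X ⟶ Y)] [∀ X Y : B, Linear K (X ⟶ Y)] [IsLinearTwoCategory K B]
  (G : GraySemigroup K B) {C : Type u} [Bicategory.{w, v} C]

namespace GraySemigroup

variable {X X' Y Y' : B} {f f₁ f₂ f' : X ⟶ X'} {g g₁ g₂ g' : Y ⟶ Y'}

theorem left_add (ρ : f ⟶ f') (e : g ⟶ g₁) (x y : g₁ ⟶ g₂) (e' : g₂ ⟶ g')
    {a b : G.tensor.obj (X, Y) ⟶ G.tensor.obj (X', Y')} (p : a ⟶ b)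
    (q : b ⟶ G.tensor.map ((f, g) : (X, Y) ⟶ (X', Y'))) :
    p ≫ q ≫ G.tensor.map₂ ((ρ, e ≫ (x + y) ≫ e') : ((f, g) : (X, Y) ⟶ (X', Y')) ⟶ (f', g')) =
      p ≫ q ≫ G.tensor.map₂ ((ρ, e ≫ x ≫ e') : ((f, g) : (X, Y) ⟶ (X', Y')) ⟶ (f', g')) +
      p ≫ q ≫ G.tensor.map₂ ((ρ, e ≫ y ≫ e') : ((f, g) : (X, Y) ⟶ (X', Y')) ⟶ (f', g')) := by
  rw [Preadditive.add_comp, Preadditive.comp_add, G.map₂_add, Preadditive.comp_add,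
    Preadditive.comp_add]

theorem left_smul (ρ : f ⟶ f') (e : g ⟶ g₁) (k : K) (x : g₁ ⟶ g₂) (e' : g₂ ⟶ g')
    {a b : G.tensor.obj (X, Y) ⟶ G.tensor.obj (X', Y')} (p : a ⟶ b)
    (q : b ⟶ G.tensor.map ((f, g) : (X, Y) ⟶ (X', Y'))) :
    p ≫ q ≫ G.tensor.map₂ ((ρ, e ≫ (k • x) ≫ e') : ((f, g) : (X, Y) ⟶ (X', Y')) ⟶ (f', g')) =
      k • (p ≫ q ≫
        G.tensor.map₂ ((ρ, e ≫ x ≫ e') : ((f, g) : (X, Y) ⟶ (X', Y')) ⟶ (f', g'))) := by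
  rw [Linear.smul_comp, Linear.comp_smul, G.map₂_smul, Linear.comp_smul, Linear.comp_smul]

theorem right_add (ρ : g ⟶ g') (e : f ⟶ f₁) (x y : f₁ ⟶ f₂) (e' : f₂ ⟶ f')
    {a b : G.tensor.obj (X, Y) ⟶ G.tensor.obj (X', Y')} (p : a ⟶ b)
    (q : b ⟶ G.tensor.map ((f, g) : (X, Y) ⟶ (X', Y'))) :
    p ≫ q ≫ G.tensor.map₂ ((e ≫ (x + y) ≫ e', ρ) : ((f, g) : (X, Y) ⟶ (X', Y')) ⟶ (f', g')) =
      p ≫ q ≫ G.tensor.map₂ ((e ≫ x ≫ e', ρ) : ((f, g) : (X, Y) ⟶ (X', Y')) ⟶ (f', g')) +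
      p ≫ q ≫ G.tensor.map₂ ((e ≫ y ≫ e', ρ) : ((f, g) : (X, Y) ⟶ (X', Y')) ⟶ (f', g')) := by
  rw [Preadditive.add_comp, Preadditive.comp_add, G.add_map₂, Preadditive.comp_add,
    Preadditive.comp_add]

theorem right_smul (ρ : g ⟶ g') (e : f ⟶ f₁) (k : K) (x : f₁ ⟶ f₂) (e' : f₂ ⟶ f')
    {a b : G.tensor.obj (X, Y) ⟶ G.tensor.obj (X', Y')} (p : a ⟶ b)
    (q : b ⟶ G.tensor.map ((f, g) : (X, Y) ⟶ (X', Y'))) :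
    p ≫ q ≫ G.tensor.map₂ ((e ≫ (k • x) ≫ e', ρ) : ((f, g) : (X, Y) ⟶ (X', Y')) ⟶ (f', g')) =
      k • (p ≫ q ≫
        G.tensor.map₂ ((e ≫ x ≫ e', ρ) : ((f, g) : (X, Y) ⟶ (X', Y')) ⟶ (f', g'))) := by
  rw [Linear.smul_comp, Linear.comp_smul, G.smul_map₂, Linear.comp_smul, Linear.comp_smul]

end GraySemigroup

/-- `((f_0, g_0), …, (f_m, g_m)) ↦ ⌈1_{f_0 ∘ ⋯ ∘ f_m} ⊗ φ (g_0, …, g_m)⌉`. -/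
def leftTensor (m : ℕ) (F : C ⥤ᵖ B) : Cochain K m F →ₗ[K]
    Cochain K m ((prodPF (Pseudofunctor.id B) F).comp G.tensor) :=
  LinearMap.restrict
    { toFun := fun φ => postFam G.tensor (prodFam (idFam m) φ)
      map_add' := by
        intro φ ψ
        funext X Y s
        exact G.left_add _ _ (φ _ _ s.snd) (ψ _ _ s.snd) _ _ _
      map_smul' := by
        intro k φ
        funext X Y s
        exact G.left_smul _ _ k (φ _ _ s.snd) _ _ _ }
    (fun _ hφ => isNatural_postFam _ (isNatural_prodFam (isNatural_idFam m) hφ))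

/-- `((g_0, f_0), …, (g_m, f_m)) ↦ ⌈φ (g_0, …, g_m) ⊗ 1_{f_0 ∘ ⋯ ∘ f_m}⌉`. -/
def rightTensor (m : ℕ) (F : C ⥤ᵖ B) : Cochain K m F →ₗ[K]
    Cochain K m ((prodPF F (Pseudofunctor.id B)).comp G.tensor) :=
  LinearMap.restrict
    { toFun := fun φ => postFam G.tensor (prodFam φ (idFam m))
      map_add' := by
        intro φ ψ
        funext X Y s
        exact G.right_add _ _ (φ _ _ s.fst) (ψ _ _ s.fst) _ _ _
      map_smul' := by
        intro k φ
        funext X Y s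
        exact G.right_smul _ _ k (φ _ _ s.fst) _ _ _ }
    (fun _ hφ => isNatural_postFam _ (isNatural_prodFam hφ (isNatural_idFam m)))

/-- `X^{m,n}`: natural families of 2-morphisms
`φ : ⊗(n + 1) f_0 ∘ ⋯ ∘ ⊗(n + 1) f_m ⟶ ⊗(n + 1) (f_0 ∘ ⋯ ∘ f_m)`, for strings `(f_0, …, f_m)` of
1-morphisms of `B ^ (n + 1)`. -/
abbrev Xext (m n : ℕ) : Submodule K (Fam m (tensorPow G.tensor n)) :=
  Cochain K m (tensorPow G.tensor n)

/-- The horizontal coboundary `δ_h`. -/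
def dh (m n : ℕ) : Xext G m n →ₗ[K] Xext G (m + 1) n :=
  deltaH K m (tensorPow G.tensor n)

/-- The first term `⌈1 ⊗ φ⌉` of `δ_v φ`. -/
def dvFirst (m n : ℕ) : Xext G m n →ₗ[K] Xext G m (n + 1) :=
  leftTensor G m (tensorPow G.tensor n)

/-- The term of `δ_v φ` in which the tensor factors `i` and `i + 1` are multiplied. -/
def dvInner (m n : ℕ) (i : Fin (n + 1)) : Xext G m n →ₗ[K] Xext G m (n + 1) :=
  castCochain K m (contract_comp G.tensor G.assoc n i) ∘ₗ
    pullback K m (contract G.tensor n i) (tensorPow G.tensor n)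

/-- The last term `⌈φ ⊗ 1⌉` of `δ_v φ`. -/
def dvLast (m n : ℕ) : Xext G m n →ₗ[K] Xext G m (n + 1) :=
  castCochain K m (splitLast_comp G.tensor G.assoc n) ∘ₗ
    pullback K m (splitLast n) ((prodPF (tensorPow G.tensor n) (Pseudofunctor.id B)).comp G.tensor) ∘ₗ
      rightTensor G m (tensorPow G.tensor n)

/-- The vertical coboundary `δ_v`. -/
def dv (m n : ℕ) : Xext G m n →ₗ[K] Xext G m (n + 1) :=
  dvFirst G m n + ∑ i : Fin (n + 1), (-1 : K) ^ (i.val + 1) • dvInner G m n i +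
    (-1 : K) ^ (n + 2) • dvLast G m n

/-- Families of 2-morphisms `𝟙 (F X) ⟶ 𝟙 (F X)`, with no condition, that is, pseudomodifications
of the identity of `F`. -/
abbrev EndFam (F : C ⥤ᵖ B) : Type (max u w) :=
  ∀ X : C, 𝟙 (F.obj X) ⟶ 𝟙 (F.obj X)

variable (K)

/-- Reindexing of a family along `P`. -/
def EndFam.pullback {E : Type u} [Bicategory.{w, v} E] (P : E ⥤ᵖ C) (F : C ⥤ᵖ B) :
    EndFam F →ₗ[K] EndFam (P.comp F) where
  toFun n X := n (P.obj X)
  map_add' _ _ := rfl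
  map_smul' _ _ := rfl

/-- Transport of families along an equality of pseudofunctors. -/
def EndFam.cast : ∀ {F F' : C ⥤ᵖ B}, F = F' → (EndFam F →ₗ[K] EndFam F')
  | _, _, rfl => LinearMap.id

variable {K}

/-- `(X, Y) ↦ 1 ⊗ n_Y`, where `𝟙 X ⊗ 𝟙 (F Y)` is identified with `𝟙 (X ⊗ F Y)`. -/
def EndFam.leftTensor (F : C ⥤ᵖ B) :
    EndFam F →ₗ[K] EndFam ((prodPF (Pseudofunctor.id B) F).comp G.tensor) where
  toFun n X := (G.tensor.mapId (X.1, F.obj X.2)).inv ≫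
    G.tensor.map₂ (((𝟙 (𝟙 X.1), n X.2) : 𝟙 (X.1, F.obj X.2) ⟶ 𝟙 (X.1, F.obj X.2))) ≫
      (G.tensor.mapId (X.1, F.obj X.2)).hom
  map_add' n n' := by
    funext X
    exact (congrArg (fun x => _ ≫ x ≫ _) (G.map₂_add _ _ _)).trans
      ((congrArg (_ ≫ ·) (Preadditive.add_comp _ _ _ _ _ _)).trans
        (Preadditive.comp_add _ _ _ _ _ _))
  map_smul' k n := by
    funext X
    exact (congrArg (fun x => _ ≫ x ≫ _) (G.map₂_smul _ _ _)).trans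
      ((congrArg (_ ≫ ·) (Linear.smul_comp _ _ _ _ _ _)).trans
        (Linear.comp_smul _ _ _ _ _ _))

/-- `(Y, X) ↦ n_Y ⊗ 1`, where `𝟙 (F Y) ⊗ 𝟙 X` is identified with `𝟙 (F Y ⊗ X)`. -/
def EndFam.rightTensor (F : C ⥤ᵖ B) :
    EndFam F →ₗ[K] EndFam ((prodPF F (Pseudofunctor.id B)).comp G.tensor) where
  toFun n X := (G.tensor.mapId (F.obj X.1, X.2)).inv ≫
    G.tensor.map₂ (((n X.1, 𝟙 (𝟙 X.2)) : 𝟙 (F.obj X.1, X.2) ⟶ 𝟙 (F.obj X.1, X.2))) ≫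
      (G.tensor.mapId (F.obj X.1, X.2)).hom
  map_add' n n' := by
    funext X
    exact (congrArg (fun x => _ ≫ x ≫ _) (G.add_map₂ _ _ _)).trans
      ((congrArg (_ ≫ ·) (Preadditive.add_comp _ _ _ _ _ _)).trans
        (Preadditive.comp_add _ _ _ _ _ _))
  map_smul' k n := by
    funext X
    exact (congrArg (fun x => _ ≫ x ≫ _) (G.smul_map₂ _ _ _)).trans
      ((congrArg (_ ≫ ·) (Linear.smul_comp _ _ _ _ _ _)).trans
        (Linear.comp_smul _ _ _ _ _ _))

/-- The module in degree `n` of the general pentagonator-deformation complex. -/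
abbrev Pent (n : ℕ) : Type (max u w) := EndFam (tensorPow G.tensor n)

/-- The first term `1 ⊗ n` of the coboundary. -/
def dpentFirst (n : ℕ) : Pent G n →ₗ[K] Pent G (n + 1) :=
  EndFam.leftTensor G (tensorPow G.tensor n)

/-- The term of the coboundary in which the tensor factors `i` and `i + 1` are multiplied. -/
def dpentInner (n : ℕ) (i : Fin (n + 1)) : Pent G n →ₗ[K] Pent G (n + 1) :=
  EndFam.cast K (contract_comp G.tensor G.assoc n i) ∘ₗ
    EndFam.pullback K (contract G.tensor n i) (tensorPow G.tensor n)

/-- The last term `n ⊗ 1` of the coboundary. -/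
def dpentLast (n : ℕ) : Pent G n →ₗ[K] Pent G (n + 1) :=
  EndFam.cast K (splitLast_comp G.tensor G.assoc n) ∘ₗ
    EndFam.pullback K (splitLast n)
      ((prodPF (tensorPow G.tensor n) (Pseudofunctor.id B)).comp G.tensor) ∘ₗ
        EndFam.rightTensor G (tensorPow G.tensor n)

/-- The coboundary `δ_pent`. -/
def dpent (n : ℕ) : Pent G n →ₗ[K] Pent G (n + 1) :=
  dpentFirst G n + ∑ i : Fin (n + 1), (-1 : K) ^ (i.val + 1) • dpentInner G n i +
    (-1 : K) ^ (n + 2) • dpentLast G n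

/-- `n_Y ∘ 1_{F f} - 1_{F f} ∘ n_X` for `f : X ⟶ Y`. -/
def EndFam.diff {F : C ⥤ᵖ B} (n : EndFam F) {X Y : C} (f : X ⟶ Y) : F.map f ⟶ F.map f :=
  (ρ_ (F.map f)).inv ≫ F.map f ◁ n Y ≫ (ρ_ (F.map f)).hom -
    (λ_ (F.map f)).inv ≫ n X ▷ F.map f ≫ (λ_ (F.map f)).hom

variable (K)

/-- `f ↦ n_Y ∘ 1_{F f} - 1_{F f} ∘ n_X`, on families. -/
def phiFam (F : C ⥤ᵖ B) : EndFam F →ₗ[K] Fam 0 F where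
  toFun n
    | _, _, .single f => n.diff f
  map_add' n n' := by
    funext X Y s
    cases s with
    | single f =>
      change EndFam.diff (n + n') f = EndFam.diff n f + EndFam.diff n' f
      simp only [EndFam.diff, Pi.add_apply, IsLinearTwoCategory.whiskerLeft_add (C := B) K,
        IsLinearTwoCategory.add_whiskerRight (C := B) K, Preadditive.add_comp, Preadditive.comp_add]
      abel
  map_smul' k n := by
    funext X Y s
    cases s with
    | single f =>
      change EndFam.diff (k • n) f = k • EndFam.diff n f
      simp only [EndFam.diff, Pi.smul_apply, IsLinearTwoCategory.whiskerLeft_smul,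
        IsLinearTwoCategory.smul_whiskerRight, Linear.smul_comp, Linear.comp_smul, smul_sub]

/-- `f ↦ n_Y ∘ 1_{F f} - 1_{F f} ∘ n_X`, as a cochain. -/
def phiOf (F : C ⥤ᵖ B) : EndFam F →ₗ[K] Cochain K 0 F :=
  (phiFam K F).codRestrict _ (by
    intro n X Y s t σ
    cases σ with
    | @single _ _ f g τ =>
      change ((ρ_ (F.map f)).inv ≫ F.map f ◁ n Y ≫ (ρ_ (F.map f)).hom -
          (λ_ (F.map f)).inv ≫ n X ▷ F.map f ≫ (λ_ (F.map f)).hom) ≫ F.map₂ τ =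
        F.map₂ τ ≫ ((ρ_ (F.map g)).inv ≫ F.map g ◁ n Y ≫ (ρ_ (F.map g)).hom -
          (λ_ (F.map g)).inv ≫ n X ▷ F.map g ≫ (λ_ (F.map g)).hom)
      rw [Preadditive.sub_comp, Preadditive.comp_sub]
      congr 1
      · rw [Category.assoc, Category.assoc, ← rightUnitor_naturality, whisker_exchange_assoc,
          rightUnitor_inv_naturality_assoc]
      · rw [Category.assoc, Category.assoc, ← leftUnitor_naturality, ← whisker_exchange_assoc,
          leftUnitor_inv_naturality_assoc])

variable {K}

/-- The map `φ` from the general pentagonator-deformation complex to the first column. -/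
def phi (n : ℕ) : Pent G n →ₗ[K] Xext G 0 n :=
  phiOf K (tensorPow G.tensor n)

/-- The modules `X^{m,n}`, with the first column replaced by the modules of the cone of `φ`. -/
def Xmod : ℕ → ℕ → ModuleCat.{max u v w} K
  | 0, n => ModuleCat.of K (Xext G 0 n × Pent G (n + 1))
  | m + 1, n => ModuleCat.of K (Xext G (m + 1) n)

/-- The differential `(φ, n) ↦ (δ_v φ + φ(n), - δ_pent n)` of the cone of `φ`. -/
def dcone (n : ℕ) : (Xext G 0 n × Pent G (n + 1)) →ₗ[K] (Xext G 0 (n + 1) × Pent G (n + 2)) :=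
  (dv G 0 n ∘ₗ LinearMap.fst K _ _ + phi G (n + 1) ∘ₗ LinearMap.snd K _ _).prod
    (-(dpent G (n + 1) ∘ₗ LinearMap.snd K _ _))

/-- `δ'_h`: for `m = 0` the projection followed by `δ_h`, otherwise `δ_h`. -/
def dhMod : ∀ m n, Xmod G m n ⟶ Xmod G (m + 1) n
  | 0, n => ModuleCat.ofHom (dh G 0 n ∘ₗ LinearMap.fst K (Xext G 0 n) (Pent G (n + 1)))
  | m + 1, n => ModuleCat.ofHom (dh G (m + 1) n)

/-- `δ'_v`: for `m = 0` the differential of the cone, otherwise `δ_v`. -/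
def dvMod : ∀ m n, Xmod G m n ⟶ Xmod G m (n + 1)
  | 0, n => ModuleCat.ofHom (dcone G n)
  | m + 1, n => ModuleCat.ofHom (dv G (m + 1) n)

end DeltaV

/-- `dh` and `dv` make `M` a double complex: rows and columns are complexes, squares commute. -/
structure IsDoubleComplex {K : Type*} [CommRing K] {M : ℕ → ℕ → ModuleCat.{u} K}
    (dh : ∀ m n, M m n ⟶ M (m + 1) n) (dv : ∀ m n, M m n ⟶ M m (n + 1)) : Prop where
  dh_comp_dh : ∀ m n, dh m n ≫ dh (m + 1) n = 0
  dv_comp_dv : ∀ m n, dv m n ≫ dv m (n + 1) = 0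
  comm : ∀ m n, dh m n ≫ dv (m + 1) n = dv m n ≫ dh m (n + 1)

end GrayComplex

/-! All three coboundaries are alternating sums of cofaces, so everything reduces to identities
between single cofaces. The six cosimplicial identities make two successive alternating sums compose
to zero (`alternating_comp_alternating`), and a linear map that intertwines each coface intertwines
the sums (`alternating_comp_comm`).

The obstacle is coherence: the two sides of such an identity often lie over pseudofunctors that are
equal only by a theorem, and the paddings ⌈ ⌉ have to be matched. Therefore a cochain is treated
together with its pseudofunctor as one element of a sigma type, where transports along equalities
disappear. `Decoration` axiomatizes such pairs: a composition `star`, a product `prod`, and a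
neutral decoration `can` of every pseudofunctor. The vertical cofaces are written with these
operations alone: 1 ⊗ x is `star (prod (can id) x) (can ⊗)`, x ⊗ 1 is its mirror image, and
multiplying two adjacent factors is composition with `can` of a contraction. Associativity of ⊗ as
an equality of pseudofunctors, the interchange of `star` with `prod`, and naturality of rebracketing
then give the vertical identities once and for all. The instance `famDecoration m` yields δ_v² = 0,
and `endDecoration` yields δ_pent² = 0.

A `DecorationMap` preserves `can`, `star` and `prod`, hence commutes with every vertical coface.
Each coface of δ_h is such a map, whence δ_h δ_v = δ_v δ_h. The map φ is the difference of two such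
maps, n ↦ n_Y ∘ 1 and n ↦ 1 ∘ n_X, so δ_v φ = φ δ_pent follows by subtraction.

The horizontal identities, hence δ_h² = 0, are checked on strings, from the associativity axiom of a
pseudofunctor and the interchange law. Moreover δ_h φ = 0: for a composable pair of 1-morphisms, n
inserted at the source, in the middle and at the target occurs twice each, with opposite signs. The
statements about the cone are then formal: its differential squares to zero because φ is a cochain
map, and the squares leaving the first column commute because δ_h φ = 0. -/

namespace GrayComplex

/-! ### Alternating sums of cofaces. -/

section AlternatingSums

variable {K M₀ M₁ M₂ : Type*} [CommRing K] [AddCommGroup M₀] [AddCommGroup M₁] [AddCommGroup M₂]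
  [Module K M₀] [Module K M₁] [Module K M₂]

/-- The usual cancellation of d ∘ d for a cosimplicial module, for the inner cofaces among
themselves; the two outer cofaces are kept apart because they are constructed differently. -/
theorem sum_inner_comp_inner (n : ℕ) (c : Fin (n + 1) → M₀ →ₗ[K] M₁)
    (c' : Fin (n + 2) → M₁ →ₗ[K] M₂)
    (hcc : ∀ i j : Fin (n + 1), i ≤ j → c' j.succ ∘ₗ c i = c' i.castSucc ∘ₗ c j) :
    (∑ j : Fin (n + 2), (-1 : K) ^ (j.val + 1) • c' j) ∘ₗ
      (∑ i : Fin (n + 1), (-1 : K) ^ (i.val + 1) • c i) = 0 := by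
  have h0 : (∑ j : Fin (n + 2), (-1 : K) ^ (j.val + 1) • c' j) ∘ₗ
      (∑ i : Fin (n + 1), (-1 : K) ^ (i.val + 1) • c i) =
      ∑ p : Fin (n + 2) × Fin (n + 1), (-1 : K) ^ (p.1.val + p.2.val) • (c' p.1 ∘ₗ c p.2) := by
    rw [Fintype.sum_prod_type]
    ext x
    simp only [LinearMap.coe_comp, Function.comp_apply, LinearMap.sum_apply, LinearMap.smul_apply,
      map_sum, map_smul, Finset.smul_sum, smul_smul]
    rw [Finset.sum_comm]
    refine Finset.sum_congr rfl fun j _ => ?_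
    refine Finset.sum_congr rfl fun i _ => ?_
    congr 1
    ring
  rw [h0]
  -- The identity `hcc` matches the pairs (j, i) with i < j to those with j ≤ i, by (j, i) ↦ (i, j -
  -- 1) with inverse (j, i) ↦ (i + 1, j). The sum of the two indices changes by one, so the signs
  -- are opposite.
  refine Finset.sum_involution (fun p _ => if h : p.2.castSucc < p.1
      then (p.2.castSucc, p.1.pred (Fin.ne_zero_of_lt h))
      else (p.2.succ, p.1.castPred fun h' => h (h' ▸ p.2.castSucc_lt_last))) ?_ ?_ ?_ ?_
  · rintro ⟨j, i⟩ -
    by_cases h : i.castSucc < j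
    · obtain ⟨j, rfl⟩ := Fin.exists_succ_eq.2 (Fin.ne_zero_of_lt h)
      have hij : i ≤ j := by
        rw [Fin.lt_def] at h
        simp only [Fin.val_castSucc, Fin.val_succ] at h
        exact Fin.le_def.2 (by omega)
      simp only [h, dite_true, Fin.pred_succ, hcc i j hij, ← add_smul]
      rw [show (-1 : K) ^ (j.succ.val + i.val) + (-1) ^ (i.castSucc.val + j.val) = 0 by
        simp only [Fin.val_succ, Fin.val_castSucc]; ring, zero_smul]
    · obtain ⟨j, rfl⟩ := Fin.exists_castSucc_eq.2
        (show j ≠ Fin.last _ from fun h' => h (h' ▸ i.castSucc_lt_last))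
      have hij : j ≤ i := by
        rw [Fin.lt_def] at h; simp only [Fin.val_castSucc] at h; exact Fin.le_def.2 (by omega)
      simp only [h, dite_false, Fin.castPred_castSucc, hcc j i hij, ← add_smul]
      rw [show (-1 : K) ^ (j.castSucc.val + i.val) + (-1) ^ (i.succ.val + j.val) = 0 by
        simp only [Fin.val_succ, Fin.val_castSucc]; ring, zero_smul]
  · rintro ⟨j, i⟩ - -
    by_cases h : i.castSucc < j
    · simp only [h, dite_true, ne_eq, Prod.mk.injEq, not_and]
      exact fun h' => absurd h' h.ne
    · simp only [h, dite_false, ne_eq, Prod.mk.injEq, not_and]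
      intro h'
      exact absurd (h' ▸ Fin.castSucc_lt_succ) h
  · intros; exact Finset.mem_univ _
  · rintro ⟨j, i⟩ -
    by_cases h : i.castSucc < j
    · obtain ⟨j, rfl⟩ := Fin.exists_succ_eq.2 (Fin.ne_zero_of_lt h)
      have hij : ¬ j.castSucc < i.castSucc := by
        rw [Fin.lt_def] at h ⊢; simp only [Fin.val_castSucc, Fin.val_succ] at h ⊢; omega
      simp only [h, hij, dite_true, dite_false, Fin.pred_succ, Fin.castPred_castSucc]
    · obtain ⟨j, rfl⟩ := Fin.exists_castSucc_eq.2
        (show j ≠ Fin.last _ from fun h' => h (h' ▸ i.castSucc_lt_last))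
      have hij : j.castSucc < i.succ := by
        rw [Fin.lt_def] at h ⊢; simp only [Fin.val_castSucc, Fin.val_succ] at h ⊢; omega
      simp only [h, hij, dite_true, dite_false, Fin.pred_succ, Fin.castPred_castSucc]

/-- Two successive alternating sums of cofaces compose to zero. -/
theorem alternating_comp_alternating (n : ℕ) (f l : M₀ →ₗ[K] M₁) (c : Fin (n + 1) → M₀ →ₗ[K] M₁)
    (f' l' : M₁ →ₗ[K] M₂) (c' : Fin (n + 2) → M₁ →ₗ[K] M₂)
    (hff : c' 0 ∘ₗ f = f' ∘ₗ f) (hcf : ∀ i, c' i.succ ∘ₗ f = f' ∘ₗ c i)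
    (hlf : l' ∘ₗ f = f' ∘ₗ l)
    (hcc : ∀ i j : Fin (n + 1), i ≤ j → c' j.succ ∘ₗ c i = c' i.castSucc ∘ₗ c j)
    (hlc : ∀ i, l' ∘ₗ c i = c' i.castSucc ∘ₗ l) (hll : c' (Fin.last _) ∘ₗ l = l' ∘ₗ l) :
    (f' + ∑ i : Fin (n + 2), (-1 : K) ^ (i.val + 1) • c' i + (-1 : K) ^ (n + 3) • l') ∘ₗ
      (f + ∑ i : Fin (n + 1), (-1 : K) ^ (i.val + 1) • c i + (-1 : K) ^ (n + 2) • l) = 0 := by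
  -- The term i = 0 yields f' ∘ f; in the others the index drops by one when c' passes f, which
  -- costs a sign.
  have h1 : (∑ i : Fin (n + 2), (-1 : K) ^ (i.val + 1) • c' i) ∘ₗ f =
      -(f' ∘ₗ f) - f' ∘ₗ ∑ i : Fin (n + 1), (-1 : K) ^ (i.val + 1) • c i := by
    rw [Fin.sum_univ_succ]
    ext x
    have hf := LinearMap.congr_fun hff x
    have hc := fun i => LinearMap.congr_fun (hcf i) x
    simp only [LinearMap.coe_comp, Function.comp_apply] at hf hc
    simp [hf, hc, pow_succ, sub_eq_add_neg]
  -- At the other end indices do not shift, so there is no extra sign, and the top term yields l' ∘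
  -- l.
  have h2 : (∑ i : Fin (n + 2), (-1 : K) ^ (i.val + 1) • c' i) ∘ₗ l =
      l' ∘ₗ (∑ i : Fin (n + 1), (-1 : K) ^ (i.val + 1) • c i) + (-1 : K) ^ (n + 2) • (l' ∘ₗ l) := by
    rw [Fin.sum_univ_castSucc]
    ext x
    have hl := LinearMap.congr_fun hll x
    have hc := fun i => LinearMap.congr_fun (hlc i) x
    simp only [LinearMap.coe_comp, Function.comp_apply] at hl hc
    simp [hl, hc]
  have h3 := sum_inner_comp_inner n c c' hcc
  have h4 : (-1 : K) ^ (n + 2) * (-1) ^ (n + 2) = 1 := by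
    rw [← mul_pow]; simp
  -- From here only the four relations for S, S', f, l, f', l' and the fact that the sign e has
  -- square 1 matter.
  generalize (∑ i : Fin (n + 2), (-1 : K) ^ (i.val + 1) • c' i) = S' at h1 h2 h3 ⊢
  generalize (∑ i : Fin (n + 1), (-1 : K) ^ (i.val + 1) • c i) = S at h1 h2 h3 ⊢
  rw [pow_succ _ (n + 2)]
  generalize (-1 : K) ^ (n + 2) = e at h2 h4 ⊢
  ext x
  have e1 := LinearMap.congr_fun h1 x
  have e2 := LinearMap.congr_fun h2 x
  have e3 := LinearMap.congr_fun h3 x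
  have e5 := LinearMap.congr_fun hlf x
  simp only [LinearMap.coe_comp, Function.comp_apply, LinearMap.sub_apply, LinearMap.neg_apply,
    LinearMap.add_apply, LinearMap.smul_apply, LinearMap.zero_apply] at e1 e2 e3 e5
  simp only [LinearMap.coe_comp, Function.comp_apply, LinearMap.add_apply, LinearMap.smul_apply,
    LinearMap.zero_apply, LinearMap.neg_apply, map_add, map_smul, smul_add, smul_smul, e1, e2, e3, e5,
    mul_one, smul_neg,
    neg_smul, h4, one_smul, mul_neg]
  abel

end AlternatingSums

/-! ### The pentagon for rebracketing products. -/

section Products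

variable {A : Type u} [Bicategory.{w, v} A] {B : Type u} [Bicategory.{w, v} B]
  {C : Type u} [Bicategory.{w, v} C] {D : Type u} [Bicategory.{w, v} D]

theorem id_comp_comp {X : Type*} [Category X] (x : X) : 𝟙 x ≫ 𝟙 x ≫ 𝟙 x = 𝟙 x ≫ 𝟙 x := by simp

/-- Both sides are the same permutation of brackets on objects, 1-morphisms and 2-morphisms; their
structural cells are composites of different numbers of identities. -/
theorem assocPF_pentagon :
    (prodPF (Pseudofunctor.id A) (assocPF B C D)).comp
      ((assocPF A (B × C) D).comp (prodPF (assocPF A B C) (Pseudofunctor.id D))) =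
    (assocPF A B (C × D)).comp (assocPF (A × B) C D) := by
  refine pseudofunctor_ext rfl (fun a => heq_of_eq ?_) (fun f g => heq_of_eq ?_)
  · exact Prod.ext (Prod.ext (Prod.ext (id_comp_comp _) (id_comp_comp _)) (id_comp_comp _))
      (id_comp_comp _)
  · exact Prod.ext (Prod.ext (Prod.ext (id_comp_comp _) (id_comp_comp _)) (id_comp_comp _))
      (id_comp_comp _)

end Products

/-- A calculus of decorated pseudofunctors: they compose, they have products, and each pseudofunctor
has a canonical decoration. -/
structure Decoration where
  Hom : ∀ (A C : Type u) [Bicategory.{w, v} A] [Bicategory.{w, v} C], Type (max u v w)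
  can : ∀ {A C : Type u} [Bicategory.{w, v} A] [Bicategory.{w, v} C], (A ⥤ᵖ C) → Hom A C
  star : ∀ {A C E : Type u} [Bicategory.{w, v} A] [Bicategory.{w, v} C] [Bicategory.{w, v} E],
    Hom A C → Hom C E → Hom A E
  prod : ∀ {A A' C C' : Type u} [Bicategory.{w, v} A] [Bicategory.{w, v} A']
    [Bicategory.{w, v} C] [Bicategory.{w, v} C'], Hom A C → Hom A' C' → Hom (A × A') (C × C')
  star_assoc : ∀ {A C E E' : Type u} [Bicategory.{w, v} A] [Bicategory.{w, v} C]
    [Bicategory.{w, v} E] [Bicategory.{w, v} E'] (x : Hom A C) (y : Hom C E) (z : Hom E E'),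
    star (star x y) z = star x (star y z)
  id_star : ∀ {A C : Type u} [Bicategory.{w, v} A] [Bicategory.{w, v} C] (x : Hom A C),
    star (can (Pseudofunctor.id A)) x = x
  star_id : ∀ {A C : Type u} [Bicategory.{w, v} A] [Bicategory.{w, v} C] (x : Hom A C),
    star x (can (Pseudofunctor.id C)) = x
  can_comp : ∀ {A C E : Type u} [Bicategory.{w, v} A] [Bicategory.{w, v} C] [Bicategory.{w, v} E]
    (F : A ⥤ᵖ C) (G : C ⥤ᵖ E), can (F.comp G) = star (can F) (can G)
  can_prod : ∀ {A A' C C' : Type u} [Bicategory.{w, v} A] [Bicategory.{w, v} A']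
    [Bicategory.{w, v} C] [Bicategory.{w, v} C'] (F : A ⥤ᵖ C) (G : A' ⥤ᵖ C'),
    can (prodPF F G) = prod (can F) (can G)
  prod_star : ∀ {A A' C C' E E' : Type u} [Bicategory.{w, v} A] [Bicategory.{w, v} A']
    [Bicategory.{w, v} C] [Bicategory.{w, v} C'] [Bicategory.{w, v} E] [Bicategory.{w, v} E']
    (x : Hom A C) (x' : Hom A' C') (y : Hom C E) (y' : Hom C' E'),
    star (prod x x') (prod y y') = prod (star x y) (star x' y')
  assoc_nat : ∀ {A A' A'' C C' C'' : Type u} [Bicategory.{w, v} A] [Bicategory.{w, v} A']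
    [Bicategory.{w, v} A''] [Bicategory.{w, v} C] [Bicategory.{w, v} C'] [Bicategory.{w, v} C'']
    (x : Hom A C) (x' : Hom A' C') (x'' : Hom A'' C''),
    star (prod x (prod x' x'')) (can (assocPF C C' C'')) =
      star (can (assocPF A A' A'')) (prod (prod x x') x'')

/-! ### Relations between contractions and splittings of the powers of `B`. -/

section Contract

variable {B : Type u} [Bicategory.{w, v} B] (T : (B × B) ⥤ᵖ B)

/-- Associativity of `T` on the first three factors, with the remaining factors `A` as spectators.
The pentagon and naturality of rebracketing move those spectators out of the way. -/
theorem contract_zero_contract_zero {A : Type u} [Bicategory.{w, v} A]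
    (hT : (assocPF B B B).comp ((prodPF T (Pseudofunctor.id B)).comp T) =
      (prodPF (Pseudofunctor.id B) T).comp T) :
    (prodPF (Pseudofunctor.id B) ((assocPF B B A).comp (prodPF T (Pseudofunctor.id A)))).comp
      ((assocPF B B A).comp (prodPF T (Pseudofunctor.id A))) =
    ((assocPF B B (B × A)).comp (prodPF T (Pseudofunctor.id (B × A)))).comp
      ((assocPF B B A).comp (prodPF T (Pseudofunctor.id A))) := by
  have h1 : prodPF (Pseudofunctor.id B) ((assocPF B B A).comp (prodPF T (Pseudofunctor.id A))) =
      (prodPF (Pseudofunctor.id B) (assocPF B B A)).comp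
        (prodPF (Pseudofunctor.id B) (prodPF T (Pseudofunctor.id A))) := by
    rw [prodPF_comp, id_compPF]
  have h2 := congrArg (fun F => prodPF F (Pseudofunctor.id A)) hT
  have h3 : ∀ {X Y Z : Type u} [Bicategory.{w, v} X] [Bicategory.{w, v} Y] [Bicategory.{w, v} Z]
      (F : X ⥤ᵖ Y) (F' : Y ⥤ᵖ Z), prodPF (F.comp F') (Pseudofunctor.id A) =
        (prodPF F (Pseudofunctor.id A)).comp (prodPF F' (Pseudofunctor.id A)) := by
    intros
    rw [prodPF_comp, id_compPF]
  simp only [h3] at h2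
  rw [h1, comp_assocPF, ← comp_assocPF _ (assocPF B B A), assocPF_naturality, comp_assocPF, ← h2,
    ← comp_assocPF (assocPF B (B × B) A), ← comp_assocPF, assocPF_pentagon, comp_assocPF,
    comp_assocPF, ← comp_assocPF _ (assocPF B B A), ← prodPF_id, assocPF_naturality, comp_assocPF]

/-- `T` and `F` act on disjoint factors, so their order is irrelevant. -/
theorem contract_succ_contract_zero {A A' : Type u} [Bicategory.{w, v} A] [Bicategory.{w, v} A']
    (F : A ⥤ᵖ A') :
    (prodPF (Pseudofunctor.id B) (prodPF (Pseudofunctor.id B) F)).comp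
      ((assocPF B B A').comp (prodPF T (Pseudofunctor.id A'))) =
    ((assocPF B B A).comp (prodPF T (Pseudofunctor.id A))).comp
      (prodPF (Pseudofunctor.id B) F) := by
  rw [← comp_assocPF, assocPF_naturality, comp_assocPF, comp_assocPF, prodPF_comp, prodPF_comp,
    prodPF_id, id_compPF, id_compPF, comp_idPF, comp_idPF]

theorem prod_id_comp {A A' A'' : Type u} [Bicategory.{w, v} A] [Bicategory.{w, v} A']
    [Bicategory.{w, v} A''] (F : A ⥤ᵖ A') (F' : A' ⥤ᵖ A'') :
    (prodPF (Pseudofunctor.id B) F).comp (prodPF (Pseudofunctor.id B) F') =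
      prodPF (Pseudofunctor.id B) (F.comp F') := by
  rw [prodPF_comp, id_compPF]

theorem comp_prod_id {A A' A'' : Type u} [Bicategory.{w, v} A] [Bicategory.{w, v} A']
    [Bicategory.{w, v} A''] (F : A ⥤ᵖ A') (F' : A' ⥤ᵖ A'') :
    (prodPF F (Pseudofunctor.id B)).comp (prodPF F' (Pseudofunctor.id B)) =
      prodPF (F.comp F') (Pseudofunctor.id B) := by
  rw [prodPF_comp, id_compPF]

/-- Peeling off a common first factor reduces to i = 0. Then j = 0 is associativity of `T`, and j >
0 is the exchange of operations on disjoint factors. -/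
theorem contract_contract
    (hT : (assocPF B B B).comp ((prodPF T (Pseudofunctor.id B)).comp T) =
      (prodPF (Pseudofunctor.id B) T).comp T) :
    ∀ n (i j : Fin (n + 1)), i ≤ j → (contract T (n + 1) j.succ).comp (contract T n i) =
      (contract T (n + 1) i.castSucc).comp (contract T n j)
  | 0, ⟨0, _⟩, ⟨0, _⟩, _ => by
    refine hT.symm.trans ?_
    exact (comp_assocPF _ _ _).symm
  | 0, _, ⟨j + 1, h⟩, _ => by omega
  | 0, ⟨i + 1, h⟩, _, _ => by omega
  | n + 1, ⟨0, _⟩, ⟨0, _⟩, _ => contract_zero_contract_zero (A := Pow B n) T hT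
  | n + 1, ⟨0, _⟩, ⟨j + 1, h⟩, _ =>
    contract_succ_contract_zero T (contract T n ⟨j, Nat.lt_of_succ_lt_succ h⟩)
  | n + 1, ⟨i + 1, h⟩, ⟨0, _⟩, hij => by simp at hij
  | n + 1, ⟨i + 1, hi⟩, ⟨j + 1, hj⟩, hij =>
    (prod_id_comp _ _).trans ((congrArg (prodPF (Pseudofunctor.id B)) (contract_contract hT n
      ⟨i, Nat.lt_of_succ_lt_succ hi⟩ ⟨j, Nat.lt_of_succ_lt_succ hj⟩
      (Nat.le_of_succ_le_succ hij))).trans (prod_id_comp _ _).symm)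

theorem prod_id_splitLast_contract {P P' Q Q' : Type u} [Bicategory.{w, v} P]
    [Bicategory.{w, v} P'] [Bicategory.{w, v} Q] [Bicategory.{w, v} Q'] {S : P ⥤ᵖ Q × B}
    {S' : P' ⥤ᵖ Q' × B} {c : P ⥤ᵖ P'} {c' : Q ⥤ᵖ Q'}
    (h : S.comp (prodPF c' (Pseudofunctor.id B)) = c.comp S') :
    ((prodPF (Pseudofunctor.id B) S).comp (assocPF B Q B)).comp
      (prodPF (prodPF (Pseudofunctor.id B) c') (Pseudofunctor.id B)) =
    (prodPF (Pseudofunctor.id B) c).comp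
      ((prodPF (Pseudofunctor.id B) S').comp (assocPF B Q' B)) := by
  rw [comp_assocPF, ← assocPF_naturality, ← comp_assocPF, prod_id_comp, h, ← prod_id_comp,
    comp_assocPF]

theorem splitLast_contract_zero {P Q : Type u} [Bicategory.{w, v} P] [Bicategory.{w, v} Q]
    (S : P ⥤ᵖ Q × B) :
    ((prodPF (Pseudofunctor.id B) ((prodPF (Pseudofunctor.id B) S).comp (assocPF B Q B))).comp
        (assocPF B (B × Q) B)).comp
      (prodPF ((assocPF B B Q).comp (prodPF T (Pseudofunctor.id Q))) (Pseudofunctor.id B)) =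
    ((assocPF B B P).comp (prodPF T (Pseudofunctor.id P))).comp
      ((prodPF (Pseudofunctor.id B) S).comp (assocPF B Q B)) := by
  rw [← comp_prod_id, ← prod_id_comp, comp_assocPF, comp_assocPF,
    ← comp_assocPF (assocPF B (B × Q) B), ← comp_assocPF _ _ (prodPF (prodPF T _) _),
    assocPF_pentagon, comp_assocPF, ← assocPF_naturality, prodPF_id, ← comp_assocPF,
    assocPF_naturality, comp_assocPF, comp_assocPF, prodPF_id, ← comp_assocPF _ _ (assocPF B Q B),
    ← comp_assocPF (prodPF T _) _ (assocPF B Q B), prodPF_comp, prodPF_comp, id_compPF, id_compPF, comp_idPF,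
    comp_idPF]

/-- The contraction does not touch the factor that is split off. The case i = 0 is pure
rebracketing, and the step i + 1 adds one spectator on the left. -/
theorem splitLast_contract : ∀ n (i : Fin (n + 1)),
    (splitLast (n + 1)).comp (prodPF (contract T n i) (Pseudofunctor.id B)) =
      (contract T (n + 1) i.castSucc).comp (splitLast n)
  | 0, ⟨0, _⟩ => by
    change ((prodPF (Pseudofunctor.id B) (Pseudofunctor.id (B × B))).comp (assocPF B B B)).comp
      (prodPF T (Pseudofunctor.id B)) = ((assocPF B B B).comp (prodPF T (Pseudofunctor.id B))).comp
        (Pseudofunctor.id (B × B))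
    rw [prodPF_id, id_compPF, comp_idPF]
  | 0, ⟨i + 1, h⟩ => by omega
  | n + 1, ⟨0, _⟩ => splitLast_contract_zero T (splitLast n)
  | n + 1, ⟨i + 1, h⟩ =>
    prod_id_splitLast_contract (splitLast_contract n ⟨i, Nat.lt_of_succ_lt_succ h⟩)

/-- `(X_0, …, X_{n+2}) ↦ ((X_0, …, X_n), (X_{n+1}, X_{n+2}))` -/
def splitLastTwo : ∀ n, Pow B (n + 2) ⥤ᵖ (Pow B n × (B × B))
  | 0 => Pseudofunctor.id (B × (B × B))
  | n + 1 => (prodPF (Pseudofunctor.id B) (splitLastTwo n)).comp (assocPF B (Pow B n) (B × B))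

theorem prod_id_splitLastTwo_assoc {P P' Q : Type u} [Bicategory.{w, v} P]
    [Bicategory.{w, v} P'] [Bicategory.{w, v} Q] {S : P ⥤ᵖ P' × B}
    {S' : P' ⥤ᵖ Q × B} {X : P ⥤ᵖ Q × (B × B)}
    (h : X.comp (assocPF Q B B) = S.comp (prodPF S' (Pseudofunctor.id B))) :
    ((prodPF (Pseudofunctor.id B) X).comp (assocPF B Q (B × B))).comp (assocPF (B × Q) B B) =
    ((prodPF (Pseudofunctor.id B) S).comp (assocPF B P' B)).comp
      (prodPF ((prodPF (Pseudofunctor.id B) S').comp (assocPF B Q B)) (Pseudofunctor.id B)) := by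
  rw [comp_assocPF, ← assocPF_pentagon, ← comp_assocPF, prod_id_comp, h, ← prod_id_comp,
    ← comp_prod_id, comp_assocPF, comp_assocPF, ← comp_assocPF _ (assocPF B (Q × B) B),
    assocPF_naturality, comp_assocPF]

/-- With `splitLastTwo_tensor`, this exhibits both ways of treating the last two factors, one after
the other or multiplied together, as continuations of the single splitting `splitLastTwo`. The
identity for two successive last cofaces then becomes an identity over `Pow B n × (B × B)`. -/
theorem splitLastTwo_assoc : ∀ n, (splitLastTwo n).comp (assocPF (Pow B n) B B) =
    (splitLast (n + 1)).comp (prodPF (splitLast n) (Pseudofunctor.id B))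
  | 0 => by
    change (Pseudofunctor.id (B × (B × B))).comp (assocPF B B B) =
      ((prodPF (Pseudofunctor.id B) (Pseudofunctor.id (B × B))).comp (assocPF B B B)).comp
        (prodPF (Pseudofunctor.id (B × B)) (Pseudofunctor.id B))
    rw [prodPF_id, prodPF_id, comp_idPF]
  | n + 1 => prod_id_splitLastTwo_assoc (splitLastTwo_assoc n)

theorem prod_id_splitLastTwo_tensor {P P' Q : Type u} [Bicategory.{w, v} P]
    [Bicategory.{w, v} P'] [Bicategory.{w, v} Q] {S' : P' ⥤ᵖ Q × B}
    {X : P ⥤ᵖ Q × (B × B)} {c : P ⥤ᵖ P'}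
    (h : X.comp (prodPF (Pseudofunctor.id Q) T) = c.comp S') :
    ((prodPF (Pseudofunctor.id B) X).comp (assocPF B Q (B × B))).comp
      (prodPF (Pseudofunctor.id (B × Q)) T) =
    (prodPF (Pseudofunctor.id B) c).comp ((prodPF (Pseudofunctor.id B) S').comp (assocPF B Q B)) := by
  rw [comp_assocPF, ← prodPF_id, ← assocPF_naturality, ← comp_assocPF, prod_id_comp, h,
    ← prod_id_comp, comp_assocPF]

theorem splitLastTwo_tensor : ∀ n, (splitLastTwo n).comp (prodPF (Pseudofunctor.id (Pow B n)) T) =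
    (contract T (n + 1) (Fin.last (n + 1))).comp (splitLast n)
  | 0 => by
    change (Pseudofunctor.id (B × (B × B))).comp (prodPF (Pseudofunctor.id B) T) =
      (prodPF (Pseudofunctor.id B) T).comp (Pseudofunctor.id (B × B))
    rw [id_compPF, comp_idPF]
  | n + 1 => prod_id_splitLastTwo_tensor T (splitLastTwo_tensor n)

end Contract

/-! ### The vertical cosimplicial identities in an arbitrary decoration calculus. -/

namespace Decoration

variable (𝒟 : Decoration.{w, v, u}) {B : Type u} [Bicategory.{w, v} B] (T : (B × B) ⥤ᵖ B)
  {P Q Q' : Type u} [Bicategory.{w, v} P] [Bicategory.{w, v} Q] [Bicategory.{w, v} Q']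

/-- `1 ⊗ x` -/
def left (x : 𝒟.Hom P B) : 𝒟.Hom (B × P) B :=
  𝒟.star (𝒟.prod (𝒟.can (Pseudofunctor.id B)) x) (𝒟.can T)

/-- `x ⊗ 1` -/
def right (x : 𝒟.Hom P B) : 𝒟.Hom (P × B) B :=
  𝒟.star (𝒟.prod x (𝒟.can (Pseudofunctor.id B))) (𝒟.can T)

/-- Reindexing along a pseudofunctor. -/
def pull (F : Q ⥤ᵖ P) (x : 𝒟.Hom P B) : 𝒟.Hom Q B :=
  𝒟.star (𝒟.can F) x

theorem pull_pull (F : Q ⥤ᵖ P) (F' : Q' ⥤ᵖ Q) (x : 𝒟.Hom P B) :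
    𝒟.pull F' (𝒟.pull F x) = 𝒟.pull (F'.comp F) x := by
  rw [pull, pull, pull, can_comp, star_assoc]

theorem pull_left (F : Q ⥤ᵖ P) (x : 𝒟.Hom P B) :
    𝒟.pull (prodPF (Pseudofunctor.id B) F) (𝒟.left T x) = 𝒟.left T (𝒟.pull F x) := by
  rw [pull, left, left, can_prod, ← star_assoc, prod_star, id_star, pull]

theorem pull_right (F : Q ⥤ᵖ P) (x : 𝒟.Hom P B) :
    𝒟.pull (prodPF F (Pseudofunctor.id B)) (𝒟.right T x) = 𝒟.right T (𝒟.pull F x) := by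
  rw [pull, right, right, can_prod, ← star_assoc, prod_star, id_star, pull]

/-- Associativity of `T`. -/
abbrev _root_.GrayComplex.IsAssocTensor {B : Type u} [Bicategory.{w, v} B] (T : (B × B) ⥤ᵖ B) :
    Prop :=
  (assocPF B B B).comp ((prodPF T (Pseudofunctor.id B)).comp T) =
    (prodPF (Pseudofunctor.id B) T).comp T

variable {T}

/-- Obtained by applying `can` to the equality of pseudofunctors `hT`. Since `can` may depend on the
structural 2-isomorphisms, it matters that `hT` includes their equality. -/
theorem can_assoc (hT : IsAssocTensor T) : 𝒟.star (𝒟.can (assocPF B B B))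
    (𝒟.star (𝒟.prod (𝒟.can T) (𝒟.can (Pseudofunctor.id B))) (𝒟.can T)) =
      𝒟.star (𝒟.prod (𝒟.can (Pseudofunctor.id B)) (𝒟.can T)) (𝒟.can T) := by
  rw [← can_prod, ← can_comp, ← can_comp, hT, can_comp, can_prod]

theorem prod_id_star (x : 𝒟.Hom P Q) (y : 𝒟.Hom Q Q') :
    𝒟.prod (𝒟.can (Pseudofunctor.id B)) (𝒟.star x y) =
      𝒟.star (𝒟.prod (𝒟.can (Pseudofunctor.id B)) x) (𝒟.prod (𝒟.can (Pseudofunctor.id B)) y) := by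
  rw [prod_star, id_star]

theorem star_prod_id (x : 𝒟.Hom P Q) (y : 𝒟.Hom Q Q') :
    𝒟.prod (𝒟.star x y) (𝒟.can (Pseudofunctor.id B)) =
      𝒟.star (𝒟.prod x (𝒟.can (Pseudofunctor.id B))) (𝒟.prod y (𝒟.can (Pseudofunctor.id B))) := by
  rw [prod_star, id_star]

/-- The unit on X ⊗ Y is the tensor product of the units on X and Y, so this is associativity
applied to 1, 1 and x. -/
theorem pull_assoc_left (hT : IsAssocTensor T) (x : 𝒟.Hom P B) :
    𝒟.pull ((assocPF B B P).comp (prodPF T (Pseudofunctor.id P))) (𝒟.left T x) =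
      𝒟.left T (𝒟.left T x) := by
  -- `can T` and `x` occupy different factors, so they may be applied in either order.
  have h : 𝒟.star (𝒟.prod (𝒟.can T) (𝒟.can (Pseudofunctor.id P)))
      (𝒟.star (𝒟.prod (𝒟.can (Pseudofunctor.id B)) x) (𝒟.can T)) =
    𝒟.star (𝒟.prod (𝒟.prod (𝒟.can (Pseudofunctor.id B)) (𝒟.can (Pseudofunctor.id B))) x)
      (𝒟.star (𝒟.prod (𝒟.can T) (𝒟.can (Pseudofunctor.id B))) (𝒟.can T)) := by
    rw [← star_assoc, ← star_assoc, prod_star, prod_star, ← can_prod, prodPF_id, id_star, id_star,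
      star_id, star_id]
  rw [pull, left, left, can_comp, can_prod, star_assoc, h, prod_id_star, star_assoc,
    ← 𝒟.can_assoc hT, ← star_assoc, ← star_assoc, ← assoc_nat, star_assoc, star_assoc]

/-- Associativity applied to 1, x and 1: the decoration `x` is carried through the rebracketing by
`assoc_nat`. -/
theorem right_left (hT : IsAssocTensor T) (x : 𝒟.Hom P B) :
    𝒟.pull (assocPF B P B) (𝒟.right T (𝒟.left T x)) = 𝒟.left T (𝒟.right T x) := by
  rw [pull, left, left, right, right, star_prod_id, star_assoc, ← star_assoc, ← assoc_nat,
    star_assoc, can_assoc 𝒟 hT, prod_id_star, star_assoc]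

/-- Associativity applied to x, 1 and 1, the mirror image of `pull_assoc_left`. -/
theorem pull_right_tensor (hT : IsAssocTensor T) (x : 𝒟.Hom P B) :
    𝒟.pull (prodPF (Pseudofunctor.id P) T) (𝒟.right T x) =
      𝒟.pull (assocPF P B B) (𝒟.right T (𝒟.right T x)) := by
  have h : 𝒟.star (𝒟.prod (𝒟.can (Pseudofunctor.id P)) (𝒟.can T))
      (𝒟.star (𝒟.prod x (𝒟.can (Pseudofunctor.id B))) (𝒟.can T)) =
    𝒟.star (𝒟.prod x (𝒟.prod (𝒟.can (Pseudofunctor.id B)) (𝒟.can (Pseudofunctor.id B))))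
      (𝒟.star (𝒟.prod (𝒟.can (Pseudofunctor.id B)) (𝒟.can T)) (𝒟.can T)) := by
    rw [← star_assoc, ← star_assoc, prod_star, prod_star, ← can_prod, prodPF_id, id_star, id_star,
      star_id, star_id]
  rw [pull, pull, right, right, can_prod, h, ← can_assoc 𝒟 hT, ← star_assoc, assoc_nat, star_assoc,
    star_prod_id, star_assoc]

variable (T) in
/-- The inner cofaces. -/
def inner (n : ℕ) (i : Fin (n + 1)) (x : 𝒟.Hom (Pow B n) B) : 𝒟.Hom (Pow B (n + 1)) B :=
  𝒟.pull (contract T n i) x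

variable (T) in
/-- The first coface. -/
def first (n : ℕ) (x : 𝒟.Hom (Pow B n) B) : 𝒟.Hom (Pow B (n + 1)) B :=
  𝒟.left T x

variable (T) in
/-- The last coface. -/
def last (n : ℕ) (x : 𝒟.Hom (Pow B n) B) : 𝒟.Hom (Pow B (n + 1)) B :=
  𝒟.pull (splitLast n) (𝒟.right T x)

variable (n : ℕ) (x : 𝒟.Hom (Pow B n) B)

theorem inner_zero_first (hT : IsAssocTensor T) :
    𝒟.inner T (n + 1) 0 (𝒟.first T n x) = 𝒟.first T (n + 1) (𝒟.first T n x) :=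
  pull_assoc_left 𝒟 hT x

theorem inner_succ_first (i : Fin (n + 1)) :
    𝒟.inner T (n + 1) i.succ (𝒟.first T n x) = 𝒟.first T (n + 1) (𝒟.inner T n i x) :=
  𝒟.pull_left T (contract T n i) x

theorem last_first (hT : IsAssocTensor T) :
    𝒟.last T (n + 1) (𝒟.first T n x) = 𝒟.first T (n + 1) (𝒟.last T n x) :=
  (𝒟.pull_pull _ _ _).symm.trans ((congrArg (𝒟.pull _) (right_left 𝒟 hT x)).trans
    (𝒟.pull_left T (splitLast n) _))

theorem inner_inner (hT : IsAssocTensor T) (i j : Fin (n + 1)) (h : i ≤ j) :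
    𝒟.inner T (n + 1) j.succ (𝒟.inner T n i x) =
      𝒟.inner T (n + 1) i.castSucc (𝒟.inner T n j x) := by
  rw [inner, inner, inner, inner, pull_pull, pull_pull, contract_contract T hT n i j h]

theorem last_inner (i : Fin (n + 1)) :
    𝒟.last T (n + 1) (𝒟.inner T n i x) = 𝒟.inner T (n + 1) i.castSucc (𝒟.last T n x) := by
  rw [last, inner, inner, last, ← pull_right, pull_pull, pull_pull, splitLast_contract]

/-- Both sides are pulled back from `Pow B n × (B × B)` along `splitLastTwo`, where
`pull_right_tensor` compares them. -/
theorem inner_last_last (hT : IsAssocTensor T) :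
    𝒟.inner T (n + 1) (Fin.last _) (𝒟.last T n x) = 𝒟.last T (n + 1) (𝒟.last T n x) := by
  rw [inner, last, last, ← pull_right, pull_pull, pull_pull, ← splitLastTwo_assoc,
    ← splitLastTwo_tensor, ← pull_pull, ← pull_pull, pull_right_tensor 𝒟 hT]

end Decoration

/-- Morphisms of calculi of decorated pseudofunctors, on strict bicategories. -/
structure DecorationMap (𝒟 𝒟' : Decoration.{w, v, u}) where
  app : ∀ {A C : Type u} [Bicategory.{w, v} A] [Bicategory.{w, v} C] [Bicategory.Strict A]
    [Bicategory.Strict C], 𝒟.Hom A C → 𝒟'.Hom A C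
  app_can : ∀ {A C : Type u} [Bicategory.{w, v} A] [Bicategory.{w, v} C] [Bicategory.Strict A]
    [Bicategory.Strict C] (F : A ⥤ᵖ C), app (𝒟.can F) = 𝒟'.can F
  app_star : ∀ {A C E : Type u} [Bicategory.{w, v} A] [Bicategory.{w, v} C] [Bicategory.{w, v} E]
    [Bicategory.Strict A] [Bicategory.Strict C] [Bicategory.Strict E] (x : 𝒟.Hom A C)
    (y : 𝒟.Hom C E), app (𝒟.star x y) = 𝒟'.star (app x) (app y)
  app_prod : ∀ {A A' C C' : Type u} [Bicategory.{w, v} A] [Bicategory.{w, v} A']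
    [Bicategory.{w, v} C] [Bicategory.{w, v} C'] [Bicategory.Strict A] [Bicategory.Strict A']
    [Bicategory.Strict C] [Bicategory.Strict C'] (x : 𝒟.Hom A C) (x' : 𝒟.Hom A' C'),
    app (𝒟.prod x x') = 𝒟'.prod (app x) (app x')

/-! ### Maps of decoration calculi commute with the vertical cofaces. -/

namespace DecorationMap

variable {𝒟 𝒟' : Decoration.{w, v, u}} (f : DecorationMap 𝒟 𝒟') {B : Type u} [Bicategory.{w, v} B]
  [Bicategory.Strict B] (T : (B × B) ⥤ᵖ B) {P Q : Type u} [Bicategory.{w, v} P]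
  [Bicategory.{w, v} Q] [Bicategory.Strict P] [Bicategory.Strict Q]

theorem app_left (x : 𝒟.Hom P B) : f.app (𝒟.left T x) = 𝒟'.left T (f.app x) := by
  rw [Decoration.left, Decoration.left, app_star, app_prod, app_can, app_can]

theorem app_right (x : 𝒟.Hom P B) : f.app (𝒟.right T x) = 𝒟'.right T (f.app x) := by
  rw [Decoration.right, Decoration.right, app_star, app_prod, app_can, app_can]

theorem app_pull (F : Q ⥤ᵖ P) (x : 𝒟.Hom P B) : f.app (𝒟.pull F x) = 𝒟'.pull F (f.app x) := by
  rw [Decoration.pull, Decoration.pull, app_star, app_can]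

variable (n : ℕ) (x : 𝒟.Hom (Pow B n) B)

/-- This and the next two lemmas are the source of every commutation with δ_v: the cofaces are words
in `can`, `star` and `prod`, all preserved by `f`. -/
theorem app_first : f.app (𝒟.first T n x) = 𝒟'.first T n (f.app x) :=
  f.app_left T x

theorem app_inner (i : Fin (n + 1)) : f.app (𝒟.inner T n i x) = 𝒟'.inner T n i (f.app x) :=
  f.app_pull _ x

theorem app_last : f.app (𝒟.last T n x) = 𝒟'.last T n (f.app x) :=
  (f.app_pull _ _).trans (congrArg (𝒟'.pull _) (f.app_right T x))

end DecorationMap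

/-- Equality of morphisms up to equality of their sources and of their targets. -/
def Sim {C : Type*} [Category C] {a b a' b' : C} (x : a ⟶ b) (y : a' ⟶ b') : Prop :=
  a = a' ∧ b = b' ∧ HEq x y

/-! ### Comparison of 2-morphisms modulo the identifications of a strict bicategory. -/

namespace Sim

section Category

variable {C : Type*} [Category C] {a b c a' b' c' a'' b'' : C}

theorem refl (x : a ⟶ b) : Sim x x := ⟨rfl, rfl, HEq.rfl⟩

theorem of_eq {x y : a ⟶ b} (h : x = y) : Sim x y := h ▸ refl x

theorem symm {x : a ⟶ b} {y : a' ⟶ b'} (h : Sim x y) : Sim y x := ⟨h.1.symm, h.2.1.symm, h.2.2.symm⟩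

theorem trans {x : a ⟶ b} {y : a' ⟶ b'} {z : a'' ⟶ b''} (h : Sim x y) (h' : Sim y z) : Sim x z :=
  ⟨h.1.trans h'.1, h.2.1.trans h'.2.1, h.2.2.trans h'.2.2⟩

theorem eq {x y : a ⟶ b} (h : Sim x y) : x = y := eq_of_heq h.2.2

theorem comp {x : a ⟶ b} {y : b ⟶ c} {x' : a' ⟶ b'} {y' : b' ⟶ c'} (h : Sim x x') (h' : Sim y y') :
    Sim (x ≫ y) (x' ≫ y') := by
  obtain ⟨rfl, rfl, hx⟩ := h
  obtain ⟨-, rfl, hy⟩ := h'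
  cases hx
  cases hy
  exact refl _

theorem eqToHom_comp (h : a = b) (x : b ⟶ c) : Sim (eqToHom h ≫ x) x := by
  subst h
  exact of_eq (Category.id_comp x)

theorem comp_eqToHom (x : a ⟶ b) (h : b = c) : Sim (x ≫ eqToHom h) x := by
  subst h
  exact of_eq (Category.comp_id x)

theorem eqToHom_comp_eqToHom (h : a = b) (x : b ⟶ c) (h' : c = c') :
    Sim (eqToHom h ≫ x ≫ eqToHom h') x :=
  (eqToHom_comp h _).trans (comp_eqToHom x h')

/-- The object `c` is left free, because a canonical cell is typically known to be an identity only
after its source and target have been rewritten. -/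
theorem id_comp {x : a ⟶ b} {y : a' ⟶ b'} {z : b' ⟶ c'} (h : Sim x z) (h' : Sim y (𝟙 c)) :
    Sim x (y ≫ z) := by
  obtain ⟨rfl, rfl, h'⟩ := h'
  cases h'
  exact h.trans (of_eq (Category.id_comp z).symm)

theorem comp_id {x : a ⟶ b} {y : b' ⟶ c'} {z : a' ⟶ b'} (h : Sim x z) (h' : Sim y (𝟙 c)) :
    Sim x (z ≫ y) := by
  obtain ⟨rfl, rfl, h'⟩ := h'
  cases h'
  exact h.trans (of_eq (Category.comp_id z).symm)

theorem fst {X Y : Type*} [Category X] [Category Y] {p q p' q' : X × Y} {x : p ⟶ q} {y : p' ⟶ q'}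
    (h : Sim x y) : Sim x.1 y.1 := by
  obtain ⟨rfl, rfl, h⟩ := h
  cases h
  exact refl _

theorem snd {X Y : Type*} [Category X] [Category Y] {p q p' q' : X × Y} {x : p ⟶ q} {y : p' ⟶ q'}
    (h : Sim x y) : Sim x.2 y.2 := by
  obtain ⟨rfl, rfl, h⟩ := h
  cases h
  exact refl _

theorem prod {X Y : Type*} [Category X] [Category Y] {p q p' q' : X × Y} {x : p ⟶ q} {y : p' ⟶ q'}
    (h : Sim x.1 y.1) (h' : Sim x.2 y.2) : Sim x y := by
  obtain ⟨x₁, x₂⟩ := x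
  obtain ⟨y₁, y₂⟩ := y
  obtain ⟨p₁, p₂⟩ := p
  obtain ⟨q₁, q₂⟩ := q
  obtain ⟨p₁', p₂'⟩ := p'
  obtain ⟨q₁', q₂'⟩ := q'
  obtain ⟨h₁, h₂, h⟩ := h
  obtain ⟨h₁', h₂', h'⟩ := h'
  dsimp only at *
  subst h₁ h₂ h₁' h₂'
  cases h
  cases h'
  exact refl _

end Category

section Bicategory

variable {C : Type u} [Bicategory.{w, v} C] {D : Type u'} [Bicategory.{w', v'} D] {X Y Z W : C}

theorem whiskerRight {f g f' g' : X ⟶ Y} {x : f ⟶ g} {y : f' ⟶ g'} (h : Sim x y) (k : Y ⟶ Z) :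
    Sim (x ▷ k) (y ▷ k) := by
  obtain ⟨rfl, rfl, h⟩ := h
  cases h
  exact refl _

theorem whiskerLeft (k : X ⟶ Y) {f g f' g' : Y ⟶ Z} {x : f ⟶ g} {y : f' ⟶ g'} (h : Sim x y) :
    Sim (k ◁ x) (k ◁ y) := by
  obtain ⟨rfl, rfl, h⟩ := h
  cases h
  exact refl _

theorem id_whiskerRight {f g : X ⟶ Y} (h : f = g) (k : Y ⟶ Z) : Sim (𝟙 f ▷ k) (𝟙 (g ≫ k)) := by
  subst h
  exact of_eq (Bicategory.id_whiskerRight _ _)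

theorem map₂ (F : C ⥤ᵖ D) {f g f' g' : X ⟶ Y} {x : f ⟶ g} {y : f' ⟶ g'} (h : Sim x y) :
    Sim (F.map₂ x) (F.map₂ y) := by
  obtain ⟨rfl, rfl, h⟩ := h
  cases h
  exact refl _

theorem map₂_id (F : C ⥤ᵖ D) {f g h : X ⟶ Y} {x : f ⟶ g} (e : Sim x (𝟙 h)) :
    Sim (F.map₂ x) (𝟙 (F.map h)) :=
  (map₂ F e).trans (of_eq (F.map₂_id h))

theorem comp_map₂_comp (F : C ⥤ᵖ D) {a : F.obj X ⟶ F.obj Y} {b c d : X ⟶ Y} (x : a ⟶ F.map b)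
    (y : b ⟶ c) (z : c ⟶ d) : Sim (x ≫ F.map₂ (y ≫ z)) ((x ≫ F.map₂ y) ≫ F.map₂ z) :=
  of_eq (by simp)

theorem mapComp_inv (F : C ⥤ᵖ D) {f f' : X ⟶ Y} {g g' : Y ⟶ Z} (h : f = f') (h' : g = g') :
    Sim (F.mapComp f g).inv (F.mapComp f' g').inv := by
  subst h h'
  exact refl _

theorem fam {m : ℕ} {F : C ⥤ᵖ D} (φ : Fam m F) {s t : Str C m X Y} (h : s = t) :
    Sim (φ X Y s) (φ X Y t) := by
  subst h
  exact refl _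

/-- In a strict bicategory the associators are `eqToHom`s, which `Sim` ignores; iterated whiskering
thus needs no bracketing. The same applies to the next two lemmas. -/
theorem whiskerRight_whiskerRight [Bicategory.Strict C] {f g : X ⟶ Y} (x : f ⟶ g) (k : Y ⟶ Z)
    (l : Z ⟶ W) : Sim (x ▷ k ▷ l) (x ▷ (k ≫ l)) := by
  refine ⟨Strict.assoc _ _ _, Strict.assoc _ _ _, ?_⟩
  rw [whiskerRight_comp, Strict.associator_eqToIso, Strict.associator_eqToIso]
  exact (eqToHom_comp_eqToHom (Strict.assoc f k l).symm _ (Strict.assoc g k l)).symm.2.2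

theorem whiskerLeft_whiskerLeft [Bicategory.Strict C] {f g : Z ⟶ W} (k : X ⟶ Y) (l : Y ⟶ Z)
    (x : f ⟶ g) : Sim (k ◁ (l ◁ x)) ((k ≫ l) ◁ x) := by
  refine ⟨(Strict.assoc _ _ _).symm, (Strict.assoc _ _ _).symm, ?_⟩
  rw [comp_whiskerLeft, Strict.associator_eqToIso, Strict.associator_eqToIso]
  exact (eqToHom_comp_eqToHom (Strict.assoc k l f) _ (Strict.assoc k l g).symm).symm.2.2

theorem whiskerLeft_whiskerRight [Bicategory.Strict C] {f g : Y ⟶ Z} (k : X ⟶ Y) (x : f ⟶ g)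
    (l : Z ⟶ W) : Sim ((k ◁ x) ▷ l) (k ◁ (x ▷ l)) := by
  refine ⟨Strict.assoc _ _ _, Strict.assoc _ _ _, ?_⟩
  rw [whisker_assoc, Strict.associator_eqToIso, Strict.associator_eqToIso]
  exact (eqToHom_comp_eqToHom (Strict.assoc k f l) _ (Strict.assoc k g l).symm).2.2

end Bicategory

end Sim

/-! ### Canonical cells of composite and product pseudofunctors. -/

section Hat

variable {A : Type u} [Bicategory.{w, v} A] {B : Type u} [Bicategory.{w, v} B]
  {C : Type u} [Bicategory.{w, v} C] {D : Type u} [Bicategory.{w, v} D]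

/-- Meant for the identity and the rebracketing pseudofunctors, whose composition cells are
identities. -/
theorem hat_sim_id (F : A ⥤ᵖ C) (hF : ∀ {X Y Z : A} (f : X ⟶ Y) (g : Y ⟶ Z),
    Sim (F.mapComp f g).inv (𝟙 (F.map (f ≫ g)))) : ∀ {m : ℕ} {X Y : A} (s : Str A m X Y),
      Sim (s.hat F) (𝟙 (F.map s.comp))
  | _, _, _, .single _ => Sim.refl _
  | _, _, _, .cons f s =>
    (Sim.comp (((hat_sim_id F hF s).whiskerRight (F.map f)).trans
      (Sim.id_whiskerRight rfl _)) (Sim.refl (F.mapComp s.comp f).inv)).trans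
      ((Sim.of_eq (Category.id_comp (F.mapComp s.comp f).inv)).trans (hF s.comp f))

/-- Naturality of `mapComp` in its first argument. It is the inductive step for prolonging a string
at its head: a cell of the form "ψ, then G applied to φ" keeps that form. -/
theorem whiskerRight_mapComp_inv (G : B ⥤ᵖ C) {X Y Z : B} {a : G.obj X ⟶ G.obj Y} {b c : X ⟶ Y}
    {f : Y ⟶ Z} {d : X ⟶ Z} (x : a ⟶ G.map b) (y : b ⟶ c) (z : c ≫ f ⟶ d) :
    (x ≫ G.map₂ y) ▷ G.map f ≫ (G.mapComp c f).inv ≫ G.map₂ z =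
      (x ▷ G.map f ≫ (G.mapComp b f).inv) ≫ G.map₂ (y ▷ f ≫ z) := by
  simp

theorem hat_comp (F : A ⥤ᵖ B) (G : B ⥤ᵖ C) : ∀ {m : ℕ} {X Y : A} (s : Str A m X Y),
    Sim (s.hat (F.comp G)) ((s.map F).hat G ≫ G.map₂ (s.hat F))
  | _, _, _, .single f =>
    Sim.of_eq (by simp : 𝟙 (G.map (F.map f)) = 𝟙 (G.map (F.map f)) ≫ G.map₂ (𝟙 (F.map f)))
  | _, _, _, .cons f s =>
    (Sim.comp ((hat_comp F G s).whiskerRight (G.map (F.map f))) (Sim.refl ((G.mapComp (F.map s.comp)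
      (F.map f)).inv ≫ G.map₂ (F.mapComp s.comp f).inv))).trans
      (Sim.of_eq (whiskerRight_mapComp_inv G ((s.map F).hat G) (s.hat F) (F.mapComp s.comp f).inv))

theorem hat_prod_fst (F : A ⥤ᵖ C) (G : B ⥤ᵖ D) : ∀ {m : ℕ} {X Y : A × B} (s : Str (A × B) m X Y),
    Sim (s.hat (prodPF F G)).1 (s.fst.hat F)
  | _, _, _, .single _ => Sim.refl _
  | _, _, _, .cons f s =>
    Sim.comp ((hat_prod_fst F G s).whiskerRight (F.map f.1)) (Sim.mapComp_inv F s.comp_fst.symm rfl)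

theorem hat_prod_snd (F : A ⥤ᵖ C) (G : B ⥤ᵖ D) : ∀ {m : ℕ} {X Y : A × B} (s : Str (A × B) m X Y),
    Sim (s.hat (prodPF F G)).2 (s.snd.hat G)
  | _, _, _, .single _ => Sim.refl _
  | _, _, _, .cons f s =>
    Sim.comp ((hat_prod_snd F G s).whiskerRight (G.map f.2)) (Sim.mapComp_inv G s.comp_snd.symm rfl)

theorem Str.fst_map_prod (F : A ⥤ᵖ C) (G : B ⥤ᵖ D) : ∀ {m : ℕ} {X Y : A × B}
    (s : Str (A × B) m X Y), (s.map (prodPF F G)).fst = s.fst.map F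
  | _, _, _, .single _ => rfl
  | _, _, _, .cons f s => congrArg (Str.cons (F.map f.1)) (fst_map_prod F G s)

theorem Str.snd_map_prod (F : A ⥤ᵖ C) (G : B ⥤ᵖ D) : ∀ {m : ℕ} {X Y : A × B}
    (s : Str (A × B) m X Y), (s.map (prodPF F G)).snd = s.snd.map G
  | _, _, _, .single _ => rfl
  | _, _, _, .cons f s => congrArg (Str.cons (G.map f.2)) (snd_map_prod F G s)

theorem Str.fst_fst_map_assoc : ∀ {m : ℕ} {X Y : A × (B × C)} (s : Str (A × (B × C)) m X Y),
    (s.map (assocPF A B C)).fst.fst = s.fst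
  | _, _, _, .single _ => rfl
  | _, _, _, .cons f s => congrArg (Str.cons f.1) (fst_fst_map_assoc s)

theorem Str.snd_fst_map_assoc : ∀ {m : ℕ} {X Y : A × (B × C)} (s : Str (A × (B × C)) m X Y),
    (s.map (assocPF A B C)).fst.snd = s.snd.fst
  | _, _, _, .single _ => rfl
  | _, _, _, .cons f s => congrArg (Str.cons f.2.1) (snd_fst_map_assoc s)

theorem Str.snd_map_assoc : ∀ {m : ℕ} {X Y : A × (B × C)} (s : Str (A × (B × C)) m X Y),
    (s.map (assocPF A B C)).snd = s.snd.snd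
  | _, _, _, .single _ => rfl
  | _, _, _, .cons f s => congrArg (Str.cons f.2.2) (snd_map_assoc s)

end Hat

/-! ### Natural families of 2-morphisms form a decoration calculus. -/

section FamDecoration

variable {A : Type u} [Bicategory.{w, v} A] {B : Type u} [Bicategory.{w, v} B]
  {C : Type u} [Bicategory.{w, v} C] {D : Type u} [Bicategory.{w, v} D]
  {E : Type u} [Bicategory.{w, v} E] {E' : Type u} [Bicategory.{w, v} E']

/-- The horizontal composite of two families:
`G F f_0 ∘ ⋯ ∘ G F f_m ⟶ G (F f_0 ∘ ⋯ ∘ F f_m) ⟶ G (F (f_0 ∘ ⋯ ∘ f_m))`. -/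
def starFam {m : ℕ} {F : A ⥤ᵖ B} {G : B ⥤ᵖ C} (φ : Fam m F) (ψ : Fam m G) : Fam m (F.comp G) :=
  fun _ _ s => eqToHom (congrArg Str.comp (s.map_map F G)) ≫ ψ _ _ (s.map F) ≫ G.map₂ (φ _ _ s)

theorem starFam_sim {m : ℕ} {F : A ⥤ᵖ B} {G : B ⥤ᵖ C} (φ : Fam m F) (ψ : Fam m G) {X Y : A}
    (s : Str A m X Y) : Sim (starFam φ ψ X Y s) (ψ _ _ (s.map F) ≫ G.map₂ (φ _ _ s)) :=
  Sim.eqToHom_comp _ _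

theorem prodFam_fst_sim {m : ℕ} {F : A ⥤ᵖ C} {G : B ⥤ᵖ D} (φ : Fam m F) (ψ : Fam m G) {X Y : A × B}
    (s : Str (A × B) m X Y) : Sim (prodFam φ ψ X Y s).1 (φ _ _ s.fst) :=
  Sim.eqToHom_comp_eqToHom (s.map_prod_fst F G) (φ _ _ s.fst) (congrArg F.map s.comp_fst)

theorem prodFam_snd_sim {m : ℕ} {F : A ⥤ᵖ C} {G : B ⥤ᵖ D} (φ : Fam m F) (ψ : Fam m G) {X Y : A × B}
    (s : Str (A × B) m X Y) : Sim (prodFam φ ψ X Y s).2 (ψ _ _ s.snd) :=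
  Sim.eqToHom_comp_eqToHom (s.map_prod_snd F G) (ψ _ _ s.snd) (congrArg G.map s.comp_snd)

theorem isNatural_starFam {m : ℕ} {F : A ⥤ᵖ B} {G : B ⥤ᵖ C} {φ : Fam m F} {ψ : Fam m G}
    (hφ : IsNatural φ) (hψ : IsNatural ψ) : IsNatural (starFam φ ψ) := by
  intro X Y s t σ
  have h := congrArg (fun x => G.map₂ x) (hφ _ _ _ _ σ)
  simp only [PrelaxFunctor.map₂_comp] at h
  exact paste (σ.map_map F G).symm (paste (hψ _ _ _ _ (σ.map F)) h)

/-- The canonical 2-isomorphisms, as a family. -/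
def hatFam (m : ℕ) (F : A ⥤ᵖ B) : Fam m F := fun _ _ s => s.hat F

theorem isNatural_hatFam (m : ℕ) (F : A ⥤ᵖ B) : IsNatural (hatFam m F) :=
  fun _ _ _ _ σ => Str.hat_naturality F σ

/-- A pseudofunctor with a natural family. -/
abbrev FamHom (m : ℕ) (A C : Type u) [Bicategory.{w, v} A] [Bicategory.{w, v} C] :
    Type (max u v w) :=
  Σ F : A ⥤ᵖ C, {φ : Fam m F // IsNatural φ}

namespace FamHom

variable {m : ℕ}

/-- Heterogeneous equality of the values suffices, since the pseudofunctors are identified first.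
The values can therefore be compared by `Sim`, without transporting a family. -/
theorem ext {x y : FamHom m A C} (h : x.1 = y.1) (h' : ∀ X Y s, HEq (x.2.1 X Y s) (y.2.1 X Y s)) :
    x = y := by
  obtain ⟨F, φ, hφ⟩ := x
  obtain ⟨G, ψ, hψ⟩ := y
  dsimp only at h
  subst h
  have : φ = ψ := by
    funext X Y s
    exact eq_of_heq (h' X Y s)
  subst this
  rfl

/-- Composition of pseudofunctors with families. -/
def star (x : FamHom m A B) (y : FamHom m B C) : FamHom m A C :=
  ⟨x.1.comp y.1, starFam x.2.1 y.2.1, isNatural_starFam x.2.2 y.2.2⟩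

/-- Products of pseudofunctors with families. -/
def prod (x : FamHom m A B) (y : FamHom m C D) : FamHom m (A × C) (B × D) :=
  ⟨prodPF x.1 y.1, prodFam x.2.1 y.2.1, isNatural_prodFam x.2.2 y.2.2⟩

/-- A pseudofunctor with its canonical 2-isomorphisms. -/
def can (m : ℕ) (F : A ⥤ᵖ B) : FamHom m A B :=
  ⟨F, hatFam m F, isNatural_hatFam m F⟩

/-- Both sides are χ, then H ψ, then H G φ on the same string; only functoriality of `H` on
2-morphisms is involved. -/
theorem star_assoc (x : FamHom m A B) (y : FamHom m B C) (z : FamHom m C D) :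
    (x.star y).star z = x.star (y.star z) := by
  obtain ⟨F, φ, hφ⟩ := x
  obtain ⟨G, ψ, hψ⟩ := y
  obtain ⟨H, χ, hχ⟩ := z
  refine FamHom.ext (comp_assocPF F G H) fun X Y s => ?_
  have h1 := (starFam_sim (starFam φ ψ) χ s).trans
    (Sim.comp (Sim.fam χ (s.map_map F G)) (Sim.map₂ H (starFam_sim φ ψ s)))
  have h2 := (starFam_sim φ (starFam ψ χ) s).trans
    (Sim.comp (starFam_sim ψ χ _) (Sim.refl (H.map₂ (G.map₂ (φ _ _ s)))))
  exact (h1.trans ((Sim.comp_map₂_comp H _ _ _).trans h2.symm)).2.2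

theorem id_star (x : FamHom m A C) : (can m (Pseudofunctor.id A)).star x = x := by
  obtain ⟨F, φ, hφ⟩ := x
  refine FamHom.ext (id_compPF F) fun X Y s => ?_
  have h1 := starFam_sim (hatFam m (Pseudofunctor.id A)) φ s
  exact (h1.trans (Sim.comp_id (Sim.fam φ s.map_id.symm) (Sim.map₂_id F
    (hat_sim_id (Pseudofunctor.id A) (fun _ _ => Sim.refl _) s))).symm).2.2

theorem star_id (x : FamHom m A C) : x.star (can m (Pseudofunctor.id C)) = x := by
  obtain ⟨F, φ, hφ⟩ := x
  refine FamHom.ext (comp_idPF F) fun X Y s => ?_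
  have h1 := starFam_sim φ (hatFam m (Pseudofunctor.id C)) s
  exact (h1.trans (Sim.id_comp (Sim.refl (φ X Y s))
    (hat_sim_id (Pseudofunctor.id C) (fun _ _ => Sim.refl _) (s.map F))).symm).2.2

theorem can_comp (F : A ⥤ᵖ B) (G : B ⥤ᵖ C) : can m (F.comp G) = (can m F).star (can m G) :=
  FamHom.ext rfl fun _ _ s => ((hat_comp F G s).trans
    (starFam_sim (hatFam m F) (hatFam m G) s).symm).2.2

theorem can_prod (F : A ⥤ᵖ B) (G : C ⥤ᵖ D) : can m (prodPF F G) = (can m F).prod (can m G) :=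
  FamHom.ext rfl fun _ _ s => (Sim.prod
    ((hat_prod_fst F G s).trans (prodFam_fst_sim (hatFam m F) (hatFam m G) s).symm)
    ((hat_prod_snd F G s).trans (prodFam_snd_sim (hatFam m F) (hatFam m G) s).symm)).2.2

theorem prod_star {A' B' C' : Type u} [Bicategory.{w, v} A'] [Bicategory.{w, v} B']
    [Bicategory.{w, v} C'] (x : FamHom m A B) (x' : FamHom m A' B') (y : FamHom m B C)
    (y' : FamHom m B' C') : (x.prod x').star (y.prod y') = (x.star y).prod (x'.star y') := by
  obtain ⟨F, φ, hφ⟩ := x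
  obtain ⟨F', φ', hφ'⟩ := x'
  obtain ⟨G, ψ, hψ⟩ := y
  obtain ⟨G', ψ', hψ'⟩ := y'
  refine FamHom.ext (prodPF_comp F F' G G') fun X Y s => (Sim.prod ?_ ?_).2.2
  · have h1 := (starFam_sim (prodFam φ φ') (prodFam ψ ψ') s).fst
    have h2 := Sim.comp ((prodFam_fst_sim ψ ψ' (s.map (prodPF F F'))).trans
      (Sim.fam ψ (s.fst_map_prod F F'))) (Sim.map₂ G (prodFam_fst_sim φ φ' s))
    have h3 := starFam_sim φ ψ s.fst
    have h4 := prodFam_fst_sim (starFam φ ψ) (starFam φ' ψ') s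
    exact h1.trans (h2.trans (h3.symm.trans h4.symm))
  · have h1 := (starFam_sim (prodFam φ φ') (prodFam ψ ψ') s).snd
    have h2 := Sim.comp ((prodFam_snd_sim ψ ψ' (s.map (prodPF F F'))).trans
      (Sim.fam ψ' (s.snd_map_prod F F'))) (Sim.map₂ G' (prodFam_snd_sim φ φ' s))
    have h3 := starFam_sim φ' ψ' s.snd
    have h4 := prodFam_snd_sim (starFam φ ψ) (starFam φ' ψ') s
    exact h1.trans (h2.trans (h3.symm.trans h4.symm))

theorem hat_assoc_sim {X Y : A × (B × C)} (s : Str (A × (B × C)) m X Y) :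
    Sim (s.hat (assocPF A B C)) (𝟙 ((assocPF A B C).map s.comp)) :=
  hat_sim_id (assocPF A B C) (fun _ _ => Sim.refl _) s

/-- The canonical cells of rebracketing are identities, so either side consists of φ, ψ and χ
evaluated on the three component strings. -/
theorem assoc_nat {A' B' C' : Type u} [Bicategory.{w, v} A'] [Bicategory.{w, v} B']
    [Bicategory.{w, v} C'] (x : FamHom m A A') (x' : FamHom m B B') (x'' : FamHom m C C') :
    (x.prod (x'.prod x'')).star (can m (assocPF A' B' C')) =
      (can m (assocPF A B C)).star ((x.prod x').prod x'') := by
  obtain ⟨F, φ, hφ⟩ := x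
  obtain ⟨G, ψ, hψ⟩ := x'
  obtain ⟨H, χ, hχ⟩ := x''
  refine FamHom.ext (assocPF_naturality F G H) fun X Y s => ?_
  have h1 := starFam_sim (prodFam φ (prodFam ψ χ)) (hatFam m (assocPF A' B' C')) s
  have h2 := starFam_sim (hatFam m (assocPF A B C)) (prodFam (prodFam φ ψ) χ) s
  have h3 := hat_assoc_sim (s.map (prodPF F (prodPF G H)))
  have h4 := hat_assoc_sim s
  have e : Sim ((assocPF A' B' C').map₂ (prodFam φ (prodFam ψ χ) X Y s))
      (prodFam (prodFam φ ψ) χ _ _ (s.map (assocPF A B C))) := by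
    refine Sim.prod (Sim.prod ?_ ?_) ?_
    · exact (prodFam_fst_sim φ (prodFam ψ χ) s).trans ((Sim.fam φ s.fst_fst_map_assoc.symm).trans
        ((prodFam_fst_sim φ ψ _).symm.trans
          (prodFam_fst_sim (prodFam φ ψ) χ (s.map (assocPF A B C))).fst.symm))
    · exact (prodFam_snd_sim φ (prodFam ψ χ) s).fst.trans ((prodFam_fst_sim ψ χ s.snd).trans
        ((Sim.fam ψ s.snd_fst_map_assoc.symm).trans ((prodFam_snd_sim φ ψ _).symm.trans
          (prodFam_fst_sim (prodFam φ ψ) χ (s.map (assocPF A B C))).snd.symm)))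
    · exact (prodFam_snd_sim φ (prodFam ψ χ) s).snd.trans ((prodFam_snd_sim ψ χ s.snd).trans
        ((Sim.fam χ s.snd_map_assoc.symm).trans
          (prodFam_snd_sim (prodFam φ ψ) χ (s.map (assocPF A B C))).symm))
  exact (h1.trans ((Sim.id_comp e.symm h3).symm.trans ((Sim.comp_id (Sim.refl _)
    (Sim.map₂_id (prodPF (prodPF F G) H) h4)).trans h2.symm))).2.2

end FamHom

/-- The calculus of natural families on strings of `m + 1` composable 1-morphisms. -/
def famDecoration (m : ℕ) : Decoration.{w, v, u} where
  Hom A C _ _ := FamHom m A C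
  can := FamHom.can m
  star := FamHom.star
  prod := FamHom.prod
  star_assoc := FamHom.star_assoc
  id_star := FamHom.id_star
  star_id := FamHom.star_id
  can_comp := FamHom.can_comp
  can_prod := FamHom.can_prod
  prod_star := FamHom.prod_star
  assoc_nat := FamHom.assoc_nat

end FamDecoration

/-! ### The calculus of endomorphisms of identities, and its maps to natural families. -/

section EndDecoration

variable {A : Type u} [Bicategory.{w, v} A] {B : Type u} [Bicategory.{w, v} B]
  {C : Type u} [Bicategory.{w, v} C] {D : Type u} [Bicategory.{w, v} D]

/-- The horizontal composite of two families of endomorphisms of identities. -/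
def starEnd {F : A ⥤ᵖ B} {G : B ⥤ᵖ C} (n : EndFam F) (n' : EndFam G) : EndFam (F.comp G) :=
  fun X => n' (F.obj X) ≫ (G.mapId (F.obj X)).inv ≫ G.map₂ (n X) ≫ (G.mapId (F.obj X)).hom

/-- The product of two families of endomorphisms of identities. -/
def prodEnd {F : A ⥤ᵖ B} {G : C ⥤ᵖ D} (n : EndFam F) (n' : EndFam G) : EndFam (prodPF F G) :=
  fun X => (n X.1, n' X.2)

/-- A pseudofunctor with a family of endomorphisms of identities. -/
abbrev EndHom (A C : Type u) [Bicategory.{w, v} A] [Bicategory.{w, v} C] : Type (max u v w) :=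
  Σ F : A ⥤ᵖ C, EndFam F

namespace EndHom

theorem ext {x y : EndHom A C} (h : x.1 = y.1) (h' : ∀ X, HEq (x.2 X) (y.2 X)) : x = y := by
  obtain ⟨F, n⟩ := x
  obtain ⟨G, n'⟩ := y
  dsimp only at h
  subst h
  have : n = n' := by
    funext X
    exact eq_of_heq (h' X)
  subst this
  rfl

/-- Composition of pseudofunctors with families of endomorphisms of identities. -/
def star (x : EndHom A B) (y : EndHom B C) : EndHom A C :=
  ⟨x.1.comp y.1, starEnd x.2 y.2⟩

/-- Products of pseudofunctors with families of endomorphisms of identities. -/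
def prod (x : EndHom A B) (y : EndHom C D) : EndHom (A × C) (B × D) :=
  ⟨prodPF x.1 y.1, prodEnd x.2 y.2⟩

/-- A pseudofunctor with the family of identities. -/
def can (F : A ⥤ᵖ B) : EndHom A B :=
  ⟨F, fun X => 𝟙 (𝟙 (F.obj X))⟩

theorem conj_id (G : B ⥤ᵖ C) (X : B) :
    (G.mapId X).inv ≫ G.map₂ (𝟙 (𝟙 X)) ≫ (G.mapId X).hom = 𝟙 (𝟙 (G.obj X)) := by
  simp

/-- Associativity of `starEnd`: applying `H` and conjugating by its unit cell is multiplicative, and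
the unit cell of `G.comp H` is assembled from those of `G` and `H`. -/
theorem conj_comp (G : B ⥤ᵖ C) (H : C ⥤ᵖ D) {X : B} (n : 𝟙 X ⟶ 𝟙 X)
    (n' : 𝟙 (G.obj X) ⟶ 𝟙 (G.obj X)) (n'' : 𝟙 (H.obj (G.obj X)) ⟶ 𝟙 (H.obj (G.obj X))) :
    n'' ≫ (H.mapId _).inv ≫ H.map₂ (n' ≫ (G.mapId X).inv ≫ G.map₂ n ≫ (G.mapId X).hom) ≫
        (H.mapId _).hom =
      (n'' ≫ (H.mapId _).inv ≫ H.map₂ n' ≫ (H.mapId _).hom) ≫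
        ((H.mapId _).inv ≫ H.map₂ (G.mapId X).inv) ≫ H.map₂ (G.map₂ n) ≫
          H.map₂ (G.mapId X).hom ≫ (H.mapId _).hom := by
  simp

theorem star_assoc (x : EndHom A B) (y : EndHom B C) (z : EndHom C D) :
    (x.star y).star z = x.star (y.star z) :=
  EndHom.ext (comp_assocPF x.1 y.1 z.1) fun _ => heq_of_eq (conj_comp y.1 z.1 _ _ _)

theorem id_star (x : EndHom A C) : (can (Pseudofunctor.id A)).star x = x :=
  EndHom.ext (id_compPF x.1) fun X =>
    heq_of_eq ((congrArg (x.2 X ≫ ·) (conj_id x.1 X)).trans (Category.comp_id _))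

theorem id_comp_id {X : Type*} [Category X] {x : X} (f : x ⟶ x) : 𝟙 x ≫ 𝟙 x ≫ f ≫ 𝟙 x = f := by
  simp

theorem star_id (x : EndHom A C) : x.star (can (Pseudofunctor.id C)) = x :=
  EndHom.ext (comp_idPF x.1) fun X => heq_of_eq (id_comp_id (x.2 X))

theorem can_comp (F : A ⥤ᵖ B) (G : B ⥤ᵖ C) : can (F.comp G) = (can F).star (can G) :=
  EndHom.ext rfl fun X =>
    heq_of_eq ((Category.id_comp _).trans (conj_id G (F.obj X))).symm

theorem assoc_nat {A' B' C' : Type u} [Bicategory.{w, v} A'] [Bicategory.{w, v} B']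
    [Bicategory.{w, v} C'] (x : EndHom A A') (x' : EndHom B B') (x'' : EndHom C C') :
    (x.prod (x'.prod x'')).star (can (assocPF A' B' C')) =
      (can (assocPF A B C)).star ((x.prod x').prod x'') := by
  refine EndHom.ext (assocPF_naturality x.1 x'.1 x''.1) fun X => ?_
  have h2 : ∀ {P Q : Type u} [Bicategory.{w, v} P] [Bicategory.{w, v} Q] (y : EndHom P Q) (Z : P),
      y.2 Z ≫ (y.1.mapId Z).inv ≫ y.1.map₂ (𝟙 (𝟙 Z)) ≫ (y.1.mapId Z).hom = y.2 Z := fun y Z =>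
    (congrArg (y.2 Z ≫ ·) (conj_id y.1 Z)).trans (Category.comp_id _)
  exact heq_of_eq (Prod.ext (Prod.ext ((id_comp_id (x.2 X.1)).trans (h2 x X.1).symm)
    ((id_comp_id (x'.2 X.2.1)).trans (h2 x' X.2.1).symm))
      ((id_comp_id (x''.2 X.2.2)).trans (h2 x'' X.2.2).symm))

end EndHom

/-- The calculus of families of endomorphisms of identities. -/
def endDecoration : Decoration.{w, v, u} where
  Hom A C _ _ := EndHom A C
  can := EndHom.can
  star := EndHom.star
  prod := EndHom.prod
  star_assoc := EndHom.star_assoc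
  id_star := EndHom.id_star
  star_id := EndHom.star_id
  can_comp := EndHom.can_comp
  can_prod _ _ := rfl
  prod_star x x' y y' := EndHom.ext (prodPF_comp x.1 x'.1 y.1 y'.1) fun _ => HEq.rfl
  assoc_nat := EndHom.assoc_nat

/-- `f ↦ 1_{F f} ∘ n_X`, as a family. -/
def leftUnitFam {F : A ⥤ᵖ B} (n : EndFam F) : Fam 0 F
  | X, _, .single f => (λ_ (F.map f)).inv ≫ n X ▷ F.map f ≫ (λ_ (F.map f)).hom

/-- `f ↦ n_Y ∘ 1_{F f}`, as a family. -/
def rightUnitFam {F : A ⥤ᵖ B} (n : EndFam F) : Fam 0 F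
  | _, Y, .single f => (ρ_ (F.map f)).inv ≫ F.map f ◁ n Y ≫ (ρ_ (F.map f)).hom

theorem isNatural_leftUnitFam {F : A ⥤ᵖ B} (n : EndFam F) : IsNatural (leftUnitFam n) := by
  intro X Y s t σ
  cases σ with
  | @single _ _ f g τ =>
    change ((λ_ (F.map f)).inv ≫ n X ▷ F.map f ≫ (λ_ (F.map f)).hom) ≫ F.map₂ τ =
      F.map₂ τ ≫ (λ_ (F.map g)).inv ≫ n X ▷ F.map g ≫ (λ_ (F.map g)).hom
    rw [Category.assoc, Category.assoc, ← leftUnitor_naturality, ← whisker_exchange_assoc,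
      leftUnitor_inv_naturality_assoc]

theorem isNatural_rightUnitFam {F : A ⥤ᵖ B} (n : EndFam F) : IsNatural (rightUnitFam n) := by
  intro X Y s t σ
  cases σ with
  | @single _ _ f g τ =>
    change ((ρ_ (F.map f)).inv ≫ F.map f ◁ n Y ≫ (ρ_ (F.map f)).hom) ≫ F.map₂ τ =
      F.map₂ τ ≫ (ρ_ (F.map g)).inv ≫ F.map g ◁ n Y ≫ (ρ_ (F.map g)).hom
    rw [Category.assoc, Category.assoc, ← rightUnitor_naturality, whisker_exchange_assoc,
      rightUnitor_inv_naturality_assoc]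

/-- The reason that n ↦ 1 ∘ n_X respects `star`. Its content is the left unit axiom of the
pseudofunctor `G`, isolated in inverse form as `h`. -/
theorem leftUnit_conj (G : B ⥤ᵖ C) {X Y : B} (f : X ⟶ Y) (n : 𝟙 X ⟶ 𝟙 X)
    (n' : 𝟙 (G.obj X) ⟶ 𝟙 (G.obj X)) :
    (λ_ (G.map f)).inv ≫ (n' ≫ (G.mapId X).inv ≫ G.map₂ n ≫ (G.mapId X).hom) ▷ G.map f ≫
        (λ_ (G.map f)).hom =
      ((λ_ (G.map f)).inv ≫ n' ▷ G.map f ≫ (λ_ (G.map f)).hom) ≫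
        G.map₂ ((λ_ f).inv ≫ n ▷ f ≫ (λ_ f).hom) := by
  have h : (G.mapId X).inv ▷ G.map f ≫ (G.mapComp (𝟙 X) f).inv =
      (λ_ (G.map f)).hom ≫ G.map₂ (λ_ f).inv := by
    rw [← cancel_mono (G.map₂ (λ_ f).hom), Category.assoc, Category.assoc, ← PrelaxFunctor.map₂_comp,
      Iso.inv_hom_id, Pseudofunctor.map₂_left_unitor, Iso.inv_hom_id_assoc,
      ← comp_whiskerRight_assoc, Iso.inv_hom_id]
    simp
  rw [PrelaxFunctor.map₂_comp, PrelaxFunctor.map₂_comp, Pseudofunctor.map₂_whisker_right,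
    Pseudofunctor.map₂_left_unitor]
  simp only [Category.assoc, Iso.inv_hom_id_assoc, comp_whiskerRight]
  rw [← reassoc_of% h]
  simp

/-- The same with the right unit axiom, for n ↦ n_Y ∘ 1. -/
theorem rightUnit_conj (G : B ⥤ᵖ C) {X Y : B} (f : X ⟶ Y) (n : 𝟙 Y ⟶ 𝟙 Y)
    (n' : 𝟙 (G.obj Y) ⟶ 𝟙 (G.obj Y)) :
    (ρ_ (G.map f)).inv ≫ G.map f ◁ (n' ≫ (G.mapId Y).inv ≫ G.map₂ n ≫ (G.mapId Y).hom) ≫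
        (ρ_ (G.map f)).hom =
      ((ρ_ (G.map f)).inv ≫ G.map f ◁ n' ≫ (ρ_ (G.map f)).hom) ≫
        G.map₂ ((ρ_ f).inv ≫ f ◁ n ≫ (ρ_ f).hom) := by
  have h : G.map f ◁ (G.mapId Y).inv ≫ (G.mapComp f (𝟙 Y)).inv =
      (ρ_ (G.map f)).hom ≫ G.map₂ (ρ_ f).inv := by
    rw [← cancel_mono (G.map₂ (ρ_ f).hom), Category.assoc, Category.assoc, ← PrelaxFunctor.map₂_comp,
      Iso.inv_hom_id, Pseudofunctor.map₂_right_unitor, Iso.inv_hom_id_assoc,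
      ← whiskerLeft_comp_assoc, Iso.inv_hom_id]
    simp
  rw [PrelaxFunctor.map₂_comp, PrelaxFunctor.map₂_comp, Pseudofunctor.map₂_whisker_left,
    Pseudofunctor.map₂_right_unitor]
  simp only [Category.assoc, Iso.inv_hom_id_assoc, whiskerLeft_comp]
  rw [← reassoc_of% h]
  simp

/-- `n ↦ (f ↦ 1_{F f} ∘ n_X)` -/
def leftUnitMap : DecorationMap endDecoration.{w, v, u} (famDecoration 0) where
  app x := ⟨x.1, leftUnitFam x.2, isNatural_leftUnitFam x.2⟩
  app_can F := FamHom.ext rfl fun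
    | _, _, .single f => heq_of_eq (by simp :
        (λ_ (F.map f)).inv ≫ 𝟙 (𝟙 _) ▷ F.map f ≫ (λ_ (F.map f)).hom = 𝟙 (F.map f))
  app_star x y := FamHom.ext rfl fun
    | _, _, .single f => ((Sim.of_eq (leftUnit_conj y.1 (x.1.map f) _ _)).trans
        (starFam_sim (leftUnitFam x.2) (leftUnitFam y.2) (.single f)).symm).2.2
  app_prod x y := FamHom.ext rfl fun
    | _, _, .single f => (Sim.prod
        (prodFam_fst_sim (leftUnitFam x.2) (leftUnitFam y.2) (.single f)).symm
        (prodFam_snd_sim (leftUnitFam x.2) (leftUnitFam y.2) (.single f)).symm).2.2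

/-- `n ↦ (f ↦ n_Y ∘ 1_{F f})` -/
def rightUnitMap : DecorationMap endDecoration.{w, v, u} (famDecoration 0) where
  app x := ⟨x.1, rightUnitFam x.2, isNatural_rightUnitFam x.2⟩
  app_can F := FamHom.ext rfl fun
    | _, _, .single f => heq_of_eq (by simp :
        (ρ_ (F.map f)).inv ≫ F.map f ◁ 𝟙 (𝟙 _) ≫ (ρ_ (F.map f)).hom = 𝟙 (F.map f))
  app_star x y := FamHom.ext rfl fun
    | _, _, .single f => ((Sim.of_eq (rightUnit_conj y.1 (x.1.map f) _ _)).trans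
        (starFam_sim (rightUnitFam x.2) (rightUnitFam y.2) (.single f)).symm).2.2
  app_prod x y := FamHom.ext rfl fun
    | _, _, .single f => (Sim.prod
        (prodFam_fst_sim (rightUnitFam x.2) (rightUnitFam y.2) (.single f)).symm
        (prodFam_snd_sim (rightUnitFam x.2) (rightUnitFam y.2) (.single f)).symm).2.2

/-- `(f_0, …, f_{m+1}) ↦ ⌈1_{F f_0} ∘ φ (f_1, …, f_{m+1})⌉`, on families. -/
def firstFun {m : ℕ} {F : A ⥤ᵖ B} (φ : Fam m F) : Fam (m + 1) F
  | _, _, .cons f s => φ _ _ s ▷ F.map f ≫ (F.mapComp s.comp f).inv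

theorem isNatural_firstFun {m : ℕ} {F : A ⥤ᵖ B} {φ : Fam m F} (hφ : IsNatural φ) :
    IsNatural (firstFun φ) := by
  intro X Y s t σ
  cases σ with
  | @cons _ _ _ _ f g s t τ σ =>
    change (φ _ _ s ▷ F.map f ≫ (F.mapComp s.comp f).inv) ≫ F.map₂ (σ.comp ▷ f ≫ t.comp ◁ τ) =
      ((σ.map F).comp ▷ F.map f ≫ (t.map F).comp ◁ F.map₂ τ) ≫ φ _ _ t ▷ F.map g ≫
        (F.mapComp t.comp g).inv
    simp only [PrelaxFunctor.map₂_comp, Pseudofunctor.map₂_whisker_left,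
      Pseudofunctor.map₂_whisker_right, Category.assoc, Iso.inv_hom_id_assoc]
    rw [← comp_whiskerRight_assoc, hφ, comp_whiskerRight_assoc, whisker_exchange_assoc]

/-- `φ ↦ ((f_0, …, f_{m+1}) ↦ ⌈1_{F f_0} ∘ φ (f_1, …, f_{m+1})⌉)` -/
def firstMap (m : ℕ) : DecorationMap (famDecoration.{w, v, u} m) (famDecoration (m + 1)) where
  app x := ⟨x.1, firstFun x.2.1, isNatural_firstFun x.2.2⟩
  app_can _ := FamHom.ext rfl fun
    | _, _, .cons _ _ => HEq.rfl
  app_star x y := FamHom.ext rfl fun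
    | _, _, .cons f s =>
      ((Sim.comp ((starFam_sim x.2.1 y.2.1 s).whiskerRight (y.1.map (x.1.map f)))
        (Sim.refl ((x.1.comp y.1).mapComp s.comp f).inv)).trans
          ((Sim.of_eq (whiskerRight_mapComp_inv y.1 (y.2.1 _ _ (s.map x.1)) (x.2.1 _ _ s)
            (x.1.mapComp s.comp f).inv)).trans
              (starFam_sim (firstFun x.2.1) (firstFun y.2.1) (.cons f s)).symm)).2.2
  app_prod x y := FamHom.ext rfl fun
    | _, _, .cons f s => (Sim.prod
        ((Sim.comp ((prodFam_fst_sim x.2.1 y.2.1 s).whiskerRight (x.1.map f.1))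
          (Sim.mapComp_inv x.1 s.comp_fst.symm rfl)).trans
            (prodFam_fst_sim (firstFun x.2.1) (firstFun y.2.1) (.cons f s)).symm)
        ((Sim.comp ((prodFam_snd_sim x.2.1 y.2.1 s).whiskerRight (y.1.map f.2))
          (Sim.mapComp_inv y.1 s.comp_snd.symm rfl)).trans
            (prodFam_snd_sim (firstFun x.2.1) (firstFun y.2.1) (.cons f s)).symm)).2.2

end EndDecoration

/-! ### The inner horizontal cofaces as maps of decoration calculi. -/

section Inner

theorem Sim.whiskerLeft_congr {C : Type u} [Bicategory.{w, v} C] {X Y Z : C} {k k' : X ⟶ Y}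
    (hk : k = k') {f g f' g' : Y ⟶ Z} {x : f ⟶ g} {y : f' ⟶ g'} (h : Sim x y) :
    Sim (k ◁ x) (k' ◁ y) := by
  subst hk
  exact h.whiskerLeft k

theorem Sim.associator_hom_comp {C : Type u} [Bicategory.{w, v} C] [Bicategory.Strict C]
    {X Y Z W : C} (f : X ⟶ Y) (g : Y ⟶ Z) (h : Z ⟶ W) {k : X ⟶ W} (x : f ≫ g ≫ h ⟶ k) :
    Sim ((α_ f g h).hom ≫ x) x := by
  rw [Strict.associator_eqToIso]
  exact Sim.eqToHom_comp (Strict.assoc f g h) _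

theorem Sim.associator_hom_congr {C : Type u} [Bicategory.{w, v} C] {X Y Z W : C} {f f' : X ⟶ Y}
    (hf : f = f') (g : Y ⟶ Z) (h : Z ⟶ W) : Sim (α_ f g h).hom (α_ f' g h).hom := by
  subst hf
  exact Sim.refl _

variable {A : Type u} [Bicategory.{w, v} A] {B : Type u} [Bicategory.{w, v} B]
  {C : Type u} [Bicategory.{w, v} C] {D : Type u} [Bicategory.{w, v} D]

section

variable [Bicategory.Strict A] [Bicategory.Strict B]

/-- Compatibility of the structural 2-isomorphisms with associativity, in the strict case. -/
theorem mapComp_assoc_sim (F : A ⥤ᵖ B) {X Y Z W : A} {a : F.obj X ⟶ F.obj Y} {b : X ⟶ Y}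
    (x : a ⟶ F.map b) (g : Y ⟶ Z) (f : Z ⟶ W) :
    Sim (a ◁ (F.mapComp g f).inv ≫ x ▷ F.map (g ≫ f) ≫ (F.mapComp b (g ≫ f)).inv)
      ((x ▷ F.map g ≫ (F.mapComp b g).inv) ▷ F.map f ≫ (F.mapComp (b ≫ g) f).inv) := by
  -- The associativity axiom of `F`, after the interchange law has moved `x` first. By strictness
  -- both associators are then `eqToHom`s, which `Sim` drops.
  have h : (α_ _ _ _).hom ≫ a ◁ (F.mapComp g f).inv ≫ x ▷ F.map (g ≫ f) ≫
      (F.mapComp b (g ≫ f)).inv =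
    ((x ▷ F.map g ≫ (F.mapComp b g).inv) ▷ F.map f ≫ (F.mapComp (b ≫ g) f).inv) ≫
      F.map₂ (α_ b g f).hom := by
    rw [whisker_exchange_assoc, Pseudofunctor.map₂_associator]
    simp
  have h2 : F.map₂ (α_ b g f).hom = eqToHom (congrArg F.map (Strict.assoc b g f)) := by
    rw [Strict.associator_eqToIso]
    exact PrelaxFunctor.map₂_eqToHom _ _ _ (Strict.assoc b g f)
  rw [h2] at h
  exact (Sim.associator_hom_comp _ _ _ _).symm.trans ((Sim.of_eq h).trans (Sim.comp_eqToHom _ _))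

/-- The mirror image of `mapComp_assoc_sim`. -/
theorem mapComp_assoc_sim' (F : A ⥤ᵖ B) {X Y Z W : A} {a : F.obj Z ⟶ F.obj W} {b : Z ⟶ W}
    (x : a ⟶ F.map b) (g : X ⟶ Y) (f : Y ⟶ Z) :
    Sim ((F.mapComp g f).inv ▷ a ≫ F.map (g ≫ f) ◁ x ≫ (F.mapComp (g ≫ f) b).inv)
      (F.map g ◁ (F.map f ◁ x ≫ (F.mapComp f b).inv) ≫ (F.mapComp g (f ≫ b)).inv) := by
  have h : ((F.mapComp g f).inv ▷ a ≫ F.map (g ≫ f) ◁ x ≫ (F.mapComp (g ≫ f) b).inv) ≫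
      F.map₂ (α_ g f b).hom = (α_ _ _ _).hom ≫
    (F.map g ◁ (F.map f ◁ x ≫ (F.mapComp f b).inv) ≫ (F.mapComp g (f ≫ b)).inv) := by
    rw [← whisker_exchange_assoc, Pseudofunctor.map₂_associator]
    simp
  have h2 : F.map₂ (α_ g f b).hom = eqToHom (congrArg F.map (Strict.assoc g f b)) := by
    rw [Strict.associator_eqToIso]
    exact PrelaxFunctor.map₂_eqToHom _ _ _ (Strict.assoc g f b)
  rw [h2] at h
  exact (Sim.comp_eqToHom _ _).symm.trans ((Sim.of_eq h).trans (Sim.associator_hom_comp _ _ _ _))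

/-- The middle case of `mapComp_assoc_sim`. -/
theorem mapComp_assoc_mid_sim (F : A ⥤ᵖ B) {X Y Z W : A} {a : F.obj Y ⟶ F.obj Z} {b : Y ⟶ Z}
    (x : a ⟶ F.map b) (g : X ⟶ Y) (f : Z ⟶ W) :
    Sim ((F.map g ◁ x ≫ (F.mapComp g b).inv) ▷ F.map f ≫ (F.mapComp (g ≫ b) f).inv)
      (F.map g ◁ (x ▷ F.map f ≫ (F.mapComp b f).inv) ≫ (F.mapComp g (b ≫ f)).inv) := by
  have h : ((F.map g ◁ x ≫ (F.mapComp g b).inv) ▷ F.map f ≫ (F.mapComp (g ≫ b) f).inv) ≫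
      F.map₂ (α_ g b f).hom = (α_ _ _ _).hom ≫
    (F.map g ◁ (x ▷ F.map f ≫ (F.mapComp b f).inv) ≫ (F.mapComp g (b ≫ f)).inv) := by
    rw [Pseudofunctor.map₂_associator]
    simp
  have h2 : F.map₂ (α_ g b f).hom = eqToHom (congrArg F.map (Strict.assoc g b f)) := by
    rw [Strict.associator_eqToIso]
    exact PrelaxFunctor.map₂_eqToHom _ _ _ (Strict.assoc g b f)
  rw [h2] at h
  exact (Sim.comp_eqToHom _ _).symm.trans ((Sim.of_eq h).trans (Sim.associator_hom_comp _ _ _ _))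

end

namespace Str

theorem fst_contract : ∀ {m : ℕ} {X Y : A × B} (i : Fin (m + 1)) (s : Str (A × B) (m + 1) X Y),
    (s.contract i).fst = s.fst.contract i
  | 0, _, _, _, cons _ (single _) => rfl
  | _ + 1, _, _, ⟨0, _⟩, cons _ (cons _ _) => rfl
  | _ + 1, _, _, ⟨i + 1, h⟩, cons f s =>
    congrArg (cons f.1) (fst_contract ⟨i, Nat.lt_of_succ_lt_succ h⟩ s)

theorem snd_contract : ∀ {m : ℕ} {X Y : A × B} (i : Fin (m + 1)) (s : Str (A × B) (m + 1) X Y),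
    (s.contract i).snd = s.snd.contract i
  | 0, _, _, _, cons _ (single _) => rfl
  | _ + 1, _, _, ⟨0, _⟩, cons _ (cons _ _) => rfl
  | _ + 1, _, _, ⟨i + 1, h⟩, cons f s =>
    congrArg (cons f.2) (snd_contract ⟨i, Nat.lt_of_succ_lt_succ h⟩ s)

theorem hatAt_prod_fst (F : A ⥤ᵖ C) (G : B ⥤ᵖ D) : ∀ {m : ℕ} {X Y : A × B} (i : Fin (m + 1))
    (s : Str (A × B) (m + 1) X Y), Sim (s.hatAt (prodPF F G) i).1 (s.fst.hatAt F i)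
  | 0, _, _, _, cons _ (single _) => Sim.refl _
  | _ + 1, _, _, ⟨0, _⟩, cons f (cons g s) =>
    Sim.comp (Sim.associator_hom_congr (s.map_prod_fst F G) (F.map g.1) (F.map f.1))
      (Sim.whiskerLeft_congr (s.map_prod_fst F G) (Sim.refl (F.mapComp g.1 f.1).inv))
  | _ + 1, _, _, ⟨i + 1, h⟩, cons f s =>
    (hatAt_prod_fst F G ⟨i, Nat.lt_of_succ_lt_succ h⟩ s).whiskerRight (F.map f.1)

theorem hatAt_prod_snd (F : A ⥤ᵖ C) (G : B ⥤ᵖ D) : ∀ {m : ℕ} {X Y : A × B} (i : Fin (m + 1))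
    (s : Str (A × B) (m + 1) X Y), Sim (s.hatAt (prodPF F G) i).2 (s.snd.hatAt G i)
  | 0, _, _, _, cons _ (single _) => Sim.refl _
  | _ + 1, _, _, ⟨0, _⟩, cons f (cons g s) =>
    Sim.comp (Sim.associator_hom_congr (s.map_prod_snd F G) (G.map g.2) (G.map f.2))
      (Sim.whiskerLeft_congr (s.map_prod_snd F G) (Sim.refl (G.mapComp g.2 f.2).inv))
  | _ + 1, _, _, ⟨i + 1, h⟩, cons f s =>
    (hatAt_prod_snd F G ⟨i, Nat.lt_of_succ_lt_succ h⟩ s).whiskerRight (G.map f.2)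

/-- The identity 2-morphisms of a string. -/
def Hom.id : ∀ {m : ℕ} {X Y : A} (s : Str A m X Y), Hom s s
  | _, _, _, .single f => .single (𝟙 f)
  | _, _, _, .cons f s => .cons (𝟙 f) (Hom.id s)

theorem Hom.comp_map_id (F : A ⥤ᵖ B) : ∀ {m : ℕ} {X Y : A} (s : Str A m X Y),
    ((Hom.id s).map F).comp = 𝟙 (s.map F).comp
  | _, _, _, .single f => F.map₂_id f
  | _, _, _, .cons f s => by
    change ((Hom.id s).map F).comp ▷ F.map f ≫ (s.map F).comp ◁ F.map₂ (𝟙 f) =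
      𝟙 ((s.map F).comp ≫ F.map f)
    rw [Hom.comp_map_id F s]
    simp

theorem Hom.comp_id : ∀ {m : ℕ} {X Y : A} (s : Str A m X Y), (Hom.id s).comp = 𝟙 s.comp
  | _, _, _, .single f => rfl
  | _, _, _, .cons f s => by
    change (Hom.id s).comp ▷ f ≫ s.comp ◁ 𝟙 f = 𝟙 (s.comp ≫ f)
    rw [Hom.comp_id s]
    simp

/-- The string of 2-morphisms from `(F f_0, …, F f_i ∘ F f_{i+1}, …, F f_{m+1})` to
`(F f_0, …, F (f_i ∘ f_{i+1}), …, F f_{m+1})`. -/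
def hatAtHom (F : A ⥤ᵖ B) : ∀ {m : ℕ} {X Y : A} (i : Fin (m + 1)) (s : Str A (m + 1) X Y),
    Hom ((s.map F).contract i) ((s.contract i).map F)
  | 0, _, _, _, cons f (single g) => .single (F.mapComp g f).inv
  | _ + 1, _, _, ⟨0, _⟩, cons f (cons g s) => .cons (F.mapComp g f).inv (Hom.id (s.map F))
  | _ + 1, _, _, ⟨i + 1, h⟩, cons f s =>
    .cons (𝟙 (F.map f)) (hatAtHom F ⟨i, Nat.lt_of_succ_lt_succ h⟩ s)

theorem whiskerRight_comp_id {X Y Z : A} {f g : X ⟶ Y} (x : f ⟶ g) (k : Y ⟶ Z) :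
    x ▷ k ≫ g ◁ 𝟙 k = x ▷ k := by
  simp

/-- Presents the canonical cell as the composite of a morphism of strings, the only kind of argument
in which families are natural. -/
theorem comp_hatAtHom [Bicategory.Strict B] (F : A ⥤ᵖ B) : ∀ {m : ℕ} {X Y : A} (i : Fin (m + 1))
    (s : Str A (m + 1) X Y), Sim (hatAtHom F i s).comp (s.hatAt F i)
  | 0, _, _, _, cons _ (single _) => Sim.refl _
  | _ + 1, _, _, ⟨0, _⟩, cons f (cons g s) =>
    (Sim.of_eq (by rw [Hom.comp_id]; simp : (Hom.id (s.map F)).comp ▷ (F.map g ≫ F.map f) ≫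
        (s.map F).comp ◁ (F.mapComp g f).inv = (s.map F).comp ◁ (F.mapComp g f).inv)).trans
      (Sim.associator_hom_comp _ _ _ _).symm
  | _ + 1, _, _, ⟨i + 1, h⟩, cons f s =>
    (Sim.of_eq (whiskerRight_comp_id (hatAtHom F ⟨i, Nat.lt_of_succ_lt_succ h⟩ s).comp
      (F.map f))).trans ((comp_hatAtHom F ⟨i, Nat.lt_of_succ_lt_succ h⟩ s).whiskerRight (F.map f))

/-- The composition cell of `F.comp G` is that of `G` followed by `G` of that of `F`, and `hatAtHom`
records the second half. -/
theorem hatAt_comp [Bicategory.Strict C] (F : A ⥤ᵖ B) (G : B ⥤ᵖ C) : ∀ {m : ℕ} {X Y : A}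
    (i : Fin (m + 1)) (s : Str A (m + 1) X Y), Sim (s.hatAt (F.comp G) i)
      ((s.map F).hatAt G i ≫ ((hatAtHom F i s).map G).comp)
  | 0, _, _, _, cons _ (single _) => Sim.refl _
  | _ + 1, _, _, ⟨0, _⟩, cons f (cons g s) => by
    have h : ((α_ ((s.map F).map G).comp (G.map (F.map g)) (G.map (F.map f))).hom ≫
        ((s.map F).map G).comp ◁ (G.mapComp (F.map g) (F.map f)).inv) ≫
        ((Hom.id (s.map F)).map G).comp ▷ G.map (F.map g ≫ F.map f) ≫
          ((s.map F).map G).comp ◁ G.map₂ (F.mapComp g f).inv =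
        (α_ ((s.map F).map G).comp (G.map (F.map g)) (G.map (F.map f))).hom ≫
          ((s.map F).map G).comp ◁ ((G.mapComp (F.map g) (F.map f)).inv ≫
            G.map₂ (F.mapComp g f).inv) := by
      rw [Hom.comp_map_id]
      simp
    exact (Sim.comp (Sim.associator_hom_congr (congrArg Str.comp (s.map_map F G)) _ _)
      (Sim.whiskerLeft_congr (congrArg Str.comp (s.map_map F G)) (Sim.refl _))).trans
        (Sim.of_eq h.symm)
  | _ + 1, _, _, ⟨i + 1, h⟩, cons f s => by
    have e : ∀ {X Y Z : C} {a b c : X ⟶ Y} (x : a ⟶ b) (y : b ⟶ c) {k l : Y ⟶ Z} (z : k ⟶ k)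
        (_ : z = 𝟙 k), (x ≫ y) ▷ k = x ▷ k ≫ y ▷ k ≫ c ◁ z := by
      rintro _ _ _ _ _ _ _ _ _ _ _ rfl
      simp
    exact ((hatAt_comp F G ⟨i, Nat.lt_of_succ_lt_succ h⟩ s).whiskerRight (G.map (F.map f))).trans
      (Sim.of_eq (e (l := G.map (F.map f)) _ _ _ (G.map₂_id (F.map f))))

/-- Coherence: composing two letters beforehand does not affect the canonical cell. Only the merge
at the head of a string with at least three letters needs the associativity axiom of `F`. -/
theorem hatAt_hat [Bicategory.Strict A] [Bicategory.Strict B] (F : A ⥤ᵖ B) : ∀ {m : ℕ} {X Y : A}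
    (i : Fin (m + 1)) (s : Str A (m + 1) X Y),
      Sim (s.hatAt F i ≫ (s.contract i).hat F) (s.hat F)
  | 0, _, _, _, cons f (single g) =>
    Sim.of_eq (by simp : (F.mapComp g f).inv ≫ 𝟙 (F.map (g ≫ f)) =
      𝟙 (F.map g) ▷ F.map f ≫ (F.mapComp g f).inv)
  | _ + 1, _, _, ⟨0, _⟩, cons f (cons g s) =>
    (Sim.of_eq (Category.assoc _ _ _)).trans ((Sim.associator_hom_comp _ _ _ _).trans
      (mapComp_assoc_sim F (s.hat F) g f))
  | _ + 1, _, _, ⟨i + 1, h⟩, cons f s => by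
    have e : ∀ {X Y Z : B} {a b c : X ⟶ Y} (x : a ⟶ b) (y : b ⟶ c) (k : Y ⟶ Z) {d : X ⟶ Z}
        (z : c ≫ k ⟶ d), x ▷ k ≫ y ▷ k ≫ z = (x ≫ y) ▷ k ≫ z := by
      intros
      simp
    exact (Sim.of_eq (e _ _ _ _)).trans
      (Sim.comp ((hatAt_hat F ⟨i, Nat.lt_of_succ_lt_succ h⟩ s).whiskerRight (F.map f))
        (Sim.mapComp_inv F (s.comp_contract ⟨i, Nat.lt_of_succ_lt_succ h⟩) rfl))

end Str

section

variable [Bicategory.Strict A]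

/-- `(f_0, …, f_{m+1}) ↦ ⌈φ (f_0, …, f_i ∘ f_{i+1}, …, f_{m+1})⌉`, on families. -/
def innerFun {m : ℕ} {F : A ⥤ᵖ B} (i : Fin (m + 1)) (φ : Fam m F) : Fam (m + 1) F :=
  fun _ _ s => s.hatAt F i ≫ φ _ _ (s.contract i) ≫ eqToHom (congrArg F.map (s.comp_contract i))

theorem innerFun_sim {m : ℕ} {F : A ⥤ᵖ B} (i : Fin (m + 1)) (φ : Fam m F) {X Y : A}
    (s : Str A (m + 1) X Y) : Sim (innerFun i φ X Y s) (s.hatAt F i ≫ φ _ _ (s.contract i)) :=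
  Sim.comp (Sim.refl _) (Sim.comp_eqToHom _ _)

theorem isNatural_innerFun {m : ℕ} {F : A ⥤ᵖ B} (i : Fin (m + 1)) {φ : Fam m F}
    (hφ : IsNatural φ) : IsNatural (innerFun i φ) := by
  intro X Y s t σ
  change (s.hatAt F i ≫ φ _ _ (s.contract i) ≫ eqToHom _) ≫ F.map₂ σ.comp =
    (σ.map F).comp ≫ t.hatAt F i ≫ φ _ _ (t.contract i) ≫ eqToHom _
  have h := congrArg (fun x => F.map₂ x) (σ.comp_contract i)
  simp only [PrelaxFunctor.map₂_comp, PrelaxFunctor.map₂_eqToHom] at h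
  rw [← reassoc_of% (Str.hatAt_naturality F i σ), ← reassoc_of% (hφ _ _ _ _ (σ.contract i)), h]
  simp

end

/-- On the left ψ is evaluated on a string containing F (f_i ∘ f_{i+1}), on the right on one
containing F f_i ∘ F f_{i+1}. Naturality of ψ along `hatAtHom` makes the two agree. -/
theorem innerFun_star [Bicategory.Strict A] [Bicategory.Strict B] [Bicategory.Strict C] {m : ℕ}
    {F : A ⥤ᵖ B} {G : B ⥤ᵖ C} (i : Fin (m + 1)) (φ : Fam m F) {ψ : Fam m G} (hψ : IsNatural ψ)
    {X Y : A} (s : Str A (m + 1) X Y) :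
    Sim (innerFun i (starFam φ ψ) X Y s) (starFam (innerFun i φ) (innerFun i ψ) X Y s) := by
  have h1 := (innerFun_sim i (starFam φ ψ) s).trans
    (Sim.comp (Str.hatAt_comp F G i s) (starFam_sim φ ψ (s.contract i)))
  have h2 := (starFam_sim (innerFun i φ) (innerFun i ψ) s).trans
    (Sim.comp (innerFun_sim i ψ (s.map F)) (((innerFun_sim i φ s).trans
      (Sim.comp (Str.comp_hatAtHom F i s).symm (Sim.refl (φ _ _ (s.contract i))))).map₂ G))
  have h3 := hψ _ _ _ _ (Str.hatAtHom F i s)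
  -- The hypothesis of `e` is the naturality square `h3`, with x' and x the two values of ψ.
  have e : ∀ {P Q : B} {k a' b' : G.obj P ⟶ G.obj Q} {a b c : P ⟶ Q} (p : k ⟶ a') (q : a' ⟶ b')
      (x : b' ⟶ G.map b) (y : a ⟶ b) (z : b ⟶ c) (x' : a' ⟶ G.map a), x' ≫ G.map₂ y = q ≫ x →
      (p ≫ q) ≫ x ≫ G.map₂ z = (p ≫ x') ≫ G.map₂ (y ≫ z) := by
    intro P Q k a' b' a b c p q x y z x' h
    rw [PrelaxFunctor.map₂_comp, Category.assoc, Category.assoc, reassoc_of% h]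
  exact h1.trans ((Sim.of_eq (e _ _ _ _ _ _ h3)).trans h2.symm)

/-- `φ ↦ ((f_0, …, f_{m+1}) ↦ ⌈φ (f_0, …, f_i ∘ f_{i+1}, …, f_{m+1})⌉)` -/
def innerMap (m : ℕ) (i : Fin (m + 1)) :
    DecorationMap (famDecoration.{w, v, u} m) (famDecoration (m + 1)) where
  app x := ⟨x.1, innerFun i x.2.1, isNatural_innerFun i x.2.2⟩
  app_can F := FamHom.ext rfl fun _ _ s =>
    ((innerFun_sim i (hatFam m F) s).trans (Str.hatAt_hat F i s)).2.2
  app_star x y := FamHom.ext rfl fun _ _ s => (innerFun_star i x.2.1 y.2.2 s).2.2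
  app_prod x y := FamHom.ext rfl fun _ _ s => by
    have h := innerFun_sim i (prodFam x.2.1 y.2.1) s
    exact (Sim.prod
      (h.fst.trans ((Sim.comp (Str.hatAt_prod_fst x.1 y.1 i s) ((prodFam_fst_sim x.2.1 y.2.1 _).trans
        (Sim.fam x.2.1 (s.fst_contract i)))).trans ((innerFun_sim i x.2.1 s.fst).symm.trans
          (prodFam_fst_sim (innerFun i x.2.1) (innerFun i y.2.1) s).symm)))
      (h.snd.trans ((Sim.comp (Str.hatAt_prod_snd x.1 y.1 i s) ((prodFam_snd_sim x.2.1 y.2.1 _).trans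
        (Sim.fam y.2.1 (s.snd_contract i)))).trans ((innerFun_sim i y.2.1 s.snd).symm.trans
          (prodFam_snd_sim (innerFun i x.2.1) (innerFun i y.2.1) s).symm)))).2.2

end Inner

/-! ### The last horizontal coface as a map of decoration calculi. -/

section Last

variable {A : Type u} [Bicategory.{w, v} A] {B : Type u} [Bicategory.{w, v} B]
  {C : Type u} [Bicategory.{w, v} C] {D : Type u} [Bicategory.{w, v} D]

namespace Str

theorem exists_snoc {m : ℕ} {X Y : A} (s : Str A (m + 1) X Y) :
    ∃ (Z : A) (t : Str A m Z Y) (g : X ⟶ Z), s = t.snoc g :=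
  ⟨_, _, _, s.snoc_unsnoc⟩

theorem fst_snoc : ∀ {m : ℕ} {W X Y : A × B} (s : Str (A × B) m X Y) (g : W ⟶ X),
    (s.snoc g).fst = s.fst.snoc g.1
  | _, _, _, _, single _, _ => rfl
  | _, _, _, _, cons f s, g => congrArg (cons f.1) (fst_snoc s g)

theorem snd_snoc : ∀ {m : ℕ} {W X Y : A × B} (s : Str (A × B) m X Y) (g : W ⟶ X),
    (s.snoc g).snd = s.snd.snoc g.2
  | _, _, _, _, single _, _ => rfl
  | _, _, _, _, cons f s, g => congrArg (cons f.2) (snd_snoc s g)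

/-- `hat` is defined by recursion from the head, whereas the last coface needs the final letter
detached; associativity of `F` converts one into the other. -/
theorem hat_snoc [Bicategory.Strict A] [Bicategory.Strict B] (F : A ⥤ᵖ B) : ∀ {m : ℕ} {W X Y : A}
    (s : Str A m X Y) (g : W ⟶ X),
      Sim ((s.snoc g).hat F) (F.map g ◁ s.hat F ≫ (F.mapComp g s.comp).inv)
  | _, _, _, _, single f, g =>
    Sim.of_eq (by simp : 𝟙 (F.map g) ▷ F.map f ≫ (F.mapComp g f).inv =
      F.map g ◁ 𝟙 (F.map f) ≫ (F.mapComp g f).inv)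
  | _, _, _, _, cons f s, g =>
    (Sim.comp ((hat_snoc F s g).whiskerRight (F.map f)) (Sim.mapComp_inv F (s.comp_snoc g) rfl)).trans
      (mapComp_assoc_mid_sim F (s.hat F) g f)

end Str

variable [Bicategory.Strict A] [Bicategory.Strict B]

theorem lastFam_sim {m : ℕ} {F : A ⥤ᵖ B} (φ : Fam m F) {W X Y : A} (s : Str A m X Y) (g : W ⟶ X) :
    Sim (lastFam φ _ _ (s.snoc g)) (F.map g ◁ φ _ _ s ≫ (F.mapComp g s.comp).inv) := by
  -- The decomposition is generalized because `unsnoc` undoes `snoc` only up to a proved equality.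
  have : ∀ (p : Σ Z : A, Str A m Z Y × (W ⟶ Z)) (h : s.snoc g = p.2.1.snoc p.2.2),
      p = ⟨X, s, g⟩ → Sim (lastAux φ (s.snoc g) p h)
        (F.map g ◁ φ _ _ s ≫ (F.mapComp g s.comp).inv) := by
    rintro p h rfl
    exact (Sim.eqToHom_comp _ _).trans (Sim.comp (Sim.refl _) (Sim.comp_eqToHom _ _))
  exact this _ _ (s.unsnoc_snoc g)

theorem lastFam_snoc_eq {m : ℕ} {F : A ⥤ᵖ B} (φ : Fam m F) {W X Y : A} (s : Str A m X Y)
    (g : W ⟶ X) :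
    lastFam φ _ _ (s.snoc g) = eqToHom (by rw [Str.map_snoc, Str.comp_snoc]) ≫
      F.map g ◁ φ _ _ s ≫ (F.mapComp g s.comp).inv ≫ eqToHom (by rw [Str.comp_snoc]) :=
  ((lastFam_sim φ s g).trans ((Sim.eqToHom_comp _ _).trans
    (Sim.comp (Sim.refl _) (Sim.comp_eqToHom _ _))).symm).eq

theorem isNatural_lastFam {m : ℕ} {F : A ⥤ᵖ B} {φ : Fam m F} (hφ : IsNatural φ) :
    IsNatural (lastFam φ) := by
  intro X Y s t σ
  induction σ using Str.Hom.snoc_induction with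
  | @hP m W X Y s t g g' σ τ =>
    rename_i φ hφ
    have h1 := congrArg (fun x => F.map₂ x ≫ eqToHom (congrArg F.map (t.comp_snoc g').symm))
      (σ.comp_snoc τ)
    have h2 := (σ.map F).comp_snoc (F.map₂ τ)
    have h3 := σ.map_snoc F τ
    have h4 := hφ _ _ _ _ σ
    simp only [PrelaxFunctor.map₂_comp, PrelaxFunctor.map₂_eqToHom, Category.assoc,
      eqToHom_trans, eqToHom_refl, Category.comp_id] at h1
    have h5 : ((σ.snoc τ).map F).comp = eqToHom (by rw [Str.map_snoc, Str.comp_snoc]) ≫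
        (F.map₂ τ ▷ (s.map F).comp ≫ F.map g' ◁ (σ.map F).comp) ≫
          eqToHom (by rw [Str.map_snoc, Str.comp_snoc]) := by
      have h6 := congrArg (· ≫ eqToHom (congrArg Str.comp (t.map_snoc F g').symm)) h3
      have h7 := congrArg (· ≫ eqToHom ((t.map F).comp_snoc (F.map g')).symm) h2
      simp only [Category.assoc, eqToHom_trans, eqToHom_refl, Category.comp_id] at h6 h7
      rw [h6, h7]
      simp only [Category.assoc, eqToHom_trans, eqToHom_trans_assoc]
    rw [lastFam_snoc_eq, lastFam_snoc_eq, h1, h5]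
    simp only [Category.assoc, eqToHom_trans_assoc, eqToHom_refl, Category.id_comp,
      Pseudofunctor.map₂_whisker_left, Pseudofunctor.map₂_whisker_right,
      Iso.inv_hom_id_assoc]
    rw [whisker_exchange_assoc, ← whiskerLeft_comp_assoc, h4, whiskerLeft_comp_assoc]

/-- The counterpart of `whiskerRight_mapComp_inv` for prolonging a string at its end. -/
theorem whiskerLeft_mapComp_inv (G : B ⥤ᵖ C) {X Y Z : B} {a : G.obj Y ⟶ G.obj Z} {b c : Y ⟶ Z}
    {f : X ⟶ Y} {d : X ⟶ Z} (x : a ⟶ G.map b) (y : b ⟶ c) (z : f ≫ c ⟶ d) :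
    G.map f ◁ (x ≫ G.map₂ y) ≫ (G.mapComp f c).inv ≫ G.map₂ z =
      (G.map f ◁ x ≫ (G.mapComp f b).inv) ≫ G.map₂ (f ◁ y ≫ z) := by
  simp

theorem lastFam_star [Bicategory.Strict C] {m : ℕ} {F : A ⥤ᵖ B} {G : B ⥤ᵖ C} (φ : Fam m F)
    (ψ : Fam m G) {X Y : A} (s : Str A (m + 1) X Y) :
    Sim (lastFam (starFam φ ψ) X Y s) (starFam (lastFam φ) (lastFam ψ) X Y s) := by
  obtain ⟨Z, s, g, rfl⟩ := s.exists_snoc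
  have h1 := (lastFam_sim (starFam φ ψ) s g).trans
    (Sim.comp ((starFam_sim φ ψ s).whiskerLeft (G.map (F.map g)))
      (Sim.refl ((F.comp G).mapComp g s.comp).inv))
  have h2 := (starFam_sim (lastFam φ) (lastFam ψ) (s.snoc g)).trans
    (Sim.comp ((Sim.fam (lastFam ψ) (s.map_snoc F g)).trans (lastFam_sim ψ (s.map F) (F.map g)))
      ((lastFam_sim φ s g).map₂ G))
  exact h1.trans ((Sim.of_eq (whiskerLeft_mapComp_inv G (ψ _ _ (s.map F)) (φ _ _ s)
    (F.mapComp g s.comp).inv)).trans h2.symm)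

theorem lastFam_prod [Bicategory.Strict C] [Bicategory.Strict D] {m : ℕ} {F : A ⥤ᵖ C} {G : B ⥤ᵖ D}
    (φ : Fam m F) (ψ : Fam m G) {X Y : A × B} (s : Str (A × B) (m + 1) X Y) :
    Sim (lastFam (prodFam φ ψ) X Y s) (prodFam (lastFam φ) (lastFam ψ) X Y s) := by
  obtain ⟨Z, s, g, rfl⟩ := s.exists_snoc
  have h := lastFam_sim (prodFam φ ψ) s g
  refine Sim.prod ?_ ?_
  · exact h.fst.trans ((Sim.comp ((prodFam_fst_sim φ ψ s).whiskerLeft (F.map g.1))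
      (Sim.mapComp_inv F rfl s.comp_fst.symm)).trans ((lastFam_sim φ s.fst g.1).symm.trans
        ((Sim.fam (lastFam φ) (s.fst_snoc g).symm).trans
          (prodFam_fst_sim (lastFam φ) (lastFam ψ) (s.snoc g)).symm)))
  · exact h.snd.trans ((Sim.comp ((prodFam_snd_sim φ ψ s).whiskerLeft (G.map g.2))
      (Sim.mapComp_inv G rfl s.comp_snd.symm)).trans ((lastFam_sim ψ s.snd g.2).symm.trans
        ((Sim.fam (lastFam ψ) (s.snd_snoc g).symm).trans
          (prodFam_snd_sim (lastFam φ) (lastFam ψ) (s.snoc g)).symm)))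

/-- `φ ↦ ((f_0, …, f_{m+1}) ↦ ⌈φ (f_0, …, f_m) ∘ 1_{F f_{m+1}}⌉)` -/
def lastMap (m : ℕ) : DecorationMap (famDecoration.{w, v, u} m) (famDecoration (m + 1)) where
  app x := ⟨x.1, lastFam x.2.1, isNatural_lastFam x.2.2⟩
  app_can F := FamHom.ext rfl fun _ _ s => by
    obtain ⟨Z, s, g, rfl⟩ := s.exists_snoc
    exact ((lastFam_sim (hatFam m F) s g).trans (Str.hat_snoc F s g).symm).2.2
  app_star x y := FamHom.ext rfl fun _ _ s => (lastFam_star x.2.1 y.2.1 s).2.2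
  app_prod x y := FamHom.ext rfl fun _ _ s => (lastFam_prod x.2.1 y.2.1 s).2.2

end Last

/-! ### The horizontal cosimplicial identities, and the relations behind δ_h φ = 0. -/

section Horizontal

section

variable {B : Type u} [Bicategory.{w, v} B] {X Y Z W V : B}

/-- The interchange law, for merging the two head letters and merging two letters further down. -/
theorem whiskerRight_associator_exchange {a b : X ⟶ Y} (x : a ⟶ b) {k : Y ⟶ Z} {l : Z ⟶ W}
    {n : Y ⟶ W} (z : k ≫ l ⟶ n) :
    x ▷ k ▷ l ≫ (α_ b k l).hom ≫ b ◁ z = ((α_ a k l).hom ≫ a ◁ z) ≫ x ▷ n := by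
  rw [Category.assoc, whisker_exchange]
  simp

theorem comp_whiskerRight_comp {a b c : X ⟶ Y} (x : a ⟶ b) (y : b ⟶ c) (k : Y ⟶ Z)
    {d : X ⟶ Z} (z : c ≫ k ⟶ d) : x ▷ k ≫ y ▷ k ≫ z = (x ≫ y) ▷ k ≫ z := by
  simp

theorem whiskerLeft_associator_left (a : X ⟶ Y) (h : Y ⟶ Z) (g : Z ⟶ W) (f : W ⟶ V) {p : Y ⟶ W}
    {q : Y ⟶ V} (x : h ≫ g ⟶ p) (y : p ≫ f ⟶ q) :
    ((α_ a h g).hom ≫ a ◁ x) ▷ f ≫ (α_ a p f).hom ≫ a ◁ y =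
      (α_ a h g).hom ▷ f ≫ (α_ a (h ≫ g) f).hom ≫ a ◁ (x ▷ f ≫ y) := by
  simp

theorem whiskerLeft_associator_right (a : X ⟶ Y) (h : Y ⟶ Z) (g : Z ⟶ W) (f : W ⟶ V) {p : Z ⟶ V}
    {q : Y ⟶ V} (x : g ≫ f ⟶ p) (y : h ≫ p ⟶ q) :
    ((α_ (a ≫ h) g f).hom ≫ (a ≫ h) ◁ x) ≫ (α_ a h p).hom ≫ a ◁ y =
      (α_ (a ≫ h) g f).hom ≫ (α_ a h (g ≫ f)).hom ≫ a ◁ (h ◁ x ≫ y) := by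
  simp

theorem Sim.associator_whiskerRight_comp [Bicategory.Strict B] (a : X ⟶ Y) (h : Y ⟶ Z) (g : Z ⟶ W)
    (f : W ⟶ V) {q : X ⟶ V} (x : (a ≫ h ≫ g) ≫ f ⟶ q) : Sim ((α_ a h g).hom ▷ f ≫ x) x := by
  rw [Strict.associator_eqToIso]
  have e : ∀ {b c : X ⟶ W} (h : b = c) {q : X ⟶ V} (x : c ≫ f ⟶ q),
      Sim (eqToHom h ▷ f ≫ x) x := by
    rintro b _ rfl q x
    exact Sim.of_eq (by simp)
  exact e (Strict.assoc a h g) x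

end

variable {A : Type u} [Bicategory.{w, v} A] {B : Type u} [Bicategory.{w, v} B]
  [Bicategory.Strict A] [Bicategory.Strict B] {m : ℕ} {F : A ⥤ᵖ B}

theorem mapComp_mapComp_sim (F : A ⥤ᵖ B) {X Y Z W : A} (h : X ⟶ Y) (g : Y ⟶ Z) (f : Z ⟶ W) :
    Sim ((F.mapComp h g).inv ▷ F.map f ≫ (F.mapComp (h ≫ g) f).inv)
      (F.map h ◁ (F.mapComp g f).inv ≫ (F.mapComp h (g ≫ f)).inv) := by
  -- The string before the merge is a single letter, whose canonical cell is the identity.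
  have := mapComp_assoc_sim F (𝟙 (F.map h)) g f
  simp only [Bicategory.id_whiskerRight, Category.id_comp] at this
  exact this.symm

theorem inner_zero_firstFun (φ : Fam m F) : innerFun 0 (firstFun φ) = firstFun (firstFun φ) := by
  funext X Y s
  match s with
  | .cons f (.cons g s) =>
    exact ((innerFun_sim 0 (firstFun φ) (.cons f (.cons g s))).trans
      ((Sim.of_eq (Category.assoc _ _ _)).trans ((Sim.associator_hom_comp _ _ _ _).trans
        (mapComp_assoc_sim F (φ _ _ s) g f)))).eq

theorem inner_succ_firstFun (i : Fin (m + 1)) (φ : Fam m F) :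
    innerFun i.succ (firstFun φ) = firstFun (innerFun i φ) := by
  funext X Y s
  match s with
  | .cons f s =>
    exact ((innerFun_sim i.succ (firstFun φ) (.cons f s)).trans
      ((Sim.of_eq (comp_whiskerRight_comp _ _ _ _)).trans
        (Sim.comp ((innerFun_sim i φ s).symm.whiskerRight (F.map f))
          (Sim.mapComp_inv F (s.comp_contract i) rfl)))).eq

theorem last_firstFun (φ : Fam m F) : lastFam (firstFun φ) = firstFun (lastFam φ) := by
  funext X Y s
  match s with
  | .cons f s =>
    obtain ⟨Z, s, g, rfl⟩ := s.exists_snoc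
    exact ((lastFam_sim (firstFun φ) (.cons f s) g).trans
      ((mapComp_assoc_mid_sim F (φ _ _ s) g f).symm.trans
        (Sim.comp ((lastFam_sim φ s g).symm.whiskerRight (F.map f))
          (Sim.mapComp_inv F (s.comp_snoc g).symm rfl)))).eq

namespace Str

theorem contract_contract : ∀ {m : ℕ} {X Y : A} (i j : Fin (m + 1)) (_ : i ≤ j)
    (s : Str A (m + 2) X Y), (s.contract j.succ).contract i = (s.contract i.castSucc).contract j
  | 0, _, _, ⟨0, _⟩, ⟨0, _⟩, _, cons f (cons g (single h)) =>
    congrArg single (Strict.assoc h g f)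
  | 0, _, _, _, ⟨_ + 1, _⟩, _, _ => by omega
  | 0, _, _, ⟨_ + 1, _⟩, _, _, _ => by omega
  | _ + 1, _, _, ⟨0, _⟩, ⟨0, _⟩, _, cons f (cons g (cons h s)) =>
    congrArg (fun x => cons x s) (Strict.assoc h g f)
  | _ + 1, _, _, ⟨0, _⟩, ⟨_ + 1, _⟩, _, cons f (cons g s) => rfl
  | _ + 1, _, _, ⟨_ + 1, _⟩, ⟨0, _⟩, h, _ => by simp at h
  | _ + 1, _, _, ⟨i + 1, hi⟩, ⟨j + 1, hj⟩, h, cons f s =>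
    congrArg (cons f) (contract_contract ⟨i, Nat.lt_of_succ_lt_succ hi⟩
      ⟨j, Nat.lt_of_succ_lt_succ hj⟩ (Nat.le_of_succ_le_succ h) s)

/-- For i = j three consecutive letters are merged, and associativity of `F` decides; for i < j the
merges are disjoint and commute. A common head is removed by induction. -/
theorem hatAt_hatAt (F : A ⥤ᵖ B) : ∀ {m : ℕ} {X Y : A} (i j : Fin (m + 1)) (_ : i ≤ j)
    (s : Str A (m + 2) X Y), Sim (s.hatAt F j.succ ≫ (s.contract j.succ).hatAt F i)
      (s.hatAt F i.castSucc ≫ (s.contract i.castSucc).hatAt F j)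
  | 0, _, _, ⟨0, _⟩, ⟨0, _⟩, _, cons f (cons g (single h)) => by
    exact (mapComp_mapComp_sim F h g f).trans ((Sim.associator_hom_comp _ _ _ _).symm.trans
      (Sim.of_eq (Category.assoc _ _ _).symm))
  | 0, _, _, _, ⟨_ + 1, _⟩, _, _ => by omega
  | 0, _, _, ⟨_ + 1, _⟩, _, _, _ => by omega
  | _ + 1, _, _, ⟨0, _⟩, ⟨0, _⟩, _, cons f (cons g (cons h s)) =>
    (Sim.of_eq (whiskerLeft_associator_left _ _ _ _ _ _)).trans
      ((Sim.associator_whiskerRight_comp _ _ _ _ _).trans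
        ((Sim.associator_hom_comp _ _ _ _).trans
          (((mapComp_mapComp_sim F h g f).whiskerLeft (s.map F).comp).trans
            ((Sim.associator_hom_comp _ _ _ _).symm.trans
              ((Sim.associator_hom_comp _ _ _ _).symm.trans
                (Sim.of_eq (whiskerLeft_associator_right _ _ _ _ _ _).symm))))))
  | _ + 1, _, _, ⟨0, _⟩, ⟨j + 1, hj⟩, _, cons f (cons g s) =>
    Sim.of_eq (whiskerRight_associator_exchange _ _)
  | _ + 1, _, _, ⟨_ + 1, _⟩, ⟨0, _⟩, h, _ => by simp at h
  | _ + 1, _, _, ⟨i + 1, hi⟩, ⟨j + 1, hj⟩, h, cons f s =>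
    (Sim.of_eq (comp_whiskerRight _ _ _).symm).trans (((hatAt_hatAt F
      ⟨i, Nat.lt_of_succ_lt_succ hi⟩ ⟨j, Nat.lt_of_succ_lt_succ hj⟩
      (Nat.le_of_succ_le_succ h) s).whiskerRight (F.map f)).trans
        (Sim.of_eq (comp_whiskerRight _ _ _)))

theorem contract_castSucc_snoc {W : A} : ∀ {m : ℕ} {X Y : A} (i : Fin (m + 1))
    (s : Str A (m + 1) X Y) (g : W ⟶ X),
      (s.snoc g).contract i.castSucc = (s.contract i).snoc g
  | 0, _, _, ⟨0, _⟩, cons _ (single _), _ => rfl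
  | 0, _, _, ⟨_ + 1, _⟩, _, _ => by omega
  | _ + 1, _, _, ⟨0, _⟩, cons _ (cons _ _), _ => rfl
  | _ + 1, _, _, ⟨i + 1, h⟩, cons f s, g =>
    congrArg (cons f) (contract_castSucc_snoc ⟨i, Nat.lt_of_succ_lt_succ h⟩ s g)

theorem contract_last_snoc {V W : A} : ∀ {m : ℕ} {X Y : A} (s : Str A m X Y) (h : W ⟶ X)
    (g : V ⟶ W), ((s.snoc h).snoc g).contract (Fin.last (m + 1)) = s.snoc (g ≫ h)
  | _, _, _, single _, _, _ => rfl
  | _, _, _, cons f s, h, g => congrArg (cons f) (contract_last_snoc s h g)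

theorem comp_map_snoc (F : A ⥤ᵖ B) {W : A} {m : ℕ} {X Y : A} (s : Str A m X Y) (g : W ⟶ X) :
    ((s.snoc g).map F).comp = F.map g ≫ (s.map F).comp := by
  rw [map_snoc, comp_snoc]

theorem hatAt_castSucc_snoc (F : A ⥤ᵖ B) {W : A} : ∀ {m : ℕ} {X Y : A} (i : Fin (m + 1))
    (s : Str A (m + 1) X Y) (g : W ⟶ X),
      Sim ((s.snoc g).hatAt F i.castSucc) (F.map g ◁ s.hatAt F i)
  | 0, _, _, ⟨0, _⟩, cons _ (single _), _ => Sim.associator_hom_comp _ _ _ _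
  | 0, _, _, ⟨_ + 1, _⟩, _, _ => by omega
  | _ + 1, _, _, ⟨0, _⟩, cons f (cons h s), g =>
    (Sim.associator_hom_comp _ _ _ _).trans ((Sim.whiskerLeft_congr (s.comp_map_snoc F g)
      (Sim.refl (F.mapComp h f).inv)).trans ((Sim.whiskerLeft_whiskerLeft _ _ _).symm.trans
        ((Sim.associator_hom_comp _ _ _ _).symm.whiskerLeft (F.map g))))
  | _ + 1, _, _, ⟨i + 1, h⟩, cons f s, g =>
    ((hatAt_castSucc_snoc F ⟨i, Nat.lt_of_succ_lt_succ h⟩ s g).whiskerRight (F.map f)).trans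
      (Sim.whiskerLeft_whiskerRight _ _ _)

theorem hatAt_last_snoc (F : A ⥤ᵖ B) {V W : A} : ∀ {m : ℕ} {X Y : A} (s : Str A m X Y) (h : W ⟶ X)
    (g : V ⟶ W), Sim (((s.snoc h).snoc g).hatAt F (Fin.last (m + 1)))
      ((F.mapComp g h).inv ▷ (s.map F).comp)
  | _, _, _, single _, _, _ => Sim.refl _
  | _, _, _, cons f s, h, g => ((hatAt_last_snoc F s h g).whiskerRight (F.map f)).trans
      (Sim.whiskerRight_whiskerRight _ _ _)

end Str

/-- φ is evaluated on the same string on both sides, so only the canonical cells in front of it have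
to be compared. -/
theorem inner_innerFun (i j : Fin (m + 1)) (h : i ≤ j) (φ : Fam m F) :
    innerFun j.succ (innerFun i φ) = innerFun i.castSucc (innerFun j φ) := by
  funext X Y s
  have h1 := (innerFun_sim j.succ (innerFun i φ) s).trans
    (Sim.comp (Sim.refl (s.hatAt F j.succ)) (innerFun_sim i φ (s.contract j.succ)))
  have h2 := (innerFun_sim i.castSucc (innerFun j φ) s).trans
    (Sim.comp (Sim.refl (s.hatAt F i.castSucc)) (innerFun_sim j φ (s.contract i.castSucc)))
  exact (h1.trans ((Sim.of_eq (Category.assoc _ _ _).symm).trans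
    ((Sim.comp (s.hatAt_hatAt F i j h) (Sim.fam φ (s.contract_contract i j h))).trans
      ((Sim.of_eq (Category.assoc _ _ _)).trans h2.symm)))).eq

theorem whiskerLeft_comp_comp {X Y Z : B} (k : X ⟶ Y) {a b c : Y ⟶ Z} (x : a ⟶ b) (y : b ⟶ c)
    {d : X ⟶ Z} (z : k ≫ c ⟶ d) : k ◁ (x ≫ y) ≫ z = k ◁ x ≫ k ◁ y ≫ z := by
  simp

theorem last_innerFun (i : Fin (m + 1)) (φ : Fam m F) :
    lastFam (innerFun i φ) = innerFun i.castSucc (lastFam φ) := by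
  funext X Y s
  obtain ⟨Z, s, g, rfl⟩ := s.exists_snoc
  have h1 := (lastFam_sim (innerFun i φ) s g).trans
    (Sim.comp ((innerFun_sim i φ s).whiskerLeft (F.map g))
      (Sim.mapComp_inv F rfl (s.comp_contract i).symm))
  have h2 := (innerFun_sim i.castSucc (lastFam φ) (s.snoc g)).trans
    (Sim.comp (s.hatAt_castSucc_snoc F i g) ((Sim.fam (lastFam φ)
      (s.contract_castSucc_snoc i g)).trans (lastFam_sim φ (s.contract i) g)))
  exact (h1.trans ((Sim.of_eq (whiskerLeft_comp_comp _ _ _ _)).trans h2.symm)).eq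

theorem inner_last_lastFam (φ : Fam m F) :
    innerFun (Fin.last _) (lastFam φ) = lastFam (lastFam φ) := by
  funext X Y s
  obtain ⟨Z, s, g, rfl⟩ := s.exists_snoc
  obtain ⟨Z', s, h, rfl⟩ := s.exists_snoc
  have h1 := (innerFun_sim (Fin.last _) (lastFam φ) ((s.snoc h).snoc g)).trans
    (Sim.comp (s.hatAt_last_snoc F h g) ((Sim.fam (lastFam φ) (s.contract_last_snoc h g)).trans
      (lastFam_sim φ s (g ≫ h))))
  have h2 := (lastFam_sim (lastFam φ) (s.snoc h) g).trans
    (Sim.comp ((lastFam_sim φ s h).whiskerLeft (F.map g)) (Sim.mapComp_inv F rfl (s.comp_snoc h)))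
  exact (h1.trans ((mapComp_assoc_sim' F (φ _ _ s) g h).trans h2.symm)).eq

theorem leftUnitFam_sim (n : EndFam F) {X Y : A} (f : X ⟶ Y) :
    Sim (leftUnitFam n X Y (.single f)) (n X ▷ F.map f) := by
  change Sim ((λ_ (F.map f)).inv ≫ n X ▷ F.map f ≫ (λ_ (F.map f)).hom) _
  rw [Strict.leftUnitor_eqToIso]
  exact Sim.eqToHom_comp_eqToHom (Strict.id_comp _).symm _ (Strict.id_comp _)

theorem rightUnitFam_sim (n : EndFam F) {X Y : A} (f : X ⟶ Y) :
    Sim (rightUnitFam n X Y (.single f)) (F.map f ◁ n Y) := by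
  change Sim ((ρ_ (F.map f)).inv ≫ F.map f ◁ n Y ≫ (ρ_ (F.map f)).hom) _
  rw [Strict.rightUnitor_eqToIso]
  exact Sim.eqToHom_comp_eqToHom (Strict.comp_id _).symm _ (Strict.comp_id _)

theorem Sim.id_whiskerLeft {X Y : B} {f g : X ⟶ Y} (x : f ⟶ g) : Sim (𝟙 X ◁ x) x := by
  rw [Bicategory.id_whiskerLeft, Strict.leftUnitor_eqToIso, Strict.leftUnitor_eqToIso]
  exact Sim.eqToHom_comp_eqToHom (Strict.id_comp f) x (Strict.id_comp g).symm

theorem Sim.whiskerRight_id {X Y : B} {f g : X ⟶ Y} (x : f ⟶ g) : Sim (x ▷ 𝟙 Y) x := by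
  rw [Bicategory.whiskerRight_id, Strict.rightUnitor_eqToIso, Strict.rightUnitor_eqToIso]
  exact Sim.eqToHom_comp_eqToHom (Strict.comp_id f) x (Strict.comp_id g).symm

/-- For a composable pair, n sits at the source on both sides, since composing leaves the source
unchanged. The interchange law moves it past the composition cell of `F`. -/
theorem inner_leftUnitFam (n : EndFam F) :
    innerFun 0 (leftUnitFam n) = firstFun (leftUnitFam n) := by
  funext X Y s
  match s with
  | .cons f (.single g) =>
    have h := (innerFun_sim 0 (leftUnitFam n) (.cons f (.single g))).trans
      (Sim.comp (Sim.id_whiskerLeft (F.mapComp g f).inv).symm (leftUnitFam_sim n (g ≫ f)))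
    have h' := Sim.comp ((Sim.whiskerRight_whiskerRight (n X) (F.map g) (F.map f)).symm.trans
      ((leftUnitFam_sim n g).symm.whiskerRight (F.map f)))
        (Sim.id_whiskerLeft (F.mapComp g (Str.single f).comp).inv)
    exact (h.trans ((Sim.of_eq (whisker_exchange (n X) (F.mapComp g f).inv)).trans h')).eq

/-- On both sides n sits at the middle object, the target of one 1-morphism and the source of the
other. -/
theorem first_rightUnitFam (n : EndFam F) :
    firstFun (rightUnitFam n) = lastFam (leftUnitFam n) := by
  funext X Y s
  match s with
  | .cons f (.single g) =>
    have h := (Sim.comp (((rightUnitFam_sim n g).whiskerRight (F.map f)).trans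
      ((Sim.whiskerLeft_whiskerRight _ _ _).trans
        ((leftUnitFam_sim n f).symm.whiskerLeft (F.map g))))
          (Sim.refl (F.mapComp g (Str.single f).comp).inv))
    exact (h.trans (lastFam_sim (leftUnitFam n) (.single f) g).symm).eq

/-- As in `inner_leftUnitFam`, now with n at the common target. -/
theorem inner_rightUnitFam (n : EndFam F) :
    innerFun 0 (rightUnitFam n) = lastFam (rightUnitFam n) := by
  funext X Y s
  match s with
  | .cons f (.single g) =>
    have h := (innerFun_sim 0 (rightUnitFam n) (.cons f (.single g))).trans
      (Sim.comp (Sim.whiskerRight_id (F.mapComp g f).inv).symm (rightUnitFam_sim n (g ≫ f)))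
    have h' := (Sim.comp ((Sim.whiskerLeft_whiskerLeft (F.map g) (F.map f) (n Y)).symm.trans
      ((rightUnitFam_sim n f).symm.whiskerLeft (F.map g)))
        (Sim.whiskerRight_id (F.mapComp g (Str.single f).comp).inv)).trans
          (lastFam_sim (rightUnitFam n) (.single f) g).symm
    exact (h.trans ((Sim.of_eq (whisker_exchange (F.mapComp g f).inv (n Y)).symm).trans h')).eq

end Horizontal

/-! ### Translation of the coboundaries into decorations, and assembly of the double complex. -/

section Assembly

theorem idFam_eq_hatFam {A : Type u} [Bicategory.{w, v} A] (m : ℕ) :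
    idFam (A := A) m = hatFam m (Pseudofunctor.id A) := by
  funext X Y s
  refine ((Sim.of_eq (Category.comp_id (idFam m X Y s)).symm).trans ?_).eq
  exact (Sim.eqToHom_comp (congrArg Str.comp s.map_id) (𝟙 s.comp)).trans
    (hat_sim_id (Pseudofunctor.id A) (fun _ _ => Sim.refl _) s).symm

variable {K : Type*} [CommRing K] {A : Type u} [Bicategory.{w, v} A] {B : Type u}
  [Bicategory.{w, v} B] [∀ X Y : B, Preadditive (X ⟶ Y)] [∀ X Y : B, Linear K (X ⟶ Y)]

/-- The pseudofunctor with a natural family given by a cochain. -/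
def cochainHom {m : ℕ} {F : A ⥤ᵖ B} (φ : Cochain K m F) : FamHom m A B :=
  ⟨F, φ.1, φ.2⟩

theorem cochainHom_injective {m : ℕ} {F : A ⥤ᵖ B} :
    Function.Injective (cochainHom : Cochain K m F → FamHom m A B) := by
  intro φ ψ h
  exact Subtype.ext (congrArg Subtype.val (eq_of_heq (Sigma.mk.inj h).2))

/-- With injectivity of `cochainHom`, this reduces identities between cofaces with transports to
transport-free ones in the sigma type. -/
theorem cochainHom_castCochain {m : ℕ} {F F' : A ⥤ᵖ B} (h : F = F') (φ : Cochain K m F) :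
    cochainHom (castCochain K m h φ) = cochainHom φ := by
  subst h
  rfl

/-- The pseudofunctor with a family of endomorphisms of identities given by the family. -/
def endHom {F : A ⥤ᵖ B} (n : EndFam F) : EndHom A B :=
  ⟨F, n⟩

theorem endHom_injective {F : A ⥤ᵖ B} : Function.Injective (endHom : EndFam F → EndHom A B) :=
  sigma_mk_injective

variable [Bicategory.Strict B] [IsLinearTwoCategory K B] (G : GraySemigroup K B)

theorem cochainHom_dvFirst (m n : ℕ) (φ : Xext G m n) :
    cochainHom (dvFirst G m n φ) = (famDecoration m).first G.tensor n (cochainHom φ) := by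
  refine FamHom.ext rfl fun X Y s => heq_of_eq ?_
  change postFam G.tensor (prodFam (idFam m) φ.1) X Y s =
    postFam G.tensor (prodFam (hatFam m (Pseudofunctor.id B)) φ.1) X Y s
  rw [idFam_eq_hatFam]

theorem cochainHom_dvInner (m n : ℕ) (i : Fin (n + 1)) (φ : Xext G m n) :
    cochainHom (dvInner G m n i φ) = (famDecoration m).inner G.tensor n i (cochainHom φ) :=
  cochainHom_castCochain _ _

theorem cochainHom_rightTensor (m : ℕ) {F : A ⥤ᵖ B} (φ : Cochain K m F) :
    cochainHom (rightTensor G m F φ) = (famDecoration m).right G.tensor (cochainHom φ) := by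
  refine FamHom.ext rfl fun X Y s => heq_of_eq ?_
  change postFam G.tensor (prodFam φ.1 (idFam m)) X Y s =
    postFam G.tensor (prodFam φ.1 (hatFam m (Pseudofunctor.id B))) X Y s
  rw [idFam_eq_hatFam]

theorem cochainHom_dvLast (m n : ℕ) (φ : Xext G m n) :
    cochainHom (dvLast G m n φ) = (famDecoration m).last G.tensor n (cochainHom φ) :=
  (cochainHom_castCochain _ _).trans (congrArg ((famDecoration m).pull (splitLast n))
    (cochainHom_rightTensor G m φ))

theorem endHom_cast {F F' : A ⥤ᵖ B} (h : F = F') (n : EndFam F) :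
    endHom (EndFam.cast K h n) = endHom n := by
  subst h
  rfl

/-- `pull` adds a factor, the conjugate of an identity by the unit cell of `F`, which is trivial. -/
theorem endHom_pullback {C : Type u} [Bicategory.{w, v} C] (P : C ⥤ᵖ A) {F : A ⥤ᵖ B} (x : EndFam F) :
    endHom (EndFam.pullback K P F x) = endDecoration.pull P (endHom x) :=
  EndHom.ext rfl fun X => heq_of_eq
    ((congrArg (x (P.obj X) ≫ ·) (EndHom.conj_id F (P.obj X))).trans (Category.comp_id _)).symm

theorem endHom_dpentFirst (n : ℕ) (x : Pent G n) :
    endHom (dpentFirst G n x) = endDecoration.first G.tensor n (endHom x) :=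
  EndHom.ext rfl fun _ => heq_of_eq (Category.id_comp _).symm

theorem endHom_dpentInner (n : ℕ) (i : Fin (n + 1)) (x : Pent G n) :
    endHom (dpentInner G n i x) = endDecoration.inner G.tensor n i (endHom x) := by
  rw [dpentInner, LinearMap.comp_apply, endHom_cast, endHom_pullback]
  rfl

theorem endHom_rightTensor {F : A ⥤ᵖ B} (x : EndFam F) :
    endHom (EndFam.rightTensor G F x) = endDecoration.right G.tensor (endHom x) :=
  EndHom.ext rfl fun _ => heq_of_eq (Category.id_comp _).symm

theorem endHom_dpentLast (n : ℕ) (x : Pent G n) :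
    endHom (dpentLast G n x) = endDecoration.last G.tensor n (endHom x) := by
  rw [dpentLast, LinearMap.comp_apply, endHom_cast, LinearMap.comp_apply, endHom_pullback,
    endHom_rightTensor]
  rfl

theorem dv_comp_dv (m n : ℕ) : dv G m (n + 1) ∘ₗ dv G m n = 0 := by
  -- Injectivity of `cochainHom` turns the six hypotheses into the six identities of the calculus
  -- `famDecoration m`.
  refine alternating_comp_alternating n _ _ _ _ _ _ ?_ ?_ ?_ ?_ ?_ ?_ <;> intros <;>
    refine LinearMap.ext fun φ => cochainHom_injective ?_ <;>
    simp only [LinearMap.comp_apply, cochainHom_dvFirst, cochainHom_dvInner, cochainHom_dvLast]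
  · exact Decoration.inner_zero_first _ n _ G.assoc
  · exact Decoration.inner_succ_first _ n _ _
  · exact Decoration.last_first _ n _ G.assoc
  · exact Decoration.inner_inner _ n _ G.assoc _ _ ‹_›
  · exact Decoration.last_inner _ n _ _
  · exact Decoration.inner_last_last _ n _ G.assoc

theorem dpent_comp_dpent (n : ℕ) : dpent G (n + 1) ∘ₗ dpent G n = 0 := by
  refine alternating_comp_alternating n _ _ _ _ _ _ ?_ ?_ ?_ ?_ ?_ ?_ <;> intros <;>
    refine LinearMap.ext fun φ => endHom_injective ?_ <;>
    simp only [LinearMap.comp_apply, endHom_dpentFirst, endHom_dpentInner, endHom_dpentLast]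
  · exact Decoration.inner_zero_first _ n _ G.assoc
  · exact Decoration.inner_succ_first _ n _ _
  · exact Decoration.last_first _ n _ G.assoc
  · exact Decoration.inner_inner _ n _ G.assoc _ _ ‹_›
  · exact Decoration.last_inner _ n _ _
  · exact Decoration.inner_last_last _ n _ G.assoc

section Horizontal

variable [Bicategory.Strict A] (m : ℕ) (F : A ⥤ᵖ B)

theorem firstFace_val (φ : Cochain K m F) : (firstFace K m F φ).1 = firstFun φ.1 := by
  funext X Y s
  cases s
  rfl

theorem innerFace_val (i : Fin (m + 1)) (φ : Cochain K m F) :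
    (innerFace K m F i φ).1 = innerFun i φ.1 :=
  rfl

theorem lastFace_val (φ : Cochain K m F) : (lastFace K m F φ).1 = lastFam φ.1 :=
  rfl

theorem deltaH_comp_deltaH : deltaH K (m + 1) F ∘ₗ deltaH K m F = 0 := by
  refine alternating_comp_alternating m _ _ _ _ _ _ ?_ ?_ ?_ ?_ ?_ ?_ <;> intros <;>
    refine LinearMap.ext fun φ => Subtype.ext ?_ <;>
    simp only [LinearMap.comp_apply, firstFace_val, innerFace_val, lastFace_val]
  · exact inner_zero_firstFun φ.1
  · exact inner_succ_firstFun _ φ.1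
  · exact last_firstFun φ.1
  · exact inner_innerFun _ _ ‹_› φ.1
  · exact last_innerFun _ φ.1
  · exact inner_last_lastFam φ.1

theorem cochainHom_firstFace (φ : Cochain K m F) :
    cochainHom (firstFace K m F φ) = (firstMap m).app (cochainHom φ) :=
  FamHom.ext rfl fun X Y s => heq_of_eq (congrFun (congrFun (congrFun (firstFace_val m F φ) X) Y) s)

theorem cochainHom_innerFace (i : Fin (m + 1)) (φ : Cochain K m F) :
    cochainHom (innerFace K m F i φ) = (innerMap m i).app (cochainHom φ) :=
  rfl

theorem cochainHom_lastFace (φ : Cochain K m F) :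
    cochainHom (lastFace K m F φ) = (lastMap m).app (cochainHom φ) :=
  rfl

end Horizontal

section Commute

variable {M₀ M₁ N₀ N₁ : Type*} [AddCommGroup M₀] [AddCommGroup M₁] [AddCommGroup N₀]
  [AddCommGroup N₁] [Module K M₀] [Module K M₁] [Module K N₀] [Module K N₁]

theorem alternating_comp_comm {n : ℕ} {f l : M₀ →ₗ[K] M₁} {c : Fin n → M₀ →ₗ[K] M₁}
    {f' l' : N₀ →ₗ[K] N₁} {c' : Fin n → N₀ →ₗ[K] N₁} {h : M₀ →ₗ[K] N₀} {h' : M₁ →ₗ[K] N₁}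
    (hf : f' ∘ₗ h = h' ∘ₗ f) (hc : ∀ i, c' i ∘ₗ h = h' ∘ₗ c i) (hl : l' ∘ₗ h = h' ∘ₗ l)
    (s : Fin n → K) (t : K) : (f' + ∑ i, s i • c' i + t • l') ∘ₗ h =
      h' ∘ₗ (f + ∑ i, s i • c i + t • l) := by
  have hc' : (∑ i, s i • c' i) ∘ₗ h = h' ∘ₗ ∑ i, s i • c i := by
    ext x
    simp [fun i => show c' i (h x) = h' (c i x) from LinearMap.congr_fun (hc i) x]
  rw [LinearMap.add_comp, LinearMap.add_comp, LinearMap.smul_comp, LinearMap.comp_add,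
    LinearMap.comp_add, LinearMap.comp_smul, hf, hc', hl]

/-- Meant for p = φ = r - l, with r and l the two insertions of n: only r and l separately come from
maps of decoration calculi. -/
theorem comp_comm_of_add_eq {p r l : M₀ →ₗ[K] N₀} {p' r' l' : M₁ →ₗ[K] N₁} {d : M₀ →ₗ[K] M₁}
    {d' : N₀ →ₗ[K] N₁} (h : r = p + l) (h' : r' = p' + l') (hr : d' ∘ₗ r = r' ∘ₗ d)
    (hl : d' ∘ₗ l = l' ∘ₗ d) : d' ∘ₗ p = p' ∘ₗ d := by
  rw [eq_sub_of_add_eq h.symm, eq_sub_of_add_eq h'.symm, LinearMap.comp_sub, LinearMap.sub_comp, hr,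
    hl]

theorem alternating_comp_eq_zero {f l : M₁ →ₗ[K] N₁} {c : Fin 1 → M₁ →ₗ[K] N₁}
    {p r q : M₀ →ₗ[K] M₁} (h : r = p + q) (h1 : c 0 ∘ₗ q = f ∘ₗ q) (h2 : f ∘ₗ r = l ∘ₗ q)
    (h3 : c 0 ∘ₗ r = l ∘ₗ r) :
    (f + ∑ i : Fin 1, (-1 : K) ^ (i.val + 1) • c i + (-1 : K) ^ 2 • l) ∘ₗ p = 0 := by
  -- In degree 0 there is a single inner coface; on p = r - q the six terms of the sum cancel in
  -- pairs by `h1`, `h2` and `h3`.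
  have h4 : f + ∑ i : Fin 1, (-1 : K) ^ (i.val + 1) • c i + (-1 : K) ^ 2 • l = f - c 0 + l := by
    ext x
    simp [sub_eq_add_neg]
  rw [h4, eq_sub_of_add_eq h.symm, LinearMap.add_comp, LinearMap.sub_comp, LinearMap.comp_sub,
    LinearMap.comp_sub, LinearMap.comp_sub, h1, h2, h3]
  abel

/-- The off-diagonal entry is d' p - p' e; the minus sign in the second component of the cone makes
it vanish for a cochain map. -/
theorem cone_comp_cone {M₂ N₂ : Type*} [AddCommGroup M₂] [AddCommGroup N₂] [Module K M₂]
    [Module K N₂] {d : M₀ →ₗ[K] M₁} {d' : M₁ →ₗ[K] M₂} {e : N₀ →ₗ[K] N₁} {e' : N₁ →ₗ[K] N₂}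
    {p : N₀ →ₗ[K] M₁} {p' : N₁ →ₗ[K] M₂} (hd : d' ∘ₗ d = 0) (he : e' ∘ₗ e = 0)
    (hp : d' ∘ₗ p = p' ∘ₗ e) :
    ((d' ∘ₗ LinearMap.fst K _ _ + p' ∘ₗ LinearMap.snd K _ _).prod (-(e' ∘ₗ LinearMap.snd K _ _))) ∘ₗ
      ((d ∘ₗ LinearMap.fst K _ _ + p ∘ₗ LinearMap.snd K _ _).prod (-(e ∘ₗ LinearMap.snd K _ _))) =
        0 := by
  refine LinearMap.ext fun x => Prod.ext ?_ ?_
  · have h1 := LinearMap.congr_fun hd x.1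
    have h2 := LinearMap.congr_fun hp x.2
    simp only [LinearMap.comp_apply, LinearMap.zero_apply] at h1 h2
    simp [h1, h2]
  · have h := LinearMap.congr_fun he x.2
    simp only [LinearMap.comp_apply, LinearMap.zero_apply] at h
    simp [h]

end Commute

theorem dv_comp_of_decorationMap {m m' : ℕ} (f : DecorationMap (famDecoration.{w, v, u} m)
    (famDecoration m')) (h : ∀ n, Xext G m n →ₗ[K] Xext G m' n)
    (hf : ∀ n φ, cochainHom (h n φ) = f.app (cochainHom φ)) (n : ℕ) :
    dv G m' n ∘ₗ h n = h (n + 1) ∘ₗ dv G m n := by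
  refine alternating_comp_comm ?_ (fun i => ?_) ?_ _ _ <;>
    refine LinearMap.ext fun φ => cochainHom_injective ?_ <;>
    simp only [LinearMap.comp_apply, cochainHom_dvFirst, cochainHom_dvInner, cochainHom_dvLast, hf]
  · exact (f.app_first _ _ _).symm
  · exact (f.app_inner _ _ _ _).symm
  · exact (f.app_last _ _ _).symm

theorem dv_comp_dh (m n : ℕ) : dv G (m + 1) n ∘ₗ dh G m n = dh G m (n + 1) ∘ₗ dv G m n := by
  have hf := dv_comp_of_decorationMap G (firstMap m)
    (fun n => firstFace K m (tensorPow G.tensor n)) (fun n => cochainHom_firstFace m _) n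
  have hi := fun i => dv_comp_of_decorationMap G (innerMap m i)
    (fun n => innerFace K m (tensorPow G.tensor n) i) (fun n => cochainHom_innerFace m _ i) n
  have hl := dv_comp_of_decorationMap G (lastMap m)
    (fun n => lastFace K m (tensorPow G.tensor n)) (fun n => cochainHom_lastFace m _) n
  -- The second use of linearity: δ_v is already a full sum in `hf`, `hi` and `hl`, and the
  -- summation is now over the cofaces of δ_h.
  exact (alternating_comp_comm hf.symm (fun i => (hi i).symm) hl.symm _ _).symm

/-- `n ↦ (f ↦ 1_{F f} ∘ n_X)`, as a cochain. -/
def leftUnit (F : A ⥤ᵖ B) : EndFam F →ₗ[K] Cochain K 0 F where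
  toFun n := ⟨leftUnitFam n, isNatural_leftUnitFam n⟩
  map_add' n n' := by
    refine Subtype.ext (funext fun X => funext fun Y => funext fun s => ?_)
    cases s with
    | single f =>
      change (λ_ (F.map f)).inv ≫ (n X + n' X) ▷ F.map f ≫ (λ_ (F.map f)).hom =
        (λ_ (F.map f)).inv ≫ n X ▷ F.map f ≫ (λ_ (F.map f)).hom +
          (λ_ (F.map f)).inv ≫ n' X ▷ F.map f ≫ (λ_ (F.map f)).hom
      rw [IsLinearTwoCategory.add_whiskerRight (C := B) K, Preadditive.add_comp,
        Preadditive.comp_add]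
  map_smul' k n := by
    refine Subtype.ext (funext fun X => funext fun Y => funext fun s => ?_)
    cases s with
    | single f =>
      change (λ_ (F.map f)).inv ≫ (k • n X) ▷ F.map f ≫ (λ_ (F.map f)).hom =
        k • ((λ_ (F.map f)).inv ≫ n X ▷ F.map f ≫ (λ_ (F.map f)).hom)
      rw [IsLinearTwoCategory.smul_whiskerRight, Linear.smul_comp, Linear.comp_smul]

/-- `n ↦ (f ↦ n_Y ∘ 1_{F f})`, as a cochain. -/
def rightUnit (F : A ⥤ᵖ B) : EndFam F →ₗ[K] Cochain K 0 F :=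
  phiOf K F + leftUnit F

/-- `rightUnit` is defined as φ plus `leftUnit`, so its linearity is inherited and φ is a difference
by definition; here the subtracted term cancels. -/
theorem rightUnit_val {F : A ⥤ᵖ B} (n : EndFam F) :
    (rightUnit (K := K) F n).1 = rightUnitFam n := by
  funext X Y s
  cases s with
  | single f => exact sub_add_cancel (rightUnitFam n X Y (.single f)) _

variable [Bicategory.Strict A]

theorem cochainHom_leftUnit {F : A ⥤ᵖ B} (n : EndFam F) :
    cochainHom (leftUnit (K := K) F n) = leftUnitMap.app (endHom n) :=
  rfl

theorem cochainHom_rightUnit {F : A ⥤ᵖ B} (n : EndFam F) :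
    cochainHom (rightUnit (K := K) F n) = rightUnitMap.app (endHom n) :=
  FamHom.ext rfl fun X Y s => heq_of_eq (congrFun (congrFun (congrFun (rightUnit_val n) X) Y) s)

theorem dv_comp_of_unitMap (f : DecorationMap endDecoration.{w, v, u} (famDecoration 0))
    (h : ∀ n, Pent G n →ₗ[K] Xext G 0 n) (hf : ∀ n x, cochainHom (h n x) = f.app (endHom x))
    (n : ℕ) : dv G 0 n ∘ₗ h n = h (n + 1) ∘ₗ dpent G n := by
  refine alternating_comp_comm ?_ (fun i => ?_) ?_ _ _ <;>
    refine LinearMap.ext fun φ => cochainHom_injective ?_ <;>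
    simp only [LinearMap.comp_apply, cochainHom_dvFirst, cochainHom_dvInner, cochainHom_dvLast,
      endHom_dpentFirst, endHom_dpentInner, endHom_dpentLast, hf]
  · exact (f.app_first _ _ _).symm
  · exact (f.app_inner _ _ _ _).symm
  · exact (f.app_last _ _ _).symm

theorem dv_comp_phi (n : ℕ) : dv G 0 n ∘ₗ phi G n = phi G (n + 1) ∘ₗ dpent G n := by
  have hr := dv_comp_of_unitMap G rightUnitMap (fun n => rightUnit (tensorPow G.tensor n))
    (fun n => cochainHom_rightUnit) n
  have hl := dv_comp_of_unitMap G leftUnitMap (fun n => leftUnit (tensorPow G.tensor n))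
    (fun n => cochainHom_leftUnit) n
  exact comp_comm_of_add_eq rfl rfl hr hl

/-- The insertions of n at the source, in the middle and at the target cancel, by `h1`, `h2` and
`h3` respectively. -/
theorem deltaH_comp_phiOf (F : A ⥤ᵖ B) : deltaH K 0 F ∘ₗ phiOf K F = 0 := by
  have h1 : innerFace K 0 F 0 ∘ₗ leftUnit F = firstFace K 0 F ∘ₗ leftUnit F := by
    refine LinearMap.ext fun n => Subtype.ext ?_
    rw [LinearMap.comp_apply, LinearMap.comp_apply, firstFace_val, innerFace_val]
    exact inner_leftUnitFam n
  have h2 : firstFace K 0 F ∘ₗ rightUnit F = lastFace K 0 F ∘ₗ leftUnit F := by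
    refine LinearMap.ext fun n => Subtype.ext ?_
    rw [LinearMap.comp_apply, LinearMap.comp_apply, firstFace_val, lastFace_val, rightUnit_val]
    exact first_rightUnitFam n
  have h3 : innerFace K 0 F 0 ∘ₗ rightUnit F = lastFace K 0 F ∘ₗ rightUnit F := by
    refine LinearMap.ext fun n => Subtype.ext ?_
    rw [LinearMap.comp_apply, LinearMap.comp_apply, innerFace_val, lastFace_val, rightUnit_val]
    exact inner_rightUnitFam n
  exact alternating_comp_eq_zero rfl h1 h2 h3

theorem dcone_comp_dcone (n : ℕ) : dcone G (n + 1) ∘ₗ dcone G n = 0 :=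
  cone_comp_cone (dv_comp_dv G 0 n) (dpent_comp_dpent G (n + 1)) (dv_comp_phi G (n + 1))

theorem dh_comp_dh (m n : ℕ) : dh G (m + 1) n ∘ₗ dh G m n = 0 :=
  deltaH_comp_deltaH m _

theorem isDoubleComplex_mod : IsDoubleComplex (dhMod G) (dvMod G) where
  dh_comp_dh
    | 0, n => by
      refine ModuleCat.hom_ext (LinearMap.ext fun x => ?_)
      exact LinearMap.congr_fun (dh_comp_dh G 0 n) x.1
    | m + 1, n => ModuleCat.hom_ext (dh_comp_dh G (m + 1) n)
  dv_comp_dv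
    | 0, n => ModuleCat.hom_ext (dcone_comp_dcone G n)
    | m + 1, n => ModuleCat.hom_ext (dv_comp_dv G (m + 1) n)
  comm
    | 0, n => by
      refine ModuleCat.hom_ext (LinearMap.ext fun x => ?_)
      -- δ'_h forgets the pentagonator component, so the cone contributes only the extra term δ_h
      -- φ(n), which is zero.
      change dv G 1 n (dh G 0 n x.1) = dh G 0 (n + 1) (dv G 0 n x.1 + phi G (n + 1) x.2)
      have h1 := LinearMap.congr_fun (dv_comp_dh G 0 n) x.1
      have h2 := LinearMap.congr_fun (deltaH_comp_phiOf (K := K) (tensorPow G.tensor (n + 1))) x.2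
      rw [map_add]
      exact h1.trans ((add_zero _).symm.trans (congrArg (_ + ·) h2.symm))
    | m + 1, n => ModuleCat.hom_ext (dv_comp_dh G (m + 1) n)

end Assembly

end GrayComplex

theorem mainTheorem12 {K : Type*} [CommRing K] {B : Type u} [Bicategory.{w, v} B]
    [Bicategory.Strict B] [∀ X Y : B, Preadditive (X ⟶ Y)] [∀ X Y : B, Linear K (X ⟶ Y)]
    [GrayComplex.IsLinearTwoCategory K B] (G : GrayComplex.GraySemigroup K B) :
    ((∀ n, GrayComplex.dpent G (n + 1) ∘ₗ GrayComplex.dpent G n = 0) ∧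
      (∀ n, GrayComplex.dv G 0 (n + 1) ∘ₗ GrayComplex.dv G 0 n = 0) ∧
      ∀ n, GrayComplex.dv G 0 n ∘ₗ GrayComplex.phi G n =
        GrayComplex.phi G (n + 1) ∘ₗ GrayComplex.dpent G n) ∧
    GrayComplex.IsDoubleComplex (GrayComplex.dhMod G) (GrayComplex.dvMod G) :=
  ⟨⟨GrayComplex.dpent_comp_dpent G, GrayComplex.dv_comp_dv G 0, GrayComplex.dv_comp_phi G⟩,
    GrayComplex.isDoubleComplex_mod G⟩
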